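/- Let $S^{n-1}=\{x\in\mathbb R^n:\|x\|_2=1\}$. The cap with pole $v\in S^{n-1}$ and angular radius $r$ is $\{x\in S^{n-1}:\langle x,v\rangle\ge\cos r\}$, and its normalized volume is its surface measure divided by that of $S^{n-1}$. Write $\ln$ for the natural logarithm and $\log$ for the logarithm to base $2$. There are a deterministic algorithm $A$ and absolute constants $k\in\mathbb N$, $C\in\mathbb R$ and $c>0$ such that the following holds. Let $m=m(n)$ be any integer sequence with $16n\le m\le 2^{o(\sqrt n)}$ (that is, $16n\le m(n)\le 2^{f(n)}$ for all large $n$, for some $f(n)=o(\sqrt n)$ as $n\to\infty$). Then for all sufficiently large $n$, the algorithm $A$ on input $(n,m)$ halts within time $k(m+n)^k$ and outputs $m$ points $v_1,\dots,v_m\in S^{n-1}$ such that $$\langle v_i,v_j\rangle\le\sqrt{\frac{2\ln\frac mn}{n}}\left(1+\frac{C}{\log\frac mn}\right)\qquad\text{for all } i\ne j .$$ Moreover there is a largest $r\in[0,\pi]$ such that the caps of angular radius $r$ around $v_1,\dots,v_m$ have pairwise disjoint interiors, and for this $r$ the density of the packing by these caps, i.e. the sum of their normalized volumes, is at least $$c\cdot\frac{n}{2^n\sqrt{\log\frac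 mn}} .$$ Here an algorithm is a random access machine program (assignments, array writes, branching and while loops over integer variables and integer arrays, with $+,-,\times$, floor division and integer literals), and time is bit (logarithmic) cost: each evaluated subexpression is charged one step plus the binary length of its value, and each executed command or loop test one further step. A point $v_i$ is output exactly, as a nonzero integer vector $u_i$ with $v_i=u_i/\|u_i\|_2$. -/

import Mathlib

open Filter Asymptotics MeasureTheory

namespace SpherePacking

/-! ### Random access machine programs over the integers, with logarithmic (bit) cost

A program is a finite text. It acts on integer variables and on integer arrays, all addressed by
fixed numbers in the text; an array is indexed by arbitrary computed integers. No other constants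
than integer literals occur, and every operation is charged the binary length of all the integers
that it touches, so that time is, up to a polynomial, Turing machine time. -/

/-- A memory state: the values of the variables, and the contents of the arrays. -/
structure State where
  var : ℕ → ℤ
  arr : ℕ → ℤ → ℤ

/-- Integer expressions: literals, variables, array reads, `+`, `-`, `*` and floor division. -/
inductive Expr where
  | lit (z : ℤ)
  | var (x : ℕ)
  | get (a : ℕ) (i : Expr)
  | plus (e₁ e₂ : Expr)
  | minus (e₁ e₂ : Expr)
  | times (e₁ e₂ : Expr)
  | quot (e₁ e₂ : Expr)

/-- The value of an expression (division by zero gives zero). -/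
def Expr.eval (s : State) : Expr → ℤ
  | .lit z => z
  | .var x => s.var x
  | .get a i => s.arr a (i.eval s)
  | .plus e₁ e₂ => e₁.eval s + e₂.eval s
  | .minus e₁ e₂ => e₁.eval s - e₂.eval s
  | .times e₁ e₂ => e₁.eval s * e₂.eval s
  | .quot e₁ e₂ => Int.fdiv (e₁.eval s) (e₂.eval s)

/-- One step plus the binary length of the integer `z`. -/
def wordCost (z : ℤ) : ℕ := 1 + z.natAbs.size

/-- The time to evaluate an expression: every node of the expression is charged one step plus the
binary length of its value. The operands of an operation and the index of an array read are nodes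
themselves, so they are charged too. -/
def Expr.cost (s : State) : Expr → ℕ
  | .lit z => wordCost z
  | .var x => wordCost (s.var x)
  | .get a i => i.cost s + wordCost ((Expr.get a i).eval s)
  | .plus e₁ e₂ => e₁.cost s + e₂.cost s + wordCost ((Expr.plus e₁ e₂).eval s)
  | .minus e₁ e₂ => e₁.cost s + e₂.cost s + wordCost ((Expr.minus e₁ e₂).eval s)
  | .times e₁ e₂ => e₁.cost s + e₂.cost s + wordCost ((Expr.times e₁ e₂).eval s)
  | .quot e₁ e₂ => e₁.cost s + e₂.cost s + wordCost ((Expr.quot e₁ e₂).eval s)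

/-- Programs. The tests of `ite` and `loop` ask whether the expression is positive. -/
inductive Prog where
  | skip
  | assign (x : ℕ) (e : Expr)
  | put (a : ℕ) (i e : Expr)
  | seq (p q : Prog)
  | ite (e : Expr) (p q : Prog)
  | loop (e : Expr) (p : Prog)

/-- The state after assigning `z` to variable `x`. -/
def State.setVar (s : State) (x : ℕ) (z : ℤ) : State :=
  { s with var := Function.update s.var x z }

/-- The state after writing `z` into cell `i` of array `a`. -/
def State.setArr (s : State) (a : ℕ) (i z : ℤ) : State :=
  { s with arr := Function.update s.arr a (Function.update (s.arr a) i z) }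

/-- `Exec p s t s'`: program `p`, started in state `s`, halts after time `t` in state `s'`. -/
inductive Exec : Prog → State → ℕ → State → Prop where
  | skip (s : State) : Exec .skip s 1 s
  | assign (s : State) (x : ℕ) (e : Expr) :
      Exec (.assign x e) s (1 + e.cost s) (s.setVar x (e.eval s))
  | put (s : State) (a : ℕ) (i e : Expr) :
      Exec (.put a i e) s (1 + i.cost s + e.cost s) (s.setArr a (i.eval s) (e.eval s))
  | seq {s s' s'' : State} {p q : Prog} {t t' : ℕ} :
      Exec p s t s' → Exec q s' t' s'' → Exec (.seq p q) s (t + t') s''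
  | ite_pos {s s' : State} {e : Expr} {p q : Prog} {t : ℕ} :
      0 < e.eval s → Exec p s t s' → Exec (.ite e p q) s (1 + e.cost s + t) s'
  | ite_neg {s s' : State} {e : Expr} {p q : Prog} {t : ℕ} :
      e.eval s ≤ 0 → Exec q s t s' → Exec (.ite e p q) s (1 + e.cost s + t) s'
  | loop_done {s : State} {e : Expr} {p : Prog} :
      e.eval s ≤ 0 → Exec (.loop e p) s (1 + e.cost s) s
  | loop_step {s s' s'' : State} {e : Expr} {p : Prog} {t t' : ℕ} :
      0 < e.eval s → Exec p s t s' → Exec (.loop e p) s' t' s'' →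
      Exec (.loop e p) s (1 + e.cost s + t + t') s''

/-- Programs are deterministic: the halting state and the time are determined by the start. -/
theorem Exec.deterministic {p : Prog} {s s₁ s₂ : State} {t₁ t₂ : ℕ}
    (h₁ : Exec p s t₁ s₁) (h₂ : Exec p s t₂ s₂) : t₁ = t₂ ∧ s₁ = s₂ := by
  induction h₁ generalizing t₂ s₂ with
  | skip s => cases h₂; exact ⟨rfl, rfl⟩
  | assign s x e => cases h₂; exact ⟨rfl, rfl⟩
  | put s a i e => cases h₂; exact ⟨rfl, rfl⟩
  | seq _ _ ih₁ ih₂ =>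
    cases h₂ with
    | seq g₁ g₂ =>
      obtain ⟨rfl, rfl⟩ := ih₁ g₁
      obtain ⟨rfl, rfl⟩ := ih₂ g₂
      exact ⟨rfl, rfl⟩
  | ite_pos h _ ih =>
    cases h₂ with
    | ite_pos _ g => obtain ⟨rfl, rfl⟩ := ih g; exact ⟨rfl, rfl⟩
    | ite_neg h' _ => exact absurd h (not_lt.mpr h')
  | ite_neg h _ ih =>
    cases h₂ with
    | ite_neg _ g => obtain ⟨rfl, rfl⟩ := ih g; exact ⟨rfl, rfl⟩
    | ite_pos h' _ => exact absurd h' (not_lt.mpr h)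
  | loop_done h =>
    cases h₂ with
    | loop_done _ => exact ⟨rfl, rfl⟩
    | loop_step h' _ _ => exact absurd h' (not_lt.mpr h)
  | loop_step h _ _ ih₁ ih₂ =>
    cases h₂ with
    | loop_done h' => exact absurd h (not_lt.mpr h')
    | loop_step _ g₁ g₂ =>
      obtain ⟨rfl, rfl⟩ := ih₁ g₁
      obtain ⟨rfl, rfl⟩ := ih₂ g₂
      exact ⟨rfl, rfl⟩

/-- The initial state on input `(n, m)`: variable `0` holds `n`, variable `1` holds `m`, and all
other variables and all array cells hold `0`. -/
def inputState (n m : ℕ) : State where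
  var := fun x => if x = 0 then (n : ℤ) else if x = 1 then (m : ℤ) else 0
  arr := fun _ _ => 0

/-! ### Points and caps on the sphere -/

/-- The unit sphere of `n`-dimensional Euclidean space. -/
abbrev Sphere (n : ℕ) : Type := Metric.sphere (0 : EuclideanSpace ℝ (Fin n)) 1

/-- The `i`-th vector written in array `0`, row by row: its coordinate `j` is in cell `i n + j`. -/
noncomputable def outputVec (s : State) (n i : ℕ) : EuclideanSpace ℝ (Fin n) :=
  WithLp.toLp 2 fun j => (s.arr 0 ((i : ℤ) * (n : ℤ) + ((j : ℕ) : ℤ)) : ℝ)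

/-- The points `v₀, …, v_{m-1}` of the sphere are what the state `s` holds as output: array `0`
contains `m` nonzero integer vectors `uᵢ`, and `vᵢ = uᵢ / ‖uᵢ‖`. -/
def IsOutput (s : State) {n m : ℕ} (v : Fin m → Sphere n) : Prop :=
  ∀ i : Fin m, outputVec s n i ≠ 0 ∧
    (v i : EuclideanSpace ℝ (Fin n)) = ‖outputVec s n i‖⁻¹ • outputVec s n i

/-- The spherical cap with pole `v` and angular radius `r`. -/
def cap {n : ℕ} (v : Sphere n) (r : ℝ) : Set (Sphere n) :=
  {x | Real.cos r ≤ inner ℝ (x : EuclideanSpace ℝ (Fin n)) (v : EuclideanSpace ℝ (Fin n))}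

/-- The normalized volume of a subset of the sphere: its surface measure divided by the surface
measure of the whole sphere. -/
noncomputable def vol {n : ℕ} (S : Set (Sphere n)) : ℝ :=
  (volume : Measure (EuclideanSpace ℝ (Fin n))).toSphere.real S /
    (volume : Measure (EuclideanSpace ℝ (Fin n))).toSphere.real Set.univ

/-- The caps of angular radius `r` around the points `v i` form a packing: no two of them overlap,
that is, they are pairwise disjoint apart from boundary points. -/
def IsCapPacking {n m : ℕ} (v : Fin m → Sphere n) (r : ℝ) : Prop :=
  Pairwise fun i j => Disjoint (interior (cap (v i) r)) (interior (cap (v j) r))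

/-- The radius `r` is the largest one for which the caps around the `v i` form a packing. -/
def IsMaxPackingRadius {n m : ℕ} (v : Fin m → Sphere n) (r : ℝ) : Prop :=
  IsGreatest {ρ : ℝ | ρ ∈ Set.Icc 0 Real.pi ∧ IsCapPacking v ρ} r

/-- The density of a system of caps: the sum of their normalized volumes. -/
noncomputable def capDensity {n m : ℕ} (v : Fin m → Sphere n) (r : ℝ) : ℝ :=
  ∑ i, vol (cap (v i) r)

end SpherePacking

/-! The points are built one at a time. Given earlier vectors v_j of squared norm at most 1 + 6/√n,
the next one is an almost unit vector y with ⟨v_j, y⟩ at most about λ/n for every j, where λ is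
about √(2n ln(m/n)). A random Gaussian vector of covariance 1/n violates one such constraint with
probability about exp(-λ²/(2n)), which is about n/m, so few of the at most m constraints are
critical. A random path that stops moving along a constraint once it becomes critical then loses
only a few of its n dimensions. The proof derandomizes such a path and runs it in exact integer
arithmetic.

The path makes n³ rounds of n steps ±η r_i with η = n⁻². The r_i are the columns of a high power R
of the map `damp`, 1 - κ⁻¹ ∑ v_j v_jᵀ, where j runs over the rows that are heavy at the start of the
round, that is, ⟨v_j, y⟩ ≥ λ/n. R is a contraction that almost annihilates the heavy v_j
(`norm_damp_pow_le`) and fixes their orthogonal complement, so that the trace of R² is at least n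
minus the number of heavy rows (`le_sum_norm_damp_pow_sq`). A power of a polynomial expression in
the v_j replaces the orthogonal projection and needs no linear algebra and no division.

The signs make the first order change of the potential ∑ w_j + m n X² nonpositive. Here w_j is a
multiplicative weight that dominates exp(λ⟨v_j, y⟩ - λ²η²/2 · time), and X collects the cross terms
of ‖y‖², so that ‖y‖² - X grows by η²‖r_i‖² whatever the sign. The second order terms come from X
alone and keep the potential below 21 m (`SignedWalk.potential_le`). Hence X = O(1/√n), and since a
heavy row carries a large weight, after b of the T = n³ rounds at most (n/5) exp(L b/T - L) rows are
heavy, with L = λ²/(2n). Summed over the rounds this is a geometric series, and the final squared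
length is at least 1 - 1/(5L) - O(1/√n). A row that has become heavy hardly moves, so no inner
product ends far above λ/n (`RoundStep.final`). Normalizing costs a factor 1 + O(1/ln(m/n)), which
is the error term of the theorem (`IsThreshold.bound_le`).

The integer λ is found by comparing two explicit products whose quotient approximates n/(1024 m) ·
exp(t²/(2n)). All quantities of the walk are integers over known scales, and only the finished row
is rounded. Their binary length is polynomial because the walk has n⁴ steps, each multiplying the
weights by a number of polynomial length.

For the density, the inner products are below 1/8 = 2(3/4)² - 1, so caps with cosine 3/4 are
disjoint. The cone over such a cap contains an ellipsoid of volume 2⁻ⁿ/5 times that of the ball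
(`vol_cap_ge`). With m ≥ n points this already gives n/(5 · 2ⁿ), without the loss of √log(m/n). -/

namespace SpherePacking

/-! ### Cost accounting for random access machine programs -/

/-- All integers in the memory state are at most `2 ^ B` in absolute value. -/
def Small (B : ℕ) (s : State) : Prop :=
  (∀ x, |s.var x| ≤ 2 ^ B) ∧ ∀ a i, |s.arr a i| ≤ 2 ^ B

/-- The number of nodes of an expression. -/
def Expr.nodes : Expr → ℕ
  | .lit _ => 1
  | .var _ => 1
  | .get _ i => i.nodes + 1
  | .plus e₁ e₂ => e₁.nodes + e₂.nodes + 1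
  | .minus e₁ e₂ => e₁.nodes + e₂.nodes + 1
  | .times e₁ e₂ => e₁.nodes + e₂.nodes + 1
  | .quot e₁ e₂ => e₁.nodes + e₂.nodes + 1

/-- The largest absolute value of a literal in an expression. -/
def Expr.maxLit : Expr → ℕ
  | .lit z => z.natAbs
  | .var _ => 0
  | .get _ i => i.maxLit
  | .plus e₁ e₂ => max e₁.maxLit e₂.maxLit
  | .minus e₁ e₂ => max e₁.maxLit e₂.maxLit
  | .times e₁ e₂ => max e₁.maxLit e₂.maxLit
  | .quot e₁ e₂ => max e₁.maxLit e₂.maxLit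

theorem Int.abs_fdiv_le (a b : ℤ) : |Int.fdiv a b| ≤ |a| := by
  rcases lt_trichotomy b 0 with hb | rfl | hb
  · have h : Int.fdiv a b = Int.fdiv (-a) (-b) := by simp [Int.neg_fdiv_neg]
    rw [h, Int.fdiv_eq_ediv_of_nonneg _ (by omega), ← abs_neg a]
    exact Int.abs_ediv_le_abs _ _
  · simp
  · rw [Int.fdiv_eq_ediv_of_nonneg _ hb.le]
    exact Int.abs_ediv_le_abs _ _

/-- Every operation at most adds the binary lengths of its operands, up to one extra word, so
lengths are bounded by the number of nodes times B. The condition 10 ≤ B accommodates literals up to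
1024. -/
theorem Expr.abs_eval_le {B : ℕ} (hB : 10 ≤ B) {s : State} (hs : Small B s) :
    ∀ e : Expr, e.maxLit ≤ 1024 → |e.eval s| ≤ 2 ^ (B * e.nodes) := by
  have key : ∀ (a b : ℕ) (x y : ℤ), |x| ≤ 2 ^ (B * a) → |y| ≤ 2 ^ (B * b) →
      |x| + |y| ≤ 2 ^ (B * (a + b + 1)) ∧ |x| * |y| ≤ 2 ^ (B * (a + b + 1)) := by
    intro a b x y hx hy
    have hpa : (1 : ℤ) ≤ 2 ^ (B * a) := one_le_pow₀ (by norm_num)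
    have hpb : (1 : ℤ) ≤ 2 ^ (B * b) := one_le_pow₀ (by norm_num)
    have hB2 : (2 : ℤ) ≤ 2 ^ B := by
      calc (2 : ℤ) = 2 ^ 1 := by norm_num
        _ ≤ 2 ^ B := pow_le_pow_right₀ (by norm_num) (by omega)
    have e : (2 : ℤ) ^ (B * (a + b + 1)) = 2 ^ (B * a) * 2 ^ (B * b) * 2 ^ B := by
      rw [← pow_add, ← pow_add]; ring_nf
    have h1 : (0 : ℤ) ≤ (2 ^ (B * a) - 1) * (2 ^ (B * b) - 1) :=
      mul_nonneg (by linarith) (by linarith)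
    have h2 : (0 : ℤ) ≤ 2 ^ (B * a) * 2 ^ (B * b) * (2 ^ B - 2) :=
      mul_nonneg (by positivity) (by linarith)
    rw [e]
    constructor
    · nlinarith
    · have h3 : |x| * |y| ≤ 2 ^ (B * a) * 2 ^ (B * b) :=
        mul_le_mul hx hy (abs_nonneg _) (by positivity)
      nlinarith
  intro e
  induction e with
  | lit z =>
    intro h
    simp only [Expr.maxLit] at h
    simp only [Expr.eval, Expr.nodes, mul_one]
    have h1 : |z| ≤ 1024 := by rw [Int.abs_eq_natAbs]; exact_mod_cast h
    refine h1.trans ?_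
    calc (1024 : ℤ) = 2 ^ 10 := by norm_num
      _ ≤ 2 ^ B := pow_le_pow_right₀ (by norm_num) hB
  | var x => intro _; simpa [Expr.eval, Expr.nodes] using hs.1 x
  | get a i _ =>
    intro _
    simp only [Expr.eval, Expr.nodes]
    exact (hs.2 a _).trans (pow_le_pow_right₀ (by norm_num) (Nat.le_mul_of_pos_right _ (by omega)))
  | plus e₁ e₂ h₁ h₂ =>
    intro h
    simp only [Expr.maxLit, max_le_iff] at h
    exact (abs_add_le _ _).trans (key _ _ _ _ (h₁ h.1) (h₂ h.2)).1
  | minus e₁ e₂ h₁ h₂ =>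
    intro h
    simp only [Expr.maxLit, max_le_iff] at h
    exact (abs_sub _ _).trans (key _ _ _ _ (h₁ h.1) (h₂ h.2)).1
  | times e₁ e₂ h₁ h₂ =>
    intro h
    simp only [Expr.maxLit, max_le_iff] at h
    simp only [Expr.eval, Expr.nodes, abs_mul]
    exact (key _ _ _ _ (h₁ h.1) (h₂ h.2)).2
  | quot e₁ e₂ h₁ h₂ =>
    intro h
    simp only [Expr.maxLit, max_le_iff] at h
    simp only [Expr.eval, Expr.nodes]
    exact (Int.abs_fdiv_le _ _).trans ((h₁ h.1).trans
      (pow_le_pow_right₀ (by norm_num) (Nat.mul_le_mul_left _ (by omega))))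

theorem wordCost_le {z : ℤ} {b : ℕ} (h : |z| ≤ 2 ^ b) : wordCost z ≤ b + 2 := by
  have h1 : z.natAbs < 2 ^ (b + 1) := by
    have : (z.natAbs : ℤ) ≤ 2 ^ b := by rwa [← Int.abs_eq_natAbs]
    have h2 : z.natAbs ≤ 2 ^ b := by exact_mod_cast this
    exact h2.trans_lt (Nat.pow_lt_pow_right (by norm_num) (by omega))
  have := Nat.size_le.2 h1
  unfold wordCost
  omega

theorem Expr.cost_le {B : ℕ} (hB : 10 ≤ B) {s : State} (hs : Small B s) :
    ∀ e : Expr, e.maxLit ≤ 1024 → e.cost s ≤ e.nodes * (B * e.nodes + 2) := by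
  have key : ∀ (a b c₁ c₂ w : ℕ), c₁ ≤ a * (B * a + 2) → c₂ ≤ b * (B * b + 2) →
      w ≤ B * (a + b + 1) + 2 → c₁ + c₂ + w ≤ (a + b + 1) * (B * (a + b + 1) + 2) := by
    intro a b c₁ c₂ w h₁ h₂ h₃
    have : a * (B * a + 2) ≤ a * (B * (a + b + 1) + 2) := by gcongr; omega
    have : b * (B * b + 2) ≤ b * (B * (a + b + 1) + 2) := by gcongr; omega
    nlinarith
  intro e
  induction e with
  | lit z =>
    intro h
    have := wordCost_le (Expr.abs_eval_le hB hs (.lit z) h)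
    simp only [Expr.eval, Expr.nodes] at this
    simpa [Expr.cost, Expr.nodes] using this
  | var x =>
    intro h
    have := wordCost_le (Expr.abs_eval_le hB hs (.var x) h)
    simp only [Expr.eval, Expr.nodes] at this
    simpa [Expr.cost, Expr.nodes] using this
  | get a i h₁ =>
    intro h
    simpa [Expr.cost, Expr.nodes] using key i.nodes 0 _ 0 _ (h₁ h) (by omega)
      (wordCost_le (Expr.abs_eval_le hB hs (.get a i) h))
  | plus e₁ e₂ h₁ h₂ =>
    intro h
    have h' := h
    simp only [Expr.maxLit, max_le_iff] at h'
    exact key _ _ _ _ _ (h₁ h'.1) (h₂ h'.2) (wordCost_le (Expr.abs_eval_le hB hs (.plus e₁ e₂) h))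
  | minus e₁ e₂ h₁ h₂ =>
    intro h
    have h' := h
    simp only [Expr.maxLit, max_le_iff] at h'
    exact key _ _ _ _ _ (h₁ h'.1) (h₂ h'.2)
      (wordCost_le (Expr.abs_eval_le hB hs (.minus e₁ e₂) h))
  | times e₁ e₂ h₁ h₂ =>
    intro h
    have h' := h
    simp only [Expr.maxLit, max_le_iff] at h'
    exact key _ _ _ _ _ (h₁ h'.1) (h₂ h'.2)
      (wordCost_le (Expr.abs_eval_le hB hs (.times e₁ e₂) h))
  | quot e₁ e₂ h₁ h₂ =>
    intro h
    have h' := h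
    simp only [Expr.maxLit, max_le_iff] at h'
    exact key _ _ _ _ _ (h₁ h'.1) (h₂ h'.2) (wordCost_le (Expr.abs_eval_le hB hs (.quot e₁ e₂) h))

/-- The expression is short and has short literals. -/
def Expr.Short (e : Expr) : Prop := e.nodes ≤ 40 ∧ e.maxLit ≤ 1024

instance (e : Expr) : Decidable e.Short := inferInstanceAs (Decidable (_ ∧ _))

theorem Expr.Short.cost_le {B : ℕ} (hB : 10 ≤ B) {s : State} (hs : Small B s) {e : Expr}
    (he : e.Short) : e.cost s ≤ 1600 * B + 80 := by
  refine (Expr.cost_le hB hs e he.2).trans ?_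
  calc e.nodes * (B * e.nodes + 2) ≤ 40 * (B * 40 + 2) := by gcongr <;> exact he.1
    _ = _ := by ring

/-- Started in `s`, the program `p` ends in `s'` after at most `T` elementary commands, in a state
whose entries are at most `2 ^ B` in absolute value. -/
def Runs (B : ℕ) (p : Prog) (s : State) (T : ℕ) (s' : State) : Prop :=
  Small B s' ∧ ∃ t, Exec p s t s' ∧ t ≤ T * (4000 * (B + 1))

theorem Small.setVar {B : ℕ} {s : State} (hs : Small B s) {z : ℤ} (hz : |z| ≤ 2 ^ B) (x : ℕ) :
    Small B (s.setVar x z) := by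
  refine ⟨fun y => ?_, hs.2⟩
  by_cases h : y = x
  · subst h; simpa [State.setVar] using hz
  · simpa [State.setVar, h] using hs.1 y

theorem Small.setArr {B : ℕ} {s : State} (hs : Small B s) {z : ℤ} (hz : |z| ≤ 2 ^ B) (a : ℕ)
    (i : ℤ) : Small B (s.setArr a i z) := by
  refine ⟨hs.1, fun b j => ?_⟩
  by_cases h : b = a
  · subst h
    by_cases hj : j = i
    · subst hj; simpa [State.setArr] using hz
    · simpa [State.setArr, hj] using hs.2 b j
  · simpa [State.setArr, h] using hs.2 b j

@[simp] theorem State.setVar_var (s : State) (x : ℕ) (z : ℤ) (y : ℕ) :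
    (s.setVar x z).var y = if y = x then z else s.var y := by
  simp [State.setVar, Function.update_apply]

@[simp] theorem State.setVar_arr (s : State) (x : ℕ) (z : ℤ) : (s.setVar x z).arr = s.arr := rfl

@[simp] theorem State.setArr_var (s : State) (a : ℕ) (i z : ℤ) : (s.setArr a i z).var = s.var := rfl

@[simp] theorem State.setArr_arr (s : State) (a : ℕ) (i z : ℤ) (b : ℕ) (j : ℤ) :
    (s.setArr a i z).arr b j = if b = a ∧ j = i then z else s.arr b j := by
  by_cases h : b = a
  · subst h; simp [State.setArr, Function.update_apply]
  · simp [State.setArr, h]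

variable {B : ℕ}

theorem Runs.mono {p : Prog} {s s' : State} {T T' : ℕ} (h : Runs B p s T s') (hT : T ≤ T') :
    Runs B p s T' s' := by
  obtain ⟨h1, t, h2, h3⟩ := h
  exact ⟨h1, t, h2, h3.trans (Nat.mul_le_mul_right _ hT)⟩

theorem Runs.assign (hB : 10 ≤ B) {s : State} (hs : Small B s) (x : ℕ) {e : Expr}
    (he : e.Short) {z : ℤ} (hz : e.eval s = z) (hb : |z| ≤ 2 ^ B) :
    Runs B (.assign x e) s 1 (s.setVar x z) := by
  subst hz
  refine ⟨hs.setVar hb x, _, Exec.assign s x e, ?_⟩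
  have := he.cost_le hB hs
  omega

/-- A write evaluates two short expressions, the most that any single command does: 2(1600 B + 80) +
1 is below the unit 4000(B + 1) of `Runs`. -/
theorem Runs.put (hB : 10 ≤ B) {s : State} (hs : Small B s) (a : ℕ) {i e : Expr}
    (hi : i.Short) (he : e.Short) {k z : ℤ} (hk : i.eval s = k) (hz : e.eval s = z)
    (hb : |z| ≤ 2 ^ B) : Runs B (.put a i e) s 1 (s.setArr a k z) := by
  subst hz hk
  refine ⟨hs.setArr hb a _, _, Exec.put s a i e, ?_⟩
  have := he.cost_le hB hs
  have := hi.cost_le hB hs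
  omega

theorem Runs.seq {p q : Prog} {s s' s'' : State} {T T' : ℕ} (h : Runs B p s T s')
    (h' : Runs B q s' T' s'') : Runs B (.seq p q) s (T + T') s'' := by
  obtain ⟨-, t, h2, h3⟩ := h
  obtain ⟨h1', t', h2', h3'⟩ := h'
  exact ⟨h1', _, Exec.seq h2 h2', by rw [add_mul]; omega⟩

theorem Runs.ite (hB : 10 ≤ B) {s : State} (hs : Small B s) {e : Expr} (he : e.Short)
    {p q : Prog} {T : ℕ} {s' : State} (hp : 0 < e.eval s → Runs B p s T s')
    (hq : e.eval s ≤ 0 → Runs B q s T s') : Runs B (.ite e p q) s (T + 1) s' := by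
  have hc := he.cost_le hB hs
  rcases lt_or_ge 0 (e.eval s) with h | h
  · obtain ⟨h1, t, h2, h3⟩ := hp h
    exact ⟨h1, _, Exec.ite_pos h h2, by rw [add_mul]; omega⟩
  · obtain ⟨h1, t, h2, h3⟩ := hq h
    exact ⟨h1, _, Exec.ite_neg h h2, by rw [add_mul]; omega⟩

/-- The invariant is indexed by the number of completed rounds, and the sign of the test is known at
each index. The number of rounds is therefore exactly K, which yields termination and time at once;
the extra 1 pays for the failing last test. -/
theorem Runs.loop (hB : 10 ≤ B) {e : Expr} (he : e.Short) {p : Prog} {Tb : ℕ}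
    (Inv : ℕ → State → Prop) {K : ℕ}
    (hpos : ∀ k < K, ∀ s, Inv k s → 0 < e.eval s) (hend : ∀ s, Inv K s → e.eval s ≤ 0)
    (step : ∀ k < K, ∀ s, Small B s → Inv k s → ∃ s', Runs B p s Tb s' ∧ Inv (k + 1) s')
    {s : State} (hs : Small B s) (h0 : Inv 0 s) :
    ∃ s', Runs B (.loop e p) s (K * (Tb + 1) + 1) s' ∧ Inv K s' := by
  have main : ∀ d k, k + d = K → ∀ s, Small B s → Inv k s →
      ∃ s', Runs B (.loop e p) s (d * (Tb + 1) + 1) s' ∧ Inv K s' := by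
    intro d
    induction d with
    | zero =>
      rintro k rfl s hs hk
      refine ⟨s, ⟨hs, _, Exec.loop_done (hend s hk), ?_⟩, hk⟩
      have := he.cost_le hB hs
      omega
    | succ d ih =>
      intro k hk s hs hI
      obtain ⟨s₁, ⟨hs₁, t, ht, htT⟩, hI₁⟩ := step k (by omega) s hs hI
      obtain ⟨s₂, ⟨hs₂, t₂, ht₂, htT₂⟩, hI₂⟩ := ih (k + 1) (by omega) s₁ hs₁ hI₁
      refine ⟨s₂, ⟨hs₂, _, Exec.loop_step (hpos k (by omega) s hI) ht ht₂, ?_⟩, hI₂⟩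
      have hc := he.cost_le hB hs
      have e1 : ((d + 1) * (Tb + 1) + 1) * (4000 * (B + 1)) =
          (d * (Tb + 1) + 1) * (4000 * (B + 1)) + Tb * (4000 * (B + 1)) + 4000 * (B + 1) := by ring
      omega
  exact main K 0 (by omega) s hs h0

/-! ### Frames and counting loops -/

/-- The states agree outside the variables `S` and the arrays `A`. -/
def Frame (S A : List ℕ) (s s' : State) : Prop :=
  (∀ x, x ∉ S → s'.var x = s.var x) ∧ ∀ a, a ∉ A → s'.arr a = s.arr a

theorem Frame.refl (S A : List ℕ) (s : State) : Frame S A s s := ⟨fun _ _ => rfl, fun _ _ => rfl⟩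

theorem Frame.trans {S A S₁ A₁ S₂ A₂ : List ℕ} {s s₁ s₂ : State} (h₁ : Frame S₁ A₁ s s₁)
    (h₂ : Frame S₂ A₂ s₁ s₂) (hS₁ : S₁ ⊆ S := by decide) (hA₁ : A₁ ⊆ A := by decide)
    (hS₂ : S₂ ⊆ S := by decide) (hA₂ : A₂ ⊆ A := by decide) : Frame S A s s₂ :=
  ⟨fun x hx => (h₂.1 x fun h => hx (hS₂ h)).trans (h₁.1 x fun h => hx (hS₁ h)),
    fun a ha => (h₂.2 a fun h => ha (hA₂ h)).trans (h₁.2 a fun h => ha (hA₁ h))⟩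

theorem Frame.setVar (s : State) (x : ℕ) (z : ℤ) : Frame [x] [] s (s.setVar x z) :=
  ⟨fun y hy => by simp_all, fun _ _ => rfl⟩

theorem Frame.setArr (s : State) (a : ℕ) (i z : ℤ) : Frame [] [a] s (s.setArr a i z) :=
  ⟨fun y hy => rfl, fun b hb => by ext j; simp_all⟩

/-- The loop `for x = 0, …, y - 1 do p`. -/
def forLoop (x y : ℕ) (p : Prog) : Prog :=
  .seq (.assign x (.lit 0))
    (.loop (.minus (.var y) (.var x)) (.seq p (.assign x (.plus (.var x) (.lit 1)))))

/-- The invariant may mention the counter x, so it is required after the increment rather than after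
the body. The overhead is a test and an increment per round, plus the initial assignment and the
last test. -/
theorem Runs.forLoop (hB : 10 ≤ B) {x y : ℕ} {p : Prog} {Tb : ℕ} (Inv : ℕ → State → Prop) {K : ℕ}
    (hK : (K : ℤ) ≤ 2 ^ B) {s : State} (hs : Small B s)
    (hy : ∀ k ≤ K, ∀ s', Inv k s' → s'.var y = K)
    (h0 : Inv 0 (s.setVar x 0))
    (step : ∀ k < K, ∀ s', Small B s' → s'.var x = k → Inv k s' →
      ∃ s'', Runs B p s' Tb s'' ∧ s''.var x = k ∧ Inv (k + 1) (s''.setVar x ((k + 1 : ℕ) : ℤ))) :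
    ∃ s', Runs B (SpherePacking.forLoop x y p) s (K * (Tb + 2) + 2) s' ∧ Inv K s' := by
  have r0 : Runs B (.assign x (.lit 0)) s 1 (s.setVar x 0) :=
    Runs.assign hB hs x (by decide) rfl (by simp)
  obtain ⟨s', hr, hI⟩ := Runs.loop (K := K) (Tb := Tb + 1) (p := .seq p (.assign x (.plus (.var x) (.lit 1))))
    (e := .minus (.var y) (.var x)) hB ⟨by simp [Expr.nodes], by simp [Expr.maxLit]⟩
    (fun k s' => Inv k s' ∧ s'.var x = k)
    (fun k hk s' h => by simp [Expr.eval, hy k hk.le s' h.1, h.2, hk])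
    (fun s' h => by simp [Expr.eval, hy K le_rfl s' h.1, h.2])
    (fun k hk s' hs' h => by
      obtain ⟨s₁, hr, hx, hI⟩ := step k hk s' hs' h.2 h.1
      refine ⟨_, hr.seq (Runs.assign hB hr.1 x (z := ((k + 1 : ℕ) : ℤ))
        ⟨by simp [Expr.nodes], by simp [Expr.maxLit]⟩ (by simp [Expr.eval, hx]) ?_), hI, by simp⟩
      rw [abs_of_nonneg (by positivity)]
      have : ((k + 1 : ℕ) : ℤ) ≤ K := by exact_mod_cast hk
      linarith)
    r0.1 ⟨h0, by simp⟩
  refine ⟨s', (r0.seq hr).mono ?_, hI.1⟩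
  have : K * (Tb + 1 + 1) = K * (Tb + 2) := by ring
  omega

/-- The command that stores the sum of the values of `e` for `x = 0, …, y - 1` in `z`. -/
def sumLoop (x y z : ℕ) (e : Expr) : Prog :=
  .seq (.assign z (.lit 0)) (forLoop x y (.assign z (.plus (.var z) e)))

theorem Runs.sumLoop (hB : 10 ≤ B) {x y z : ℕ} {e : Expr} (he : e.nodes ≤ 30 ∧ e.maxLit ≤ 1024)
    (hxy : y ≠ x) (hyz : y ≠ z) (hxz : x ≠ z) (f : ℕ → ℤ) {K : ℕ} {s : State} (hs : Small B s)
    (hK : s.var y = K)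
    (hf : ∀ k < K, ∀ s', Frame [x, z] [] s s' → s'.var x = k → e.eval s' = f k)
    (hb : ∀ k ≤ K, |∑ i ∈ Finset.range k, f i| ≤ 2 ^ B) :
    ∃ s', Runs B (SpherePacking.sumLoop x y z e) s (K * 3 + 3) s' ∧ Frame [x, z] [] s s' ∧
      s'.var z = ∑ i ∈ Finset.range K, f i := by
  have r0 : Runs B (.assign z (.lit 0)) s 1 (s.setVar z 0) :=
    Runs.assign hB hs z (by decide) rfl (by simp)
  have hK' : (K : ℤ) ≤ 2 ^ B := by
    have := hs.1 y
    rw [hK] at this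
    exact (le_abs_self _).trans this
  obtain ⟨s', hr, hI⟩ := Runs.forLoop hB (x := x) (y := y) (p := .assign z (.plus (.var z) e))
    (Tb := 1) (fun k s' => Frame [x, z] [] s s' ∧ s'.var z = ∑ i ∈ Finset.range k, f i) hK' r0.1
    (fun k _ s' h => by rw [h.1.1 y (by simp [hxy, hyz]), hK])
    ⟨(Frame.setVar s z 0).trans (Frame.setVar _ x 0) (by simp) (by simp) (by simp) (by simp),
      by simp [hxz.symm]⟩
    (fun k hk s' hs' hx h => by
      refine ⟨_, Runs.assign hB hs' z (z := ∑ i ∈ Finset.range (k + 1), f i)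
        ⟨by simp [Expr.nodes]; omega, by simpa [Expr.maxLit] using he.2⟩ ?_ (hb _ hk),
        by simp [hxz, hx], ?_, by simp [hxz.symm]⟩
      · simp [Expr.eval, h.2, hf k hk s' h.1 hx, Finset.sum_range_succ]
      · exact (h.1.trans (S := [x, z]) (A := []) (Frame.setVar s' z _) (by simp) (by simp) (by simp) (by simp)).trans
          (S := [x, z]) (A := []) (Frame.setVar _ x _) (by simp) (by simp) (by simp) (by simp))
  exact ⟨s', (r0.seq hr).mono (by omega), hI.1, hI.2⟩

/-- A loop whose `k`-th round writes `f k` into cell `ix k` of array `a`. -/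
theorem Runs.tabulate (hB : 10 ≤ B) {x y a : ℕ} {p : Prog} {Tb : ℕ} (S : List ℕ) (ix f : ℕ → ℤ)
    {K : ℕ} {s : State} (hs : Small B s) (hxy : y ≠ x) (hyS : y ∉ S) (hxS : x ∉ S)
    (hK : s.var y = K) (hix : ∀ k < K, ∀ k' < K, ix k = ix k' → k = k')
    (step : ∀ k < K, ∀ s', Small B s' → Frame (x :: S) [a] s s' → s'.var x = k →
      (∀ k', k ≤ k' → k' < K → s'.arr a (ix k') = s.arr a (ix k')) →
      (∀ i, (∀ k < K, ix k ≠ i) → s'.arr a i = s.arr a i) →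
      ∃ s'', Runs B p s' Tb s'' ∧ Frame S [a] s' s'' ∧
        s''.arr a = Function.update (s'.arr a) (ix k) (f k)) :
    ∃ s', Runs B (SpherePacking.forLoop x y p) s (K * (Tb + 2) + 2) s' ∧ Frame (x :: S) [a] s s' ∧
      (∀ k < K, s'.arr a (ix k) = f k) ∧ ∀ i, (∀ k < K, ix k ≠ i) → s'.arr a i = s.arr a i := by
  have hK' : (K : ℤ) ≤ 2 ^ B := by
    have := hs.1 y
    rw [hK] at this
    exact (le_abs_self _).trans this
  obtain ⟨s', hr, h1, h2, h3, h4⟩ := Runs.forLoop hB (x := x) (y := y) (p := p) (Tb := Tb)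
    (fun k s' => Frame (x :: S) [a] s s' ∧ (∀ k' < k, s'.arr a (ix k') = f k') ∧
      -- Cells not yet reached keep their old values. This allows bodies that update an array in
      -- place, reading the old entry of the cell they write.
      (∀ k', k ≤ k' → k' < K → s'.arr a (ix k') = s.arr a (ix k')) ∧
      ∀ i, (∀ k < K, ix k ≠ i) → s'.arr a i = s.arr a i) hK' hs
    (fun k _ s' h => by rw [h.1.1 y (by simp [hxy, hyS]), hK])
    ⟨(Frame.setVar s x 0).trans (Frame.refl [] [] _) (by simp) (by simp) (by simp) (by simp),
      by simp, by simp, by simp⟩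
    (fun k hk s' hs' hx h => by
      obtain ⟨s'', hr, hF, hu⟩ := step k hk s' hs' h.1 hx h.2.2.1 h.2.2.2
      refine ⟨s'', hr, by rw [hF.1 x hxS, hx], ?_, ?_, ?_, ?_⟩
      · exact (h.1.trans (S := x :: S) (A := [a]) hF (by simp) (by simp) (by simp) (by simp)).trans
          (Frame.setVar _ x _) (by simp) (by simp) (by simp) (by simp)
      · intro k' hk'
        rw [State.setVar_arr, hu]
        rcases Nat.lt_succ_iff_lt_or_eq.1 hk' with h' | rfl
        · rw [Function.update_of_ne, h.2.1 k' h']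
          intro e
          exact h'.ne (hix k' (by omega) k hk e)
        · simp
      · intro k' h1 h2
        rw [State.setVar_arr, hu, Function.update_of_ne, h.2.2.1 k' (by omega) h2]
        intro e
        have := hix k' h2 k hk e
        omega
      · intro i hi
        rw [State.setVar_arr, hu, Function.update_of_ne (hi k hk).symm, h.2.2.2 i hi])
  exact ⟨s', hr, h1, h2, h4⟩

/-- A loop that writes the value of `e` into cell `i` of array `a`, for `x = 0, …, y - 1`. -/
theorem Runs.tabulate_put (hB : 10 ≤ B) {x y a : ℕ} {i e : Expr} (hi : i.Short) (he : e.Short)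
    (ix f : ℕ → ℤ) {K : ℕ} {s : State} (hs : Small B s) (hxy : y ≠ x)
    (hK : s.var y = K) (hix : ∀ k < K, ∀ k' < K, ix k = ix k' → k = k')
    (hb : ∀ k < K, |f k| ≤ 2 ^ B)
    (step : ∀ k < K, ∀ s', Frame [x] [a] s s' → s'.var x = k →
      (∀ k', k ≤ k' → k' < K → s'.arr a (ix k') = s.arr a (ix k')) →
      (∀ i, (∀ k < K, ix k ≠ i) → s'.arr a i = s.arr a i) →
      i.eval s' = ix k ∧ e.eval s' = f k) :
    ∃ s', Runs B (SpherePacking.forLoop x y (.put a i e)) s (K * 3 + 2) s' ∧ Frame [x] [a] s s' ∧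
      (∀ k < K, s'.arr a (ix k) = f k) ∧ ∀ i, (∀ k < K, ix k ≠ i) → s'.arr a i = s.arr a i :=
  Runs.tabulate hB [] ix f hs hxy (by simp) (by simp) hK hix
    (fun k hk s' hs' h1 h2 h3 h4 => by
      obtain ⟨h5, h6⟩ := step k hk s' h1 h2 h3 h4
      exact ⟨_, Runs.put hB hs' a hi he h5 h6 (hb k hk), Frame.setArr s' a _ _,
        by simp [State.setArr]⟩)


/-! ### Damping the directions of a family of vectors -/

section Damping

open scoped RealInnerProductSpace

variable {V : Type*} [NormedAddCommGroup V] [InnerProductSpace ℝ V]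

/-- Half of the power moves to the other side by symmetry: an even power gives a squared norm, an
odd one the form of A at A^q z. -/
theorem inner_pow_nonneg {A : V →ₗ[ℝ] V} (hA : A.IsSymmetric) (h0 : ∀ z, 0 ≤ ⟪A z, z⟫)
    (k : ℕ) (z : V) : 0 ≤ ⟪(A ^ k) z, z⟫ := by
  rcases Nat.even_or_odd' k with ⟨q, rfl | rfl⟩
  · have : ⟪(A ^ (2 * q)) z, z⟫ = ⟪(A ^ q) z, (A ^ q) z⟫ := by
      rw [two_mul, pow_add, Module.End.mul_apply, (hA.pow q) ((A ^ q) z) z]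
    rw [this]
    exact real_inner_self_nonneg
  · have : ⟪(A ^ (2 * q + 1)) z, z⟫ = ⟪A ((A ^ q) z), (A ^ q) z⟫ := by
      rw [show 2 * q + 1 = q + (1 + q) by ring, pow_add, pow_add, Module.End.mul_apply,
        Module.End.mul_apply, pow_one, (hA.pow q) _ z]
    rw [this]
    exact h0 _

/-- Positivity of the form at z - A z reads 2‖A z‖² ≤ ⟪A z, z⟫ + ⟪A (A z), A z⟫ ≤ ‖z‖² + ‖A z‖².
This replaces the spectral theorem. -/
theorem norm_apply_le_of_inner_le {A : V →ₗ[ℝ] V} (hA : A.IsSymmetric) (h0 : ∀ z, 0 ≤ ⟪A z, z⟫)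
    (h1 : ∀ z, ⟪A z, z⟫ ≤ ‖z‖ ^ 2) (z : V) : ‖A z‖ ≤ ‖z‖ := by
  have h := h0 (z - A z)
  have e : ⟪A (z - A z), z - A z⟫ = ⟪A z, z⟫ - 2 * ‖A z‖ ^ 2 + ⟪A (A z), A z⟫ := by
    rw [map_sub, inner_sub_left, inner_sub_right, inner_sub_right, hA (A z) z,
      real_inner_self_eq_norm_sq]
    ring
  have := h1 z
  have := h1 (A z)
  nlinarith [norm_nonneg z, norm_nonneg (A z)]

theorem norm_pow_apply_le {A : V →ₗ[ℝ] V} (h : ∀ z, ‖A z‖ ≤ ‖z‖) (k : ℕ) (z : V) :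
    ‖(A ^ k) z‖ ≤ ‖z‖ := by
  induction k with
  | zero => simp
  | succ k ih => rw [pow_succ', Module.End.mul_apply]; exact (h _).trans ih

/-- With a k = ⟪A^k z, z⟫, the left side is a (2N) - a (2N+1). The differences a k - a (k+1)
decrease, because the form of A^k at z - A z is nonnegative, and the first 2N+1 of them sum to at
most a 0 = ‖z‖². The last one is at most their average. -/
theorem inner_sub_apply_pow_le {A : V →ₗ[ℝ] V} (hA : A.IsSymmetric) (h0 : ∀ z, 0 ≤ ⟪A z, z⟫)
    (N : ℕ) (z : V) :
    ⟪(A ^ N) z - A ((A ^ N) z), (A ^ N) z⟫ ≤ ‖z‖ ^ 2 / (2 * N + 1) := by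
  set a : ℕ → ℝ := fun k => ⟪(A ^ k) z, z⟫ with ha
  have hanti : Antitone fun k => a k - a (k + 1) := by
    refine antitone_nat_of_succ_le fun k => ?_
    have := inner_pow_nonneg hA h0 k (z - A z)
    have e : ⟪(A ^ k) (z - A z), z - A z⟫ = a k - a (k + 1) - (a (k + 1) - a (k + 1 + 1)) := by
      have e1 : (A ^ k) (A z) = (A ^ (k + 1)) z := by rw [pow_succ, Module.End.mul_apply]
      have e2 : ⟪(A ^ k) z, A z⟫ = a (k + 1) := by
        rw [← hA, ← Module.End.mul_apply, ← pow_succ']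
      have e3 : ⟪(A ^ (k + 1)) z, A z⟫ = a (k + 1 + 1) := by
        rw [← hA, ← Module.End.mul_apply, ← pow_succ']
      rw [map_sub, inner_sub_left, inner_sub_right, inner_sub_right, e1, e2, e3]
    linarith
  have hlast : ⟪(A ^ N) z - A ((A ^ N) z), (A ^ N) z⟫ = a (2 * N) - a (2 * N + 1) := by
    rw [inner_sub_left, ha]
    congr 1
    · simp only
      rw [two_mul, pow_add, Module.End.mul_apply, (hA.pow N) ((A ^ N) z) z]
    · simp only
      rw [show 2 * N + 1 = N + (1 + N) by ring, pow_add, pow_add, Module.End.mul_apply,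
        Module.End.mul_apply, pow_one, (hA.pow N) _ z]
  rw [hlast, le_div_iff₀ (by positivity)]
  have hsum : ∑ k ∈ Finset.range (2 * N + 1), (a k - a (k + 1)) = a 0 - a (2 * N + 1) :=
    Finset.sum_range_sub' _ _
  have hge : ∑ _k ∈ Finset.range (2 * N + 1), (a (2 * N) - a (2 * N + 1)) ≤
      ∑ k ∈ Finset.range (2 * N + 1), (a k - a (k + 1)) :=
    Finset.sum_le_sum fun k hk => hanti (by have := Finset.mem_range.1 hk; omega)
  rw [Finset.sum_const, Finset.card_range, nsmul_eq_mul, hsum] at hge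
  have h1 : 0 ≤ a (2 * N + 1) := inner_pow_nonneg hA h0 _ z
  have h2 : a 0 = ‖z‖ ^ 2 := by simp [ha]
  push_cast at hge
  linarith

variable {ι : Type*}

/-- The map `z ↦ z - κ⁻¹ ∑ ⟨v j, z⟩ v j`. -/
noncomputable def damp (H : Finset ι) (v : ι → V) (κ : ℝ) : V →ₗ[ℝ] V :=
  LinearMap.id - κ⁻¹ • ∑ j ∈ H, ((innerₛₗ ℝ (v j)).smulRight (v j))

theorem damp_apply (H : Finset ι) (v : ι → V) (κ : ℝ) (z : V) :
    damp H v κ z = z - κ⁻¹ • ∑ j ∈ H, ⟪v j, z⟫ • v j := by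
  simp [damp, LinearMap.sum_apply]

theorem inner_damp (H : Finset ι) (v : ι → V) (κ : ℝ) (z w : V) :
    ⟪damp H v κ z, w⟫ = ⟪z, w⟫ - κ⁻¹ * ∑ j ∈ H, ⟪v j, z⟫ * ⟪v j, w⟫ := by
  rw [damp_apply, inner_sub_left, inner_smul_left, sum_inner]
  simp [inner_smul_left]

theorem damp_isSymmetric (H : Finset ι) (v : ι → V) (κ : ℝ) : (damp H v κ).IsSymmetric := by
  intro z w
  rw [inner_damp, real_inner_comm (damp H v κ w) z, inner_damp, real_inner_comm w z]
  congr 2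
  exact Finset.sum_congr rfl fun j _ => mul_comm _ _

/-- By Cauchy-Schwarz the form ∑ ⟪v j, z⟫² is bounded by the trace ∑ ‖v j‖² times ‖z‖², so a κ above
the trace keeps the map positive. -/
theorem inner_damp_self_nonneg {H : Finset ι} {v : ι → V} {κ : ℝ} (hκ : 0 < κ)
    (hH : ∑ j ∈ H, ‖v j‖ ^ 2 ≤ κ) (z : V) : 0 ≤ ⟪damp H v κ z, z⟫ := by
  rw [inner_damp, real_inner_self_eq_norm_sq, sub_nonneg, inv_mul_le_iff₀ hκ]
  calc ∑ j ∈ H, ⟪v j, z⟫ * ⟪v j, z⟫ ≤ ∑ j ∈ H, ‖v j‖ ^ 2 * ‖z‖ ^ 2 := by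
        refine Finset.sum_le_sum fun j _ => ?_
        have := abs_real_inner_le_norm (v j) z
        rw [← abs_mul_abs_self]
        nlinarith [abs_nonneg ⟪v j, z⟫]
    _ = (∑ j ∈ H, ‖v j‖ ^ 2) * ‖z‖ ^ 2 := (Finset.sum_mul ..).symm
    _ ≤ κ * ‖z‖ ^ 2 := by gcongr

theorem inner_damp_self_le {H : Finset ι} {v : ι → V} {κ : ℝ} (hκ : 0 < κ) (z : V) : ⟪damp H v κ z, z⟫ ≤ ‖z‖ ^ 2 := by
  rw [inner_damp, real_inner_self_eq_norm_sq]
  have : 0 ≤ κ⁻¹ * ∑ j ∈ H, ⟪v j, z⟫ * ⟪v j, z⟫ :=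
    mul_nonneg (inv_nonneg.2 hκ.le) (Finset.sum_nonneg fun j _ => mul_self_nonneg _)
  linarith

theorem norm_damp_apply_le {H : Finset ι} {v : ι → V} {κ : ℝ} (hκ : 0 < κ)
    (hH : ∑ j ∈ H, ‖v j‖ ^ 2 ≤ κ) (z : V) : ‖damp H v κ z‖ ≤ ‖z‖ :=
  norm_apply_le_of_inner_le (damp_isSymmetric H v κ) (inner_damp_self_nonneg hκ hH)
    (inner_damp_self_le hκ) z

/-- Put R = damp^N. The single term j of the form of 1 - damp at R (R (v j)) is κ⁻¹‖R (v j)‖⁴, and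
the averaging estimate bounds the whole form by ‖R (v j)‖²/(2N+1). Cancelling ‖R (v j)‖² leaves the
claim, with no lower bound on eigenvalues needed. -/
theorem norm_damp_pow_le {H : Finset ι} {v : ι → V} {κ : ℝ} (hκ : 0 < κ)
    (hH : ∑ j ∈ H, ‖v j‖ ^ 2 ≤ κ) (N : ℕ) {j : ι} (hj : j ∈ H) :
    ‖(damp H v κ ^ N) (v j)‖ ^ 2 ≤ κ / (2 * N + 1) := by
  set R := damp H v κ ^ N with hR
  have hsymm : R.IsSymmetric := (damp_isSymmetric H v κ).pow N
  have h1 := inner_sub_apply_pow_le (damp_isSymmetric H v κ) (inner_damp_self_nonneg hκ hH) N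
    (R (v j))
  rw [← hR] at h1
  have h2 : κ⁻¹ * ⟪v j, R (R (v j))⟫ ^ 2 ≤ ⟪R (R (v j)) - damp H v κ (R (R (v j))), R (R (v j))⟫ := by
    rw [inner_sub_left, inner_damp, sub_sub_cancel]
    gcongr
    rw [sq]
    exact Finset.single_le_sum (f := fun i => ⟪v i, R (R (v j))⟫ * ⟪v i, R (R (v j))⟫)
      (fun i _ => mul_self_nonneg _) hj
  have h3 : ⟪v j, R (R (v j))⟫ = ‖R (v j)‖ ^ 2 := by
    rw [← hsymm, real_inner_self_eq_norm_sq]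
  rw [h3] at h2
  have h4 := h2.trans h1
  rw [inv_mul_le_iff₀ hκ] at h4
  rcases eq_or_ne (‖R (v j)‖ ^ 2) 0 with h | h
  · rw [h]; positivity
  · have hpos : 0 < ‖R (v j)‖ ^ 2 := lt_of_le_of_ne (by positivity) h.symm
    have h5 : ‖R (v j)‖ ^ 2 * ‖R (v j)‖ ^ 2 ≤ κ / (2 * N + 1) * ‖R (v j)‖ ^ 2 := by
      calc ‖R (v j)‖ ^ 2 * ‖R (v j)‖ ^ 2 = (‖R (v j)‖ ^ 2) ^ 2 := by ring
        _ ≤ _ := h4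
        _ = _ := by ring
    exact le_of_mul_le_mul_right h5 hpos

theorem sum_inner_sq_eq {n : ℕ} (b : OrthonormalBasis (Fin n) ℝ V) {R : V →ₗ[ℝ] V}
    (hR : R.IsSymmetric) (z : V) : ∑ i, ⟪R (b i), z⟫ ^ 2 = ‖R z‖ ^ 2 := by
  rw [← b.sum_sq_norm_inner_right (R z)]
  exact Finset.sum_congr rfl fun i _ => by rw [hR, Real.norm_eq_abs, sq_abs]

/-- The sum is the trace of R². The map fixes the orthogonal complement of the span of the v j with
j ∈ H, whose dimension is at least n - |H|, and Bessel's inequality compares the trace with its part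
on that complement. -/
theorem le_sum_norm_damp_pow_sq {n : ℕ} (b : OrthonormalBasis (Fin n) ℝ V) (H : Finset ι)
    (v : ι → V) (κ : ℝ) (N : ℕ) :
    (n : ℝ) - H.card ≤ ∑ i, ‖(damp H v κ ^ N) (b i)‖ ^ 2 := by
  classical
  have hfin : FiniteDimensional ℝ V := Module.Finite.of_basis b.toBasis
  have hdim : Module.finrank ℝ V = n := by
    rw [Module.finrank_eq_card_basis b.toBasis, Fintype.card_fin]
  set R := damp H v κ ^ N with hR
  have hsymm : R.IsSymmetric := (damp_isSymmetric H v κ).pow N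
  set W : Submodule ℝ V := Submodule.span ℝ (v '' (H : Set ι)) with hW
  have hfix : ∀ z ∈ Wᗮ, R z = z := by
    intro z hz
    have h1 : damp H v κ z = z := by
      rw [damp_apply, Finset.sum_eq_zero, smul_zero, sub_zero]
      intro j hj
      rw [(Submodule.mem_orthogonal W z).1 hz (v j) (Submodule.subset_span ⟨j, hj, rfl⟩), zero_smul]
    rw [hR, Module.End.pow_apply]
    exact Function.IsFixedPt.iterate h1 N
  have hWdim : Module.finrank ℝ W ≤ H.card := by
    have := finrank_span_finset_le_card (R := ℝ) (H.image v)
    rw [Finset.coe_image] at this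
    exact this.trans Finset.card_image_le
  have hsumdim := Submodule.finrank_add_finrank_orthogonal W
  set f := stdOrthonormalBasis ℝ (Wᗮ : Submodule ℝ V) with hf
  have hon : Orthonormal ℝ fun k => ((f k : Wᗮ) : V) :=
    f.orthonormal.comp_linearIsometry (Wᗮ).subtypeₗᵢ
  have hB : ∀ i, ∑ k, ⟪((f k : Wᗮ) : V), R (b i)⟫ ^ 2 ≤ ‖R (b i)‖ ^ 2 := by
    intro i
    have := hon.sum_inner_products_le (R (b i)) (s := Finset.univ)
    simpa [sq_abs] using this
  calc (n : ℝ) - H.card ≤ Module.finrank ℝ (Wᗮ : Submodule ℝ V) := by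
        rw [sub_le_iff_le_add]
        have : n ≤ Module.finrank ℝ (Wᗮ : Submodule ℝ V) + H.card := by omega
        exact_mod_cast this
    _ = ∑ k, ‖R ((f k : Wᗮ) : V)‖ ^ 2 := by
        have : ∀ k, ‖R ((f k : Wᗮ) : V)‖ ^ 2 = 1 := fun k => by
          rw [hfix _ (f k).2, hon.1 k, one_pow]
        simp [this]
    _ = ∑ k, ∑ i, ⟪((f k : Wᗮ) : V), R (b i)⟫ ^ 2 := by
        refine Finset.sum_congr rfl fun k _ => ?_
        rw [← sum_inner_sq_eq b hsymm]
        exact Finset.sum_congr rfl fun i _ => by rw [real_inner_comm]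
    _ = ∑ i, ∑ k, ⟪((f k : Wᗮ) : V), R (b i)⟫ ^ 2 := Finset.sum_comm
    _ ≤ _ := Finset.sum_le_sum fun i _ => hB i

end Damping


/-! ### A derandomized walk that avoids half-spaces -/

section Walk

open scoped RealInnerProductSpace

/-- The cubic remainder of log (1 + x) is at most 2|x|³, which |x| ≤ ξ/4 turns into (ξ/2) x². Thus
the factors 1 + x, which are exact in integers, can replace exponentials in the weights. -/
theorem exp_sub_sq_le_one_add {x ξ : ℝ} (hx : |x| ≤ ξ / 4) (hξ : ξ ≤ 1) :
    Real.exp (x - (1 + ξ) / 2 * x ^ 2) ≤ 1 + x := by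
  have hx4 : |x| ≤ 1 / 4 := by linarith
  have hpos : 0 < 1 + x := by have := neg_abs_le x; linarith
  rw [← Real.le_log_iff_exp_le hpos]
  have h := Real.abs_log_sub_add_sum_range_le (x := -x) (by rw [abs_neg]; linarith) 2
  rw [abs_neg] at h
  simp only [Finset.sum_range_succ, Finset.sum_range_zero, sub_neg_eq_add] at h
  have h2 := (abs_le.1 h).1
  have h3 : |x| ^ (2 + 1) / (1 - |x|) ≤ 2 * |x| * x ^ 2 := by
    rw [div_le_iff₀ (by linarith), ← sq_abs x]
    have h5 : 0 ≤ |x| ^ 3 * (1 / 2 - |x|) := mul_nonneg (by positivity) (by linarith)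
    have h6 : 0 ≤ |x| ^ 3 := by positivity
    linear_combination 2 * h5
  have h4 : 2 * |x| * x ^ 2 ≤ ξ / 2 * x ^ 2 := by gcongr; linarith
  norm_num at h2
  linarith

variable {V : Type*} [NormedAddCommGroup V] [InnerProductSpace ℝ V] {ι : Type*}

/-- A walk in the directions `± η r i`, together with multiplicative weights `w` for the vectors
`v j` and a correction `X`, whose signs are chosen so that the potential `∑ w j + γ X ^ 2` does
not increase to first order. -/
structure SignedWalk (J : Finset ι) (v : ι → V) (lam η γ : ℝ) (K : ℕ) (r : ℕ → V) (y : ℕ → V)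
    (w : ℕ → ι → ℝ) (X : ℕ → ℝ) (ε : ℕ → ℝ) : Prop where
  sign : ∀ i < K, ε i = 1 ∨ ε i = -1
  y_succ : ∀ i < K, y (i + 1) = y i + (η * ε i) • r i
  w_succ : ∀ i < K, ∀ j ∈ J, w (i + 1) j = w i j * (1 + ε i * (lam * η * ⟪v j, r i⟫))
  X_succ : ∀ i < K, X (i + 1) = X i + 2 * η * ε i * ⟪y i, r i⟫
  choice : ∀ i < K,
    ε i * (lam * η * ∑ j ∈ J, w i j * ⟪v j, r i⟫ + 4 * γ * η * X i * ⟪y i, r i⟫) ≤ 0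

namespace SignedWalk

variable {J : Finset ι} {v : ι → V} {lam η γ : ℝ} {K : ℕ} {r : ℕ → V} {y : ℕ → V}
  {w : ℕ → ι → ℝ} {X : ℕ → ℝ} {ε : ℕ → ℝ}

theorem sign_sq (h : SignedWalk J v lam η γ K r y w X ε) {i : ℕ} (hi : i < K) : ε i ^ 2 = 1 := by
  rcases h.sign i hi with e | e <;> rw [e] <;> norm_num

theorem abs_sign (h : SignedWalk J v lam η γ K r y w X ε) {i : ℕ} (hi : i < K) : |ε i| = 1 := by
  rcases h.sign i hi with e | e <;> rw [e] <;> norm_num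

theorem potential_le (h : SignedWalk J v lam η γ K r y w X ε) {k : ℕ} (hk : k ≤ K) :
    ∑ j ∈ J, w k j + γ * X k ^ 2 ≤ ∑ j ∈ J, w 0 j + γ * X 0 ^ 2 +
      4 * γ * η ^ 2 * ∑ i ∈ Finset.range k, ⟪y i, r i⟫ ^ 2 := by
  induction k with
  | zero => simp
  | succ k ih =>
    have ih := ih (by omega)
    have hc := h.choice k hk
    have e1 : ∑ j ∈ J, w (k + 1) j =
        ∑ j ∈ J, w k j + ε k * (lam * η * ∑ j ∈ J, w k j * ⟪v j, r k⟫) := by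
      rw [Finset.mul_sum, Finset.mul_sum, ← Finset.sum_add_distrib]
      refine Finset.sum_congr rfl fun j hj => ?_
      rw [h.w_succ k hk j hj]
      ring
    have e2 : γ * X (k + 1) ^ 2 = γ * X k ^ 2 + ε k * (4 * γ * η * X k * ⟪y k, r k⟫) +
        4 * γ * η ^ 2 * ⟪y k, r k⟫ ^ 2 := by
      rw [h.X_succ k hk]
      linear_combination 4 * γ * η ^ 2 * ⟪y k, r k⟫ ^ 2 * h.sign_sq hk
    rw [Finset.sum_range_succ, e1, e2]
    linarith

/-- X records exactly the cross terms 2ηε⟪y, r⟫ of the squared norm; what remains does not depend on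
the signs. -/
theorem norm_sq_sub (h : SignedWalk J v lam η γ K r y w X ε) {k : ℕ} (hk : k ≤ K) :
    ‖y k‖ ^ 2 - X k = ‖y 0‖ ^ 2 - X 0 + η ^ 2 * ∑ i ∈ Finset.range k, ‖r i‖ ^ 2 := by
  induction k with
  | zero => simp
  | succ k ih =>
    have ih := ih (by omega)
    rw [Finset.sum_range_succ, h.y_succ k hk, h.X_succ k hk, norm_add_sq_real, norm_smul,
      inner_smul_right, mul_pow, Real.norm_eq_abs, sq_abs]
    linear_combination ih + η ^ 2 * ‖r k‖ ^ 2 * h.sign_sq hk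

theorem sub_eq_sum (h : SignedWalk J v lam η γ K r y w X ε) {k : ℕ} (hk : k ≤ K) :
    y k - y 0 = ∑ i ∈ Finset.range k, (η * ε i) • r i := by
  induction k with
  | zero => simp
  | succ k ih =>
    rw [Finset.sum_range_succ, h.y_succ k hk, ← ih (by omega)]
    abel

/-- Each factor 1 + x of the weight is at least exp(x - (1+ξ)x²/2), and the linear exponents add up
to the displacement of y against v j. -/
theorem weight_ge (h : SignedWalk J v lam η γ K r y w X ε) {ξ : ℝ} (hξ : ξ ≤ 1) {j : ι}
    (hj : j ∈ J) (hw : 0 ≤ w 0 j) (hr : ∀ i < K, |lam * η * ⟪v j, r i⟫| ≤ ξ / 4) {k : ℕ}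
    (hk : k ≤ K) :
    w 0 j * Real.exp (lam * (⟪v j, y k⟫ - ⟪v j, y 0⟫) -
      (1 + ξ) / 2 * (lam * η) ^ 2 * ∑ i ∈ Finset.range k, ⟪v j, r i⟫ ^ 2) ≤ w k j := by
  induction k with
  | zero => simp
  | succ k ih =>
    have ih := ih (by omega)
    have h1 := exp_sub_sq_le_one_add (x := ε k * (lam * η * ⟪v j, r k⟫)) (ξ := ξ)
      (by rw [abs_mul, h.abs_sign hk, one_mul]; exact hr k hk) hξ
    rw [h.w_succ k hk j hj]
    refine le_trans (le_of_eq ?_) (mul_le_mul ih h1 (Real.exp_pos _).le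
      ((mul_nonneg hw (Real.exp_pos _).le).trans ih))
    rw [mul_assoc (w 0 j), ← Real.exp_add]
    congr 2
    rw [Finset.sum_range_succ, h.y_succ k hk, inner_add_right, inner_smul_right]
    linear_combination (1 + ξ) / 2 * (lam * η * ⟪v j, r k⟫) ^ 2 * h.sign_sq hk

end SignedWalk

/-- The effect of a round of the walk on the position, the weights and the correction. -/
structure RoundStep (J : Finset ι) (v : ι → V) (lam η γ ξ θ τ : ℝ) (n : ℕ) (y y' : V)
    (w w' : ι → ℝ) (X X' : ℝ) : Prop where
  inner_le : ∀ j ∈ J, |⟪v j, y'⟫ - ⟪v j, y⟫| ≤ η * Real.sqrt n * ‖v j‖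
  heavy_inner_le : ∀ j ∈ J, θ ≤ ⟪v j, y⟫ → |⟪v j, y'⟫ - ⟪v j, y⟫| ≤ τ
  weight_ge : ∀ j ∈ J, 0 ≤ w j →
    w j * Real.exp (lam * (⟪v j, y'⟫ - ⟪v j, y⟫) - (1 + ξ) / 2 * (lam * η) ^ 2 * ‖v j‖ ^ 2) ≤ w' j
  potential_le : ∑ j ∈ J, w' j + γ * X' ^ 2 ≤ ∑ j ∈ J, w j + γ * X ^ 2 +
      4 * γ * η ^ 2 * (2 * ‖y‖ ^ 2 + 2 * η ^ 2 * n ^ 3)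
  norm_le : ‖y'‖ ^ 2 - X' ≤ ‖y‖ ^ 2 - X + η ^ 2 * n
  norm_ge : ∀ H ⊆ J, (∀ j ∈ J, θ ≤ ⟪v j, y⟫ → j ∈ H) → (∀ j ∈ H, θ ≤ ⟪v j, y⟫) →
    ‖y‖ ^ 2 - X + η ^ 2 * (n - H.card) ≤ ‖y'‖ ^ 2 - X'

theorem sum_abs_le_sqrt_mul {n : ℕ} (a : Fin n → ℝ) {c : ℝ} (hc : 0 ≤ c)
    (h : ∑ i, a i ^ 2 = c ^ 2) : ∑ i, |a i| ≤ Real.sqrt n * c := by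
  have h1 : (∑ i, |a i|) ^ 2 ≤ n * c ^ 2 := by
    have := sq_sum_le_card_mul_sum_sq (s := Finset.univ) (f := fun i => |a i|)
    simpa [h] using this
  calc ∑ i, |a i| ≤ Real.sqrt (n * c ^ 2) := Real.le_sqrt_of_sq_le h1
    _ = _ := by rw [Real.sqrt_mul (by positivity), Real.sqrt_sq hc]

/-- A walk along the columns of a power of the damping map is a round. -/
theorem SignedWalk.roundStep {n : ℕ} {J H : Finset ι} {v : ι → V} {lam η γ κ ξ θ τ : ℝ} {N : ℕ}
    (b : OrthonormalBasis (Fin n) ℝ V) {r : ℕ → V} {y : ℕ → V} {w : ℕ → ι → ℝ} {X : ℕ → ℝ}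
    {ε : ℕ → ℝ} (h : SignedWalk J v lam η γ n r y w X ε) (hη : 0 ≤ η) (hγ : 0 ≤ γ) (hlam : 0 ≤ lam)
    (hr : ∀ i : Fin n, r i = (damp H v κ ^ N) (b i)) (hκ : 0 < κ)
    (hJκ : ∑ j ∈ H, ‖v j‖ ^ 2 ≤ κ) (hH : ∀ j, j ∈ H ↔ j ∈ J ∧ θ ≤ ⟪v j, y 0⟫)
    (hξ : ξ ≤ 1) (hξ' : ∀ j ∈ J, lam * η * ‖v j‖ ≤ ξ / 4)
    (hτ : η * Real.sqrt n * Real.sqrt (κ / (2 * N + 1)) ≤ τ) :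
    RoundStep J v lam η γ ξ θ τ n (y 0) (y n) (w 0) (w n) (X 0) (X n) := by
  set R := damp H v κ ^ N with hR
  have hsymm : R.IsSymmetric := (damp_isSymmetric H v κ).pow N
  have hcontr : ∀ z, ‖R z‖ ≤ ‖z‖ := norm_pow_apply_le (norm_damp_apply_le hκ hJκ) N
  have hr1 : ∀ i < n, ‖r i‖ ≤ 1 := fun i hi => by
    rw [hr ⟨i, hi⟩]
    exact (hcontr _).trans (b.orthonormal.1 _).le
  have hsq : ∀ z, ∑ i ∈ Finset.range n, ⟪z, r i⟫ ^ 2 = ‖R z‖ ^ 2 := fun z => by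
    rw [Finset.sum_range, ← sum_inner_sq_eq b hsymm]
    exact Finset.sum_congr rfl fun i _ => by rw [hr i, real_inner_comm]
  -- In the worst case all signs conspire: the displacement is at most η ∑ |⟪z, r i⟫|, and
  -- Cauchy-Schwarz with Parseval turns this into η √n ‖R z‖.
  have hmove : ∀ z, |⟪z, y n⟫ - ⟪z, y 0⟫| ≤ η * Real.sqrt n * ‖R z‖ := fun z => by
    rw [← inner_sub_right, h.sub_eq_sum le_rfl, inner_sum]
    refine (Finset.abs_sum_le_sum_abs _ _).trans ?_
    have e : ∀ i ∈ Finset.range n, |⟪z, (η * ε i) • r i⟫| = η * |⟪z, r i⟫| := fun i hi => by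
      rw [inner_smul_right, abs_mul, abs_mul, h.abs_sign (Finset.mem_range.1 hi), abs_of_nonneg hη,
        mul_one]
    rw [Finset.sum_congr rfl e, ← Finset.mul_sum, mul_assoc]
    have := hsq z
    rw [Finset.sum_range] at this ⊢
    gcongr
    exact sum_abs_le_sqrt_mul (fun i : Fin n => ⟪z, r i⟫) (norm_nonneg _) this
  refine ⟨fun j _ => (hmove _).trans ?_, fun j hj hθ => (hmove _).trans (le_trans ?_ hτ), ?_, ?_, ?_,
    ?_⟩
  · gcongr
    exact hcontr _
  · gcongr
    exact Real.le_sqrt_of_sq_le (norm_damp_pow_le hκ hJκ N ((hH j).2 ⟨hj, hθ⟩))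
  · intro j hj hw
    refine le_trans ?_ (h.weight_ge hξ hj hw (fun i hi => ?_) le_rfl)
    · have hξ0 : 0 ≤ 1 + ξ := by
        have := hξ' j hj
        have : 0 ≤ lam * η * ‖v j‖ := by positivity
        linarith
      rw [hsq]
      gcongr
      exact hcontr _
    · rw [abs_mul, abs_of_nonneg (by positivity)]
      refine le_trans ?_ (hξ' j hj)
      gcongr
      calc |⟪v j, r i⟫| ≤ ‖v j‖ * ‖r i‖ := abs_real_inner_le_norm _ _
        _ ≤ ‖v j‖ * 1 := by gcongr; exact hr1 i hi
        _ = _ := mul_one _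
  · refine (h.potential_le le_rfl).trans ?_
    gcongr
    -- Within a round y drifts by at most η n, so y i may be replaced by y 0 up to a small error;
    -- then Parseval sums the squares to ‖R (y 0)‖².
    have hdist : ∀ i ≤ n, ‖y i - y 0‖ ≤ η * n := fun i hi => by
      rw [h.sub_eq_sum hi]
      calc ‖∑ k ∈ Finset.range i, (η * ε k) • r k‖ ≤ ∑ k ∈ Finset.range i, η := by
            refine norm_sum_le_of_le _ fun k hk => ?_
            have hk' : k < n := (Finset.mem_range.1 hk).trans_le hi
            rw [norm_smul, Real.norm_eq_abs, abs_mul, h.abs_sign hk', abs_of_nonneg hη, mul_one]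
            exact mul_le_of_le_one_right hη (hr1 k hk')
        _ = i * η := by simp
        _ ≤ η * n := by
            rw [mul_comm]
            gcongr
    calc ∑ i ∈ Finset.range n, ⟪y i, r i⟫ ^ 2
        ≤ ∑ i ∈ Finset.range n, (2 * ⟪y 0, r i⟫ ^ 2 + 2 * (η * n) ^ 2) := by
          refine Finset.sum_le_sum fun i hi => ?_
          have hi' := Finset.mem_range.1 hi
          have h1 : |⟪y i - y 0, r i⟫| ≤ η * n :=
            (abs_real_inner_le_norm _ _).trans (by
              calc ‖y i - y 0‖ * ‖r i‖ ≤ η * n * 1 :=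
                    mul_le_mul (hdist i hi'.le) (hr1 i hi') (norm_nonneg _) (by positivity)
                _ = _ := mul_one _)
          have h2 : ⟪y i - y 0, r i⟫ ^ 2 ≤ (η * n) ^ 2 := by
            rw [← sq_abs]
            gcongr
          have h3 : ⟪y i, r i⟫ = ⟪y 0, r i⟫ + ⟪y i - y 0, r i⟫ := by
            rw [← inner_add_left]; congr 1; abel
          rw [h3]
          nlinarith [sq_nonneg (⟪y 0, r i⟫ - ⟪y i - y 0, r i⟫)]
      _ = 2 * ‖R (y 0)‖ ^ 2 + 2 * η ^ 2 * n ^ 3 := by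
          rw [Finset.sum_add_distrib, ← Finset.mul_sum, hsq]
          simp
          ring
      _ ≤ _ := by
          gcongr
          exact hcontr _
  · rw [h.norm_sq_sub le_rfl]
    gcongr
    calc ∑ i ∈ Finset.range n, ‖r i‖ ^ 2 ≤ ∑ i ∈ Finset.range n, (1 : ℝ) :=
          Finset.sum_le_sum fun i hi => by
            have := hr1 i (Finset.mem_range.1 hi)
            exact pow_le_one₀ (norm_nonneg _) this
      _ = n := by simp
  · intro H' _ h1 h2
    have : H' = H := by
      ext j
      rw [hH]
      exact ⟨fun hj => ⟨‹H' ⊆ J› hj, h2 j hj⟩, fun hj => h1 j hj.1 hj.2⟩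
    subst this
    rw [h.norm_sq_sub le_rfl]
    gcongr
    rw [Finset.sum_range]
    refine (le_sum_norm_damp_pow_sq b H' v κ N).trans (le_of_eq ?_)
    exact Finset.sum_congr rfl fun i _ => by rw [hr i]

end Walk


/-! ### Accumulation of the rounds: heavy rows and the length of the position -/

section Rounds

open scoped RealInnerProductSpace

/-- A geometric series with ratio exp(L/T) ≥ 1 + L/T. -/
theorem sum_exp_neg_le {T : ℕ} (hT : 0 < T) {L : ℝ} (hL : 0 < L) :
    ∑ b ∈ Finset.range T, Real.exp (L * (b / T : ℝ) - L) ≤ T / L := by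
  have hT' : (0 : ℝ) < T := by exact_mod_cast hT
  set q := Real.exp (L / T) with hq
  have hq1 : 1 + L / T ≤ q := by rw [hq, add_comm]; exact Real.add_one_le_exp _
  have hpos : 0 < L / T := by positivity
  have e : ∀ b : ℕ, Real.exp (L * (b / T : ℝ) - L) = Real.exp (-L) * q ^ b := fun b => by
    rw [hq, ← Real.exp_nat_mul, ← Real.exp_add]
    congr 1
    field_simp
    ring
  have hqT : q ^ T = Real.exp L := by
    rw [hq, ← Real.exp_nat_mul]
    congr 1
    field_simp
  simp_rw [e]
  rw [← Finset.mul_sum, geom_sum_eq (by linarith), hqT, Real.exp_neg, ← mul_div_assoc,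
    mul_sub, inv_mul_cancel₀ (Real.exp_pos L).ne', mul_one]
  calc (1 - (Real.exp L)⁻¹) / (q - 1) ≤ 1 / (L / T) := by
        gcongr
        · have := Real.exp_pos L
          have : 0 < (Real.exp L)⁻¹ := by positivity
          linarith
        · linarith
    _ = T / L := by field_simp

variable {V : Type*} [NormedAddCommGroup V] [InnerProductSpace ℝ V] {ι : Type*}

set_option maxHeartbeats 1600000 in
/-- After `n ^ 3` rounds with step `1 / n ^ 2` the position is almost a unit vector, and it has
almost no inner product above the threshold `lam / n` with any of the `v j`. -/
theorem RoundStep.final {n m : ℕ} {J : Finset ι} {v : ι → V} {lam L τ : ℝ} {y : ℕ → V}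
    {w : ℕ → ι → ℝ} {X : ℕ → ℝ} (hn : 100 ≤ n) (hmpos : 0 < m) (hJ : J.card ≤ m) (hlam : 0 < lam)
    (hL : L = lam ^ 2 / (2 * n)) (hm : 300 * (m : ℝ) ≤ n * Real.exp L) (hτ : 0 ≤ τ)
    (hv : ∀ j ∈ J, ‖v j‖ ^ 2 ≤ 1 + 6 / Real.sqrt n) (hL' : L * (20 / Real.sqrt n) ≤ 1)
    (h : ∀ b < n ^ 3, RoundStep J v lam (1 / n ^ 2) (m * n) (6 / n) (lam / n) τ n
      (y b) (y (b + 1)) (w b) (w (b + 1)) (X b) (X (b + 1)))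
    (hy0 : y 0 = 0) (hw0 : ∀ j ∈ J, w 0 j = 1) (hX0 : X 0 = 0) :
    (∀ j ∈ J, ⟪v j, y (n ^ 3)⟫ ≤ lam / n + 2 / n + n ^ 3 * τ) ∧
    ‖y (n ^ 3)‖ ^ 2 ≤ 1 + 5 / Real.sqrt n ∧
    1 - 1 / (5 * L) - 5 / Real.sqrt n ≤ ‖y (n ^ 3)‖ ^ 2 := by
  classical
  have hn' : (100 : ℝ) ≤ n := by exact_mod_cast hn
  have hn0 : (0 : ℝ) < n := by linarith
  set q := Real.sqrt n with hq
  have hqq : q ^ 2 = n := Real.sq_sqrt hn0.le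
  have hq10 : 10 ≤ q := Real.le_sqrt_of_sq_le (by norm_num; exact hn)
  have hLpos : 0 < L := by rw [hL]; positivity
  set ξ : ℝ := 6 / n with hξ
  have hξ1 : 0 < ξ := by positivity
  have hξq : ξ ≤ 1 / q := by
    rw [hξ, ← hqq, div_le_div_iff₀ (by positivity) (by positivity)]
    nlinarith
  have hq1 : 1 / q ≤ 1 / 10 := one_div_le_one_div_of_le (by norm_num) hq10
  have hvs : ∀ j ∈ J, ‖v j‖ ≤ 3 / 2 := fun j hj => by
    have := hv j hj
    have : 6 / q = 6 * (1 / q) := by ring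
    nlinarith [norm_nonneg (v j)]
  -- the exponent accumulated up to time `b`
  set c : ℝ := (1 + ξ) / 2 * (lam * (1 / n ^ 2)) ^ 2 * (1 + 6 / q) with hc
  have hcn : n ^ 3 * c = L * ((1 + ξ) * (1 + 6 / q)) := by
    rw [hc, hL]; field_simp
  -- The factors 1 + ξ and 1 + 6/√n cost a relative error of at most 20/√n, and `hL'` makes its
  -- contribution to the exponent at most 1.
  have hcb : ∀ b : ℕ, b ≤ n ^ 3 → b * c ≤ L * (b / (n ^ 3 : ℕ) : ℝ) + 1 := by
    intro b hb
    have hb' : (b : ℝ) ≤ n ^ 3 := by exact_mod_cast hb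
    have e : b * c = (b / n ^ 3 : ℝ) * (L * ((1 + ξ) * (1 + 6 / q))) := by
      rw [← hcn]; field_simp
    have h1 : (1 + ξ) * (1 + 6 / q) ≤ 1 + 20 / q := by
      have e6 : 6 / q = 6 * (1 / q) := by ring
      have e20 : 20 / q = 20 * (1 / q) := by ring
      have : 0 < 1 / q := by positivity
      rw [e6, e20]
      nlinarith
    have h2 : (b / n ^ 3 : ℝ) ≤ 1 := by rw [div_le_one (by positivity)]; exact hb'
    have h3 : (0 : ℝ) ≤ b / n ^ 3 := by positivity
    rw [e]
    push_cast
    calc (b / n ^ 3 : ℝ) * (L * ((1 + ξ) * (1 + 6 / q)))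
        ≤ (b / n ^ 3 : ℝ) * (L * (1 + 20 / q)) := by gcongr
      _ = L * (b / n ^ 3 : ℝ) + (b / n ^ 3 : ℝ) * (L * (20 / q)) := by ring
      _ ≤ L * (b / n ^ 3 : ℝ) + 1 * 1 := by
          gcongr
      _ = _ := by ring
  have hm0 : (0 : ℝ) ≤ m := by positivity
  -- the invariants
  have inv : ∀ b ≤ n ^ 3,
      (∑ j ∈ J, w b j + m * n * X b ^ 2 ≤ m + 20 * m * (b / n ^ 3 : ℝ)) ∧
      (‖y b‖ ^ 2 - X b ≤ (b / n ^ 3 : ℝ)) ∧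
      (∀ j ∈ J, Real.exp (lam * ⟪v j, y b⟫ - b * c) ≤ w b j) ∧
      (∀ j ∈ J, ⟪v j, y b⟫ ≤ lam / n + 2 / n + b * τ) := by
    intro b
    induction b with
    | zero =>
      intro _
      refine ⟨?_, ?_, ?_, ?_⟩
      · rw [Finset.sum_congr rfl hw0, hX0]
        simpa using hJ
      · simp [hy0, hX0]
      · intro j hj
        simp [hy0, hw0 j hj]
      · intro j _
        simp only [hy0, inner_zero_right]
        positivity
    | succ b ih =>
      intro hb
      obtain ⟨i1, i2, i3, i4⟩ := ih (by omega)
      have hs := h b hb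
      have hb1 : (b / n ^ 3 : ℝ) ≤ 1 := by
        rw [div_le_one (by positivity)]
        exact_mod_cast (by omega : b ≤ n ^ 3)
      have hwpos : 0 ≤ ∑ j ∈ J, w b j :=
        Finset.sum_nonneg fun j hj => (Real.exp_pos _).le.trans (i3 j hj)
      have hstep : ((b + 1 : ℕ) / n ^ 3 : ℝ) = b / n ^ 3 + 1 / n ^ 3 := by
        push_cast; ring
      have hηn : (1 / n ^ 2 : ℝ) ^ 2 * n = 1 / n ^ 3 := by field_simp
      refine ⟨?_, ?_, ?_, ?_⟩
      · have hmpos' : (0 : ℝ) < m := by exact_mod_cast hmpos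
        -- The potential is at most 21 m and γ = m n. This keeps ‖y b‖² ≤ 2, so the second order
        -- growth per round is at most 20 m/n³.
        have hX : n * X b ^ 2 ≤ 21 := by
          have h1 : (m : ℝ) * (n * X b ^ 2) ≤ m * 21 := by nlinarith
          exact le_of_mul_le_mul_left h1 hmpos'
        have hX1 : X b ≤ 1 / 2 := by nlinarith
        have hy2 : ‖y b‖ ^ 2 ≤ 2 := by linarith
        have hη : 2 * (1 / n ^ 2 : ℝ) ^ 2 * n ^ 3 ≤ 1 := by
          have : 2 * (1 / n ^ 2 : ℝ) ^ 2 * n ^ 3 = 2 / n := by field_simp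
          rw [this, div_le_one hn0]; linarith
        have e : 4 * (m * n : ℝ) * (1 / n ^ 2) ^ 2 * 5 = 20 * m * (1 / n ^ 3) := by
          rw [← hηn]; ring
        calc ∑ j ∈ J, w (b + 1) j + m * n * X (b + 1) ^ 2
            ≤ ∑ j ∈ J, w b j + m * n * X b ^ 2 + 4 * (m * n) * (1 / n ^ 2 : ℝ) ^ 2 *
              (2 * ‖y b‖ ^ 2 + 2 * (1 / n ^ 2 : ℝ) ^ 2 * n ^ 3) := hs.potential_le
          _ ≤ m + 20 * m * (b / n ^ 3 : ℝ) + 4 * (m * n) * (1 / n ^ 2 : ℝ) ^ 2 * 5 := by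
              gcongr
              linarith
          _ = _ := by rw [e, hstep]; ring
      · have := hs.norm_le
        rw [hηn] at this
        rw [hstep]
        linarith
      · intro j hj
        have hwj : 0 ≤ w b j := (Real.exp_pos _).le.trans (i3 j hj)
        refine le_trans ?_ (hs.weight_ge j hj hwj)
        calc Real.exp (lam * ⟪v j, y (b + 1)⟫ - (b + 1 : ℕ) * c)
            = Real.exp (lam * ⟪v j, y b⟫ - b * c) *
              Real.exp (lam * (⟪v j, y (b + 1)⟫ - ⟪v j, y b⟫) - c) := by
              rw [← Real.exp_add]
              congr 1
              push_cast
              ring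
          _ ≤ _ := by
              gcongr
              · exact i3 j hj
              · rw [hc]
                gcongr
                exact hv j hj
      · intro j hj
        have hb0 : 0 ≤ b * τ := by positivity
        have hbs : ((b + 1 : ℕ) : ℝ) * τ = b * τ + τ := by push_cast; ring
        -- A light row starts the round below λ/n and can overshoot it by at most 2/n; a heavy row
        -- only creeps by τ. Hence the overshoot is paid once and the creep at most once per round.
        rcases le_or_gt (lam / n) ⟪v j, y b⟫ with hθ | hθ
        · have := (abs_le.1 (hs.heavy_inner_le j hj hθ)).2
          have := i4 j hj
          rw [hbs]
          linarith
        · have h1 := (abs_le.1 (hs.inner_le j hj)).2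
          have h2 : 1 / (n : ℝ) ^ 2 * q * ‖v j‖ ≤ 2 / (n : ℝ) := by
            calc 1 / (n : ℝ) ^ 2 * q * ‖v j‖ ≤ 1 / (n : ℝ) ^ 2 * n * (3 / 2) := by
                  gcongr
                  · nlinarith
                  · exact hvs j hj
              _ = (3 / 2) / (n : ℝ) := by field_simp
              _ ≤ 2 / (n : ℝ) := by gcongr; norm_num
          rw [hbs]
          linarith
  -- the correction stays small
  have hXfin : |X (n ^ 3)| ≤ 5 / q := by
    obtain ⟨i1, i2, i3, -⟩ := inv (n ^ 3) le_rfl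
    have hmpos' : (0 : ℝ) < m := by exact_mod_cast hmpos
    have hwpos : 0 ≤ ∑ j ∈ J, w (n ^ 3) j :=
      Finset.sum_nonneg fun j hj => (Real.exp_pos _).le.trans (i3 j hj)
    have h1 : ((n ^ 3 : ℕ) / n ^ 3 : ℝ) = 1 := by push_cast; field_simp
    rw [h1] at i1
    have hX : n * X (n ^ 3) ^ 2 ≤ 21 := by
      have h1 : (m : ℝ) * (n * X (n ^ 3) ^ 2) ≤ m * 21 := by nlinarith
      exact le_of_mul_le_mul_left h1 hmpos'
    rw [le_div_iff₀ (by positivity)]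
    refine abs_le_of_sq_le_sq' ?_ (by norm_num) |>.2
    rw [mul_pow, sq_abs, hqq]
    linarith
  -- the number of frozen vectors
  set H : ℕ → Finset ι := fun b => J.filter fun j => lam / n ≤ ⟪v j, y b⟫ with hHdef
  have hcard : ∀ b < n ^ 3, ((H b).card : ℝ) ≤
      n / 5 * Real.exp (L * (b / (n ^ 3 : ℕ) : ℝ) - L) := by
    intro b hb
    obtain ⟨i1, i2, i3, -⟩ := inv b hb.le
    have hb1 : (b / n ^ 3 : ℝ) ≤ 1 := by
      rw [div_le_one (by positivity)]
      exact_mod_cast hb.le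
    -- At a heavy row λ⟪v j, y⟫ ≥ λ²/n = 2L, while the accumulated exponent is at most L b/n³ + 1,
    -- so each heavy row carries at least this exponential in the total weight.
    have h1 : ((H b).card : ℝ) * Real.exp (2 * L - (L * (b / (n ^ 3 : ℕ) : ℝ) + 1)) ≤ 21 * m := by
      calc ((H b).card : ℝ) * Real.exp (2 * L - (L * (b / (n ^ 3 : ℕ) : ℝ) + 1))
          = ∑ j ∈ H b, Real.exp (2 * L - (L * (b / (n ^ 3 : ℕ) : ℝ) + 1)) := by simp
        _ ≤ ∑ j ∈ H b, w b j := by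
            refine Finset.sum_le_sum fun j hj => ?_
            have hj' := Finset.mem_filter.1 hj
            refine le_trans ?_ (i3 j hj'.1)
            have e : 2 * L = lam * (lam / n) := by rw [hL]; field_simp
            have := hcb b hb.le
            have : lam * (lam / n) ≤ lam * ⟪v j, y b⟫ := by gcongr; exact hj'.2
            exact Real.exp_le_exp.2 (by linarith)
        _ ≤ ∑ j ∈ J, w b j := Finset.sum_le_sum_of_subset_of_nonneg (Finset.filter_subset _ _)
            fun j hj _ => (Real.exp_pos _).le.trans (i3 j hj)
        _ ≤ m + 20 * m * (b / n ^ 3 : ℝ) := by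
            have : (0 : ℝ) ≤ m * n * X b ^ 2 := by positivity
            linarith
        _ ≤ 21 * m := by nlinarith
    have e2 : Real.exp (2 * L - (L * (b / (n ^ 3 : ℕ) : ℝ) + 1)) =
        Real.exp L * (Real.exp (L * (b / (n ^ 3 : ℕ) : ℝ) - L))⁻¹ * (Real.exp 1)⁻¹ := by
      rw [← Real.exp_neg, ← Real.exp_neg, ← Real.exp_add, ← Real.exp_add]
      congr 1
      ring
    rw [e2] at h1
    set x := Real.exp (L * (b / (n ^ 3 : ℕ) : ℝ) - L) with hx
    have hxpos : 0 < x := Real.exp_pos _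
    have he : Real.exp 1 ≤ 2.8 := by have := Real.exp_one_lt_d9; linarith
    have hepos := Real.exp_pos 1
    have hELpos := Real.exp_pos L
    have h3 : ((H b).card : ℝ) * Real.exp L ≤ 21 * m * Real.exp 1 * x := by
      have := mul_le_mul_of_nonneg_right h1 (mul_nonneg hepos.le hxpos.le)
      calc ((H b).card : ℝ) * Real.exp L
          = (H b).card * (Real.exp L * x⁻¹ * (Real.exp 1)⁻¹) * (Real.exp 1 * x) := by field_simp
        _ ≤ _ := this
        _ = _ := by ring
    -- Here the constant 300 is used: 21 · 2.8 = 300 · 0.196, which is below 300/5.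
    have h4 : ((H b).card : ℝ) * Real.exp L ≤ n / 5 * x * Real.exp L := by
      calc ((H b).card : ℝ) * Real.exp L ≤ 21 * m * Real.exp 1 * x := h3
        _ ≤ 21 * m * 2.8 * x := by gcongr
        _ = 300 * m * (0.196 * x) := by ring
        _ ≤ n * Real.exp L * (0.2 * x) := by
            gcongr
            norm_num
        _ = _ := by ring
    exact le_of_mul_le_mul_right h4 hELpos
  -- the length grows
  have hgrow : ∀ b ≤ n ^ 3, ∑ k ∈ Finset.range b, (1 / n ^ 2 : ℝ) ^ 2 * (n - (H k).card) ≤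
      ‖y b‖ ^ 2 - X b := by
    intro b
    induction b with
    | zero => simp [hy0, hX0]
    | succ b ih =>
      intro hb
      have ih := ih (by omega)
      rw [Finset.sum_range_succ]
      have := (h b hb).norm_ge (H b) (Finset.filter_subset _ _)
        (fun j hj hθ => Finset.mem_filter.2 ⟨hj, hθ⟩) fun j hj => (Finset.mem_filter.1 hj).2
      linarith
  obtain ⟨-, j2, -, j4⟩ := inv (n ^ 3) le_rfl
  have h1 : ((n ^ 3 : ℕ) / n ^ 3 : ℝ) = 1 := by push_cast; field_simp
  rw [h1] at j2
  refine ⟨fun j hj => by simpa using j4 j hj, ?_, ?_⟩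
  · have := (abs_le.1 hXfin).2
    linarith
  · have g := hgrow (n ^ 3) le_rfl
    -- On average over the n³ rounds at most n/(5L) rows are heavy, so a fraction 1/(5L) of the
    -- growth of ‖y‖² is lost.
    have hsum : ∑ k ∈ Finset.range (n ^ 3), ((H k).card : ℝ) ≤ n / 5 * ((n ^ 3 : ℕ) / L) := by
      refine (Finset.sum_le_sum fun k hk => hcard k (Finset.mem_range.1 hk)).trans ?_
      rw [← Finset.mul_sum]
      gcongr
      exact sum_exp_neg_le (by positivity) hLpos
    rw [← Finset.mul_sum, Finset.sum_sub_distrib] at g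
    have h5 : (1 / n ^ 2 : ℝ) ^ 2 * (n ^ 3 * n - n / 5 * (n ^ 3 / L)) = 1 - 1 / (5 * L) := by
      field_simp
    have h6 : (1 / n ^ 2 : ℝ) ^ 2 * (n ^ 3 * n - n / 5 * (n ^ 3 / L)) ≤
        (1 / n ^ 2 : ℝ) ^ 2 * (∑ k ∈ Finset.range (n ^ 3), (n : ℝ) -
          ∑ k ∈ Finset.range (n ^ 3), ((H k).card : ℝ)) := by
      gcongr
      · simp
      · exact_mod_cast hsum
    have := (abs_le.1 hXfin).1
    linarith

end Rounds


/-! ### Packings by caps -/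

section Caps

open scoped RealInnerProductSpace Pointwise Topology

variable {n m : ℕ}

theorem inner_self_sphere (v : Sphere n) :
    ⟪(v : EuclideanSpace ℝ (Fin n)), (v : EuclideanSpace ℝ (Fin n))⟫ = 1 := by
  rw [real_inner_self_eq_norm_sq, norm_eq_of_mem_sphere, one_pow]

theorem isOpen_inner_gt (v : Sphere n) (c : ℝ) :
    IsOpen {x : Sphere n | c < ⟪(x : EuclideanSpace ℝ (Fin n)), (v : EuclideanSpace ℝ (Fin n))⟫} :=
  isOpen_lt continuous_const (by fun_prop)

theorem isClosed_cap (v : Sphere n) (r : ℝ) : IsClosed (cap v r) :=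
  isClosed_le continuous_const (by fun_prop)

theorem mem_interior_cap_of_lt {v x : Sphere n} {r : ℝ}
    (h : Real.cos r < ⟪(x : EuclideanSpace ℝ (Fin n)), (v : EuclideanSpace ℝ (Fin n))⟫) :
    x ∈ interior (cap v r) := by
  have hsub : {x : Sphere n | Real.cos r <
      ⟪(x : EuclideanSpace ℝ (Fin n)), (v : EuclideanSpace ℝ (Fin n))⟫} ⊆ cap v r :=
    fun y hy => by
      simp only [cap, Set.mem_ofPred_eq] at hy ⊢
      exact hy.le
  exact interior_maximal hsub (isOpen_inner_gt v (Real.cos r)) h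

theorem cap_subset_cap (v : Sphere n) {r r' : ℝ} (h : Real.cos r' ≤ Real.cos r) :
    cap v r ⊆ cap v r' := fun _ hx => h.trans hx

/-- A point with equality leaves the cap when it moves away from the pole along x - t v,
renormalized. For cos r = -1 this fails, since the cap is the whole sphere and the antipode of the
pole is interior. -/
theorem lt_inner_of_mem_interior_cap {v x : Sphere n} {r : ℝ} (hr : Real.cos r ∈ Set.Ioo (-1) 1)
    (hx : x ∈ interior (cap v r)) :
    Real.cos r < ⟪(x : EuclideanSpace ℝ (Fin n)), (v : EuclideanSpace ℝ (Fin n))⟫ := by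
  refine lt_of_le_of_ne (show x ∈ cap v r from interior_subset hx) fun heq => ?_
  set c := Real.cos r with hc
  set x' : EuclideanSpace ℝ (Fin n) := (x : EuclideanSpace ℝ (Fin n)) with hx'
  set v' : EuclideanSpace ℝ (Fin n) := (v : EuclideanSpace ℝ (Fin n)) with hv'
  have hxx : ‖x'‖ = 1 := norm_eq_of_mem_sphere x
  have hvv : ‖v'‖ = 1 := norm_eq_of_mem_sphere v
  have hnorm : ∀ t : ℝ, ‖x' - t • v'‖ ^ 2 = 1 - 2 * t * c + t ^ 2 := fun t => by
    rw [norm_sub_sq_real, inner_smul_right, norm_smul, hxx, hvv, ← heq, Real.norm_eq_abs, mul_one,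
      sq_abs]
    ring
  have hpos : ∀ t : ℝ, 0 < ‖x' - t • v'‖ := fun t => by
    have : 0 < ‖x' - t • v'‖ ^ 2 := by
      rw [hnorm]
      nlinarith [sq_nonneg (t - c), hr.1, hr.2]
    exact lt_of_le_of_ne (norm_nonneg _) fun h => by rw [← h] at this; simp at this
  let g : ℝ → Sphere n := fun t => ⟨‖x' - t • v'‖⁻¹ • (x' - t • v'), by
    rw [mem_sphere_zero_iff_norm, norm_smul, norm_inv, norm_norm, inv_mul_cancel₀ (hpos t).ne']⟩
  have hg : Continuous g := by
    refine Continuous.subtype_mk ?_ _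
    have h1 : Continuous fun t : ℝ => x' - t • v' := by fun_prop
    exact (h1.norm.inv₀ fun t => (hpos t).ne').smul h1
  have hg0 : g 0 = x := Subtype.ext (by simp [g, hx'])
  have hev : ∀ᶠ t in 𝓝 (0 : ℝ), g t ∈ interior (cap v r) :=
    hg.continuousAt.eventually_mem (by rw [hg0]; exact isOpen_interior.mem_nhds hx)
  have hev' : ∀ᶠ t in 𝓝[>] (0 : ℝ), g t ∈ interior (cap v r) := hev.filter_mono nhdsWithin_le_nhds
  obtain ⟨t, ht1, ht2⟩ := (hev'.and self_mem_nhdsWithin).exists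
  have ht : 0 < t := ht2
  have h1 : c ≤ ‖x' - t • v'‖⁻¹ * (c - t) := by
    have := interior_subset ht1
    simp only [cap, Set.mem_ofPred_eq, g, inner_smul_left, inner_sub_left, ← hv',
      real_inner_self_eq_norm_sq, hvv] at this
    rw [← heq] at this
    simpa using this
  rw [inv_mul_eq_div, le_div_iff₀ (hpos t)] at h1
  have h2 := hnorm t
  have h3 := hpos t
  set s := ‖x' - t • v'‖
  have hc2 : 0 < t * (1 - c ^ 2) := mul_pos ht (by nlinarith [hr.1, hr.2])
  rcases le_or_gt 0 c with h0 | h0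
  · have h4 : 1 - t * c ≤ s := by
      by_contra! h
      have : s ^ 2 < (1 - t * c) ^ 2 := by gcongr
      nlinarith [mul_pos ht hc2]
    have h5 : c * (1 - t * c) ≤ c * s := by gcongr
    linarith
  · have h4 : s ≤ 1 + t := by
      by_contra! h
      have : (1 + t) ^ 2 < s ^ 2 := by gcongr
      nlinarith [hr.1]
    have h5 : c * (1 + t) ≤ c * s := mul_le_mul_of_nonpos_left h4 h0.le
    nlinarith [hr.1]

/-- A common point x would give 2c ≤ ⟪x, v i + v j⟫ ≤ ‖v i + v j‖, but the assumption makes the last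
norm smaller than 2c. -/
theorem isCapPacking_of_inner_lt {v : Fin m → Sphere n} {r c : ℝ} (hc : 0 ≤ c)
    (hr : Real.cos r = c) (h : ∀ i j, i ≠ j →
      ⟪(v i : EuclideanSpace ℝ (Fin n)), (v j : EuclideanSpace ℝ (Fin n))⟫ < 2 * c ^ 2 - 1) :
    IsCapPacking v r := by
  intro i j hij
  refine Set.disjoint_of_subset interior_subset interior_subset (Set.disjoint_left.2 ?_)
  intro x hi hj
  simp only [cap, Set.mem_ofPred_eq, hr] at hi hj
  have h1 := h i j hij
  have h2 := real_inner_le_norm (x : EuclideanSpace ℝ (Fin n)) ((v i : EuclideanSpace ℝ (Fin n)) + v j)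
  rw [norm_eq_of_mem_sphere, one_mul, inner_add_right] at h2
  have h3 : ‖(v i : EuclideanSpace ℝ (Fin n)) + v j‖ ^ 2 < 4 * c ^ 2 := by
    rw [norm_add_sq_real, norm_eq_of_mem_sphere, norm_eq_of_mem_sphere]
    linarith
  nlinarith

/-- The supremum of the admissible radii is attained because the interior of a cap is described by a
strict inequality, which survives a small decrease of the radius. That description needs cos r > -1,
and the radii are kept below π/2 for this. -/
theorem exists_isMaxPackingRadius {v : Fin m → Sphere n} (hm : 3 ≤ m) {ρ : ℝ}
    (hρ : ρ ∈ Set.Ioc 0 Real.pi) (hpack : IsCapPacking v ρ)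
    (h : ∀ i j, i ≠ j →
      ⟪(v i : EuclideanSpace ℝ (Fin n)), (v j : EuclideanSpace ℝ (Fin n))⟫ < 1) :
    ∃ r, ρ ≤ r ∧ r ≤ Real.pi ∧ IsMaxPackingRadius v r := by
  set S : Set ℝ := {ρ : ℝ | ρ ∈ Set.Icc 0 Real.pi ∧ IsCapPacking v ρ} with hS
  have hρS : ρ ∈ S := ⟨⟨hρ.1.le, hρ.2⟩, hpack⟩
  have hbdd : BddAbove S := ⟨Real.pi, fun x hx => hx.1.2⟩
  -- Among three distinct points two are not antipodal, since antipodes are unique.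
  obtain ⟨i, j, hij, hneg⟩ : ∃ i j, i ≠ j ∧
      -1 < ⟪(v i : EuclideanSpace ℝ (Fin n)), (v j : EuclideanSpace ℝ (Fin n))⟫ := by
    by_contra! hcon
    have hanti : ∀ i j, i ≠ j →
        (v i : EuclideanSpace ℝ (Fin n)) = -(v j : EuclideanSpace ℝ (Fin n)) := fun i j hij => by
      rw [← inner_eq_neg_one_iff_of_norm_eq_one (𝕜 := ℝ) (norm_eq_of_mem_sphere _)
        (norm_eq_of_mem_sphere _)]
      refine le_antisymm (hcon i j hij) ?_
      have := neg_le_of_abs_le (abs_real_inner_le_norm (v i : EuclideanSpace ℝ (Fin n)) (v j))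
      simpa using this
    have h01 := hanti ⟨0, by omega⟩ ⟨1, by omega⟩ (by simp)
    have h21 := hanti ⟨2, by omega⟩ ⟨1, by omega⟩ (by simp)
    have h02 := h ⟨0, by omega⟩ ⟨2, by omega⟩ (by simp)
    rw [h01, ← h21, inner_self_sphere] at h02
    exact lt_irrefl _ h02
  -- Beyond π/2 the interiors of the caps around v i and v j share the normalized midpoint, which
  -- exists as v i and v j are not antipodal.
  have hhalf : ∀ r ∈ S, r ≤ Real.pi / 2 := by
    intro r hr
    by_contra! hlt
    have hcos : Real.cos r < 0 := Real.cos_neg_of_pi_div_two_lt_of_lt hlt (by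
      linarith [hr.1.2, Real.pi_pos])
    set u : EuclideanSpace ℝ (Fin n) := (v i : EuclideanSpace ℝ (Fin n)) + v j with hu
    have hun : 0 < ‖u‖ := by
      have : 0 < ‖u‖ ^ 2 := by
        rw [hu, norm_add_sq_real, norm_eq_of_mem_sphere, norm_eq_of_mem_sphere]
        linarith
      exact lt_of_le_of_ne (norm_nonneg _) fun h => by rw [← h] at this; simp at this
    let y : Sphere n := ⟨‖u‖⁻¹ • u, by
      rw [mem_sphere_zero_iff_norm, norm_smul, norm_inv, norm_norm, inv_mul_cancel₀ hun.ne']⟩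
    have hui : 0 < ⟪u, (v i : EuclideanSpace ℝ (Fin n))⟫ := by
      rw [hu, inner_add_left, inner_self_sphere, real_inner_comm]; linarith
    have huj : 0 < ⟪u, (v j : EuclideanSpace ℝ (Fin n))⟫ := by
      rw [hu, inner_add_left, inner_self_sphere]; linarith
    have hyi : y ∈ interior (cap (v i) r) := mem_interior_cap_of_lt (hcos.trans (by
      simp only [y, inner_smul_left]; exact mul_pos (by simpa using hun) hui))
    have hyj : y ∈ interior (cap (v j) r) := mem_interior_cap_of_lt (hcos.trans (by
      simp only [y, inner_smul_left]; exact mul_pos (by simpa using hun) huj))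
    exact Set.disjoint_left.1 (hr.2 hij) hyi hyj
  set r := sSup S with hr
  have hρr : ρ ≤ r := le_csSup hbdd hρS
  have hr2 : r ≤ Real.pi / 2 := csSup_le ⟨ρ, hρS⟩ hhalf
  have hrpi : r ≤ Real.pi := by linarith [Real.pi_pos]
  refine ⟨r, hρr, hrpi, ⟨⟨(hρ.1.le.trans hρr), hrpi⟩, ?_⟩, fun x hx => le_csSup hbdd hx⟩
  have hr0 : 0 < r := hρ.1.trans_le hρr
  have hcos : Real.cos r ∈ Set.Ioo (-1) 1 := by
    constructor
    · have : 0 ≤ Real.cos r := Real.cos_nonneg_of_neg_pi_div_two_le_of_le (by linarith) hr2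
      linarith
    · have := Real.cos_lt_cos_of_nonneg_of_le_pi le_rfl hrpi hr0
      simpa using this
  intro i j hij
  refine Set.disjoint_left.2 fun x hi hj => ?_
  have hi' := lt_inner_of_mem_interior_cap hcos hi
  have hj' := lt_inner_of_mem_interior_cap hcos hj
  have hcont : ∀ᶠ t in 𝓝 r,
      Real.cos t < ⟪(x : EuclideanSpace ℝ (Fin n)), (v i : EuclideanSpace ℝ (Fin n))⟫ ∧
      Real.cos t < ⟪(x : EuclideanSpace ℝ (Fin n)), (v j : EuclideanSpace ℝ (Fin n))⟫ :=
    (Real.continuous_cos.continuousAt.eventually_lt_const hi').and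
      (Real.continuous_cos.continuousAt.eventually_lt_const hj')
  obtain ⟨δ, hδ, hball⟩ := Metric.eventually_nhds_iff.1 hcont
  -- A common interior point at the supremum r would already be common to two cap interiors at an
  -- admissible radius t close to r.
  obtain ⟨t, htS, ht⟩ := exists_lt_of_lt_csSup ⟨ρ, hρS⟩ (show r - δ < sSup S by linarith)
  have htr : t ≤ r := le_csSup hbdd htS
  have hd : dist t r < δ := by rw [Real.dist_eq, abs_lt]; constructor <;> linarith
  exact Set.disjoint_left.1 (htS.2 hij) (mem_interior_cap_of_lt (hball hd).1)
    (mem_interior_cap_of_lt (hball hd).2)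

theorem vol_mono {S S' : Set (Sphere n)} (h : S ⊆ S') : vol S ≤ vol S' := by
  unfold vol
  gcongr
  exact measure_ne_top _ _

/-- The surface measure of the cap is n times the volume of the part of its cone inside the unit
ball. This part contains the ellipsoid centred at (7/10) v with half axis 1/10 along v and 1/2
orthogonally to it, up to the null set of its boundary, which the open ball avoids. -/
theorem vol_cap_ge (hn : 0 < n) (v : Sphere n) {r : ℝ} (hr : Real.cos r = 3 / 4) :
    1 / 5 * (1 / 2) ^ n ≤ vol (cap v r) := by
  have : Nonempty (Fin n) := ⟨⟨0, hn⟩⟩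
  set μ : Measure (EuclideanSpace ℝ (Fin n)) := volume with hμ
  set v' : EuclideanSpace ℝ (Fin n) := (v : EuclideanSpace ℝ (Fin n)) with hv'
  have hvv : ‖v'‖ = 1 := norm_eq_of_mem_sphere v
  -- The transvection by φ multiplies v by 1/5 and fixes its orthogonal complement; halving gives
  -- the half axes 1/10 and 1/2 and the determinant 2⁻ⁿ/5.
  let φ : EuclideanSpace ℝ (Fin n) →ₗ[ℝ] ℝ := (-4 / 5 : ℝ) • innerₛₗ ℝ v'
  let f : EuclideanSpace ℝ (Fin n) →ₗ[ℝ] EuclideanSpace ℝ (Fin n) :=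
    (1 / 2 : ℝ) • LinearMap.transvection φ v'
  have hdet : LinearMap.det f = 1 / 5 * (1 / 2) ^ n := by
    simp only [f, LinearMap.det_smul, LinearMap.transvection.det]
    simp only [φ, LinearMap.smul_apply, innerₛₗ_apply_apply, real_inner_self_eq_norm_sq, hvv,
      finrank_euclideanSpace, Fintype.card_fin, smul_eq_mul]
    ring
  have hf : ∀ x, f x = (1 / 2 : ℝ) • (x + (-4 / 5 * ⟪v', x⟫) • v') := fun x => by
    simp [f, φ, LinearMap.transvection.apply]
  set U := (fun z => (7 / 10 : ℝ) • v' + z) '' (f '' Metric.ball 0 1) with hU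
  have hμU : μ.real U = 1 / 5 * (1 / 2) ^ n * μ.real (Metric.ball 0 1) := by
    have h1 : μ U = μ (f '' Metric.ball 0 1) := by
      rw [hU, Set.image_add_left, measure_preimage_add]
    rw [measureReal_def, h1, Measure.addHaar_image_linearMap, hdet, ENNReal.toReal_mul,
      ENNReal.toReal_ofReal (abs_nonneg _), abs_of_nonneg (by positivity), measureReal_def]
  have hsub : U ⊆ Set.Ioo (0 : ℝ) 1 • ((↑) '' cap v r) := by
    rintro _ ⟨_, ⟨x, hx, rfl⟩, rfl⟩
    rw [mem_ball_zero_iff] at hx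
    set s := ⟪v', x⟫ with hs
    have hs1 : |s| ≤ 1 := by
      have := abs_real_inner_le_norm v' x
      rw [hvv] at this
      linarith
    have hs' := abs_le.1 hs1
    have hx2 : ‖x‖ ^ 2 ≤ 1 := pow_le_one₀ (norm_nonneg _) hx.le
    simp only
    set p := (7 / 10 : ℝ) • v' + f x with hp
    have hpe : p = (7 / 10 - 2 / 5 * s) • v' + (1 / 2 : ℝ) • x := by
      rw [hp, hf, smul_add, smul_smul, sub_smul, ← hs, sub_eq_add_neg, ← neg_smul]
      rw [show (1 / 2 : ℝ) * (-4 / 5 * s) = -(2 / 5 * s) by ring]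
      abel
    have hpv : ⟪p, v'⟫ = 7 / 10 + s / 10 := by
      rw [hpe, inner_add_left, inner_smul_left, inner_smul_left, real_inner_self_eq_norm_sq, hvv,
        real_inner_comm v' x, ← hs]
      simp only [conj_trivial]
      ring
    have hpn : ‖p‖ ^ 2 = 49 / 100 + 14 / 100 * s + 1 / 4 * ‖x‖ ^ 2 - 24 / 100 * s ^ 2 := by
      rw [hpe, norm_add_sq_real, inner_smul_left, inner_smul_right, norm_smul, norm_smul, hvv,
        Real.norm_eq_abs, mul_pow, sq_abs, mul_pow, ← hs]
      norm_num
      ring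
    have hp1 : ‖p‖ < 1 := by nlinarith [norm_nonneg p, sq_nonneg s]
    have hp0 : 0 < ‖p‖ := by
      refine norm_pos_iff.2 fun h => ?_
      rw [h, inner_zero_left] at hpv
      linarith
    refine Set.mem_smul.2 ⟨‖p‖, ⟨hp0, hp1⟩, ‖p‖⁻¹ • p,
      ⟨⟨‖p‖⁻¹ • p, by
        rw [mem_sphere_zero_iff_norm, norm_smul, norm_inv, norm_norm, inv_mul_cancel₀ hp0.ne']⟩,
        ?_, rfl⟩, by rw [smul_smul, mul_inv_cancel₀ hp0.ne', one_smul]⟩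
    simp only [cap, Set.mem_ofPred_eq, hr, inner_smul_left, ← hv', hpv]
    simp only [conj_trivial]
    rw [inv_mul_eq_div, le_div_iff₀ hp0]
    refine abs_le_of_sq_le_sq' ?_ (by linarith) |>.2
    rw [mul_pow, hpn]
    nlinarith [sq_nonneg (s + 1 / 5)]
  have hball : 0 < μ.real (Metric.ball 0 1) :=
    ENNReal.toReal_pos (Metric.measure_ball_pos μ 0 one_pos).ne' measure_ball_lt_top.ne
  have hdim : (0 : ℝ) < Module.finrank ℝ (EuclideanSpace ℝ (Fin n)) := by
    rw [finrank_euclideanSpace, Fintype.card_fin]; exact_mod_cast hn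
  unfold vol
  rw [Measure.toSphere_real_apply_univ, le_div_iff₀ (mul_pos hdim hball), measureReal_def (Measure.toSphere _),
    Measure.toSphere_apply' _ (isClosed_cap v r).measurableSet, ENNReal.toReal_mul,
    ENNReal.toReal_natCast]
  have h2 : μ.real U ≤ (μ (Set.Ioo (0 : ℝ) 1 • ((↑) '' cap v r))).toReal := by
    refine ENNReal.toReal_mono (ne_top_of_le_ne_top measure_ball_lt_top.ne (measure_mono
      (t := Metric.ball 0 1) ?_)) (measure_mono hsub)
    intro z hz
    obtain ⟨a, ha, _, ⟨x, -, rfl⟩, rfl⟩ := Set.mem_smul.1 hz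
    rw [mem_ball_zero_iff, norm_smul, norm_eq_of_mem_sphere, mul_one, Real.norm_eq_abs,
      abs_of_pos ha.1]
    exact ha.2
  rw [hμU] at h2
  calc 1 / 5 * (1 / 2) ^ n * (_ * μ.real (Metric.ball 0 1))
      = _ * (1 / 5 * (1 / 2) ^ n * μ.real (Metric.ball 0 1)) := by ring
    _ ≤ _ := by gcongr

/-- Points with small pairwise inner products have a largest packing radius, and the caps of this
radius are not too small. -/
theorem exists_isMaxPackingRadius_capDensity_ge (hn : 0 < n) (hm : 3 ≤ m) (v : Fin m → Sphere n)
    (h : ∀ i j, i ≠ j →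
      ⟪(v i : EuclideanSpace ℝ (Fin n)), (v j : EuclideanSpace ℝ (Fin n))⟫ < 1 / 8) :
    ∃ r, IsMaxPackingRadius v r ∧ m * (1 / 5 * (1 / 2) ^ n) ≤ capDensity v r := by
  set ρ := Real.arccos (3 / 4) with hρ
  have hcos : Real.cos ρ = 3 / 4 := Real.cos_arccos (by norm_num) (by norm_num)
  obtain ⟨r, h1, h2, h3⟩ := exists_isMaxPackingRadius hm (ρ := ρ)
    ⟨Real.arccos_pos.2 (by norm_num), Real.arccos_le_pi _⟩
    (isCapPacking_of_inner_lt (by norm_num) hcos fun i j hij => (h i j hij).trans_le (by norm_num))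
    fun i j hij => (h i j hij).trans (by norm_num)
  refine ⟨r, h3, ?_⟩
  unfold capDensity
  calc m * (1 / 5 * (1 / 2 : ℝ) ^ n) = ∑ _i : Fin m, 1 / 5 * (1 / 2 : ℝ) ^ n := by simp
    _ ≤ _ := Finset.sum_le_sum fun i _ => (vol_cap_ge hn (v i) hcos).trans (vol_mono
        (cap_subset_cap _ (Real.cos_le_cos_of_nonneg_of_le_pi (Real.arccos_nonneg _) h2 h1)))

end Caps


/-! ### The choice of the threshold -/

section Threshold

/-- The numerator of a rational approximation of `n / (1024 m) * exp (t ^ 2 / (2 n))`. -/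
def expNum (n t : ℕ) : ℤ := n * ∏ i ∈ Finset.range t, (4 * (n : ℤ) + 2 * (i : ℤ) + 1)

/-- The denominator of a rational approximation of `n / (1024 m) * exp (t ^ 2 / (2 n))`. -/
def expDen (n m t : ℕ) : ℤ := 1024 * m * ∏ i ∈ Finset.range t, (4 * (n : ℤ) - 2 * (i : ℤ) - 1)

/-- The even terms of the two logarithmic series cancel, so the error is cubic. -/
theorem abs_log_sub_log_sub_le {z : ℝ} (h0 : 0 ≤ z) (h1 : z ≤ 1 / 2) :
    |Real.log (1 + z) - Real.log (1 - z) - 2 * z| ≤ 4 * z ^ 3 := by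
  have ha := Real.abs_log_sub_add_sum_range_le (x := z) (by rw [abs_of_nonneg h0]; linarith) 2
  have hb := Real.abs_log_sub_add_sum_range_le (x := -z)
    (by rw [abs_neg, abs_of_nonneg h0]; linarith) 2
  rw [abs_neg] at hb
  rw [abs_of_nonneg h0] at ha hb
  simp only [Finset.sum_range_succ, Finset.sum_range_zero, sub_neg_eq_add] at ha hb
  have h3 : z ^ (2 + 1) / (1 - z) ≤ 2 * z ^ 3 := by
    rw [div_le_iff₀ (by linarith)]
    have : 0 ≤ z ^ 3 * (1 / 2 - z) := mul_nonneg (by positivity) (by linarith)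
    linear_combination 2 * this
  have ha := abs_le.1 (ha.trans h3)
  have hb := abs_le.1 (hb.trans h3)
  norm_num at ha hb
  rw [abs_le]
  constructor <;> linarith [ha.1, ha.2, hb.1, hb.2]

/-- The quotient of the products is ∏ (1 + z_i)/(1 - z_i) with z_i = (2i+1)/(4n), and ∑ 2 z_i =
t²/(2n) exactly. The cubic errors add up to at most t · 4 (t/(2n))³ = t⁴/(2n³). -/
theorem abs_log_expNum_div_expDen_sub_le {n m t : ℕ} (hn : 0 < n) (hm : 0 < m) (ht : t ≤ n)
    (ht4 : (t : ℝ) ^ 4 ≤ n ^ 3) :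
    0 < expNum n t ∧ 0 < expDen n m t ∧
    |Real.log (expNum n t) - Real.log (expDen n m t) -
      ((t : ℝ) ^ 2 / (2 * n) - Real.log (1024 * m / n))| ≤ 1 / 2 := by
  have hn' : (0 : ℝ) < n := by exact_mod_cast hn
  have hm' : (0 : ℝ) < m := by exact_mod_cast hm
  have hP : ∀ i ∈ Finset.range t, (0 : ℤ) < 4 * (n : ℤ) + 2 * (i : ℤ) + 1 := fun i _ => by positivity
  have hQ : ∀ i ∈ Finset.range t, (0 : ℤ) < 4 * (n : ℤ) - 2 * (i : ℤ) - 1 := fun i hi => by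
    have := Finset.mem_range.1 hi; omega
  have hz : ∀ i ∈ Finset.range t, 0 ≤ (2 * i + 1 : ℝ) / (4 * n) ∧ (2 * i + 1 : ℝ) / (4 * n) ≤ t / (2 * n)
      ∧ (t : ℝ) / (2 * n) ≤ 1 / 2 := fun i hi => by
    have hi' : (i : ℝ) + 1 ≤ t := by exact_mod_cast Finset.mem_range.1 hi
    have htn : (t : ℝ) ≤ n := by exact_mod_cast ht
    refine ⟨by positivity, ?_, ?_⟩
    · rw [div_le_div_iff₀ (by positivity) (by positivity)]
      nlinarith
    · rw [div_le_div_iff₀ (by positivity) (by positivity)]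
      linarith
  refine ⟨mul_pos (by exact_mod_cast hn) (Finset.prod_pos hP),
    mul_pos (by positivity) (Finset.prod_pos hQ), ?_⟩
  have hlog : Real.log (expNum n t) - Real.log (expDen n m t) =
      -Real.log (1024 * m / n) + ∑ i ∈ Finset.range t,
        (Real.log (1 + (2 * i + 1) / (4 * n)) - Real.log (1 - (2 * i + 1) / (4 * n))) := by
    have hPr : ∀ i ∈ Finset.range t, (4 * (n : ℝ) + 2 * (i : ℝ) + 1) ≠ 0 := fun i _ => by positivity
    have hQr : ∀ i ∈ Finset.range t, (4 * (n : ℝ) - 2 * (i : ℝ) - 1) ≠ 0 := fun i hi => by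
      have : (0 : ℝ) < ((4 * (n : ℤ) - 2 * (i : ℤ) - 1 : ℤ) : ℝ) := by exact_mod_cast hQ i hi
      push_cast at this
      exact this.ne'
    unfold expNum expDen
    push_cast
    rw [Real.log_mul hn'.ne' (Finset.prod_ne_zero_iff.2 hPr),
      Real.log_mul (by positivity) (Finset.prod_ne_zero_iff.2 hQr), Real.log_prod hPr,
      Real.log_prod hQr, Real.log_div (by positivity) hn'.ne']
    have : ∀ i ∈ Finset.range t,
        Real.log (1 + (2 * i + 1) / (4 * n)) - Real.log (1 - (2 * i + 1) / (4 * n)) =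
        Real.log (4 * (n : ℝ) + 2 * (i : ℝ) + 1) - Real.log (4 * (n : ℝ) - 2 * (i : ℝ) - 1) := by
      intro i hi
      have e1 : 1 + (2 * i + 1) / (4 * n) = (4 * (n : ℝ) + 2 * (i : ℝ) + 1) / (4 * n) := by
        field_simp; ring
      have e2 : 1 - (2 * i + 1) / (4 * n) = (4 * (n : ℝ) - 2 * (i : ℝ) - 1) / (4 * n) := by
        field_simp; ring
      rw [e1, e2, Real.log_div (hPr i hi) (by positivity), Real.log_div (hQr i hi) (by positivity)]
      ring
    rw [Finset.sum_congr rfl this, Finset.sum_sub_distrib]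
    ring
  have hsq : ∀ t : ℕ, ∑ i ∈ Finset.range t, 2 * ((2 * i + 1 : ℝ) / (4 * n)) = (t : ℝ) ^ 2 / (2 * n) := by
    intro t
    induction t with
    | zero => simp
    | succ k ih => rw [Finset.sum_range_succ, ih]; push_cast; field_simp; ring
  have e : Real.log (expNum n t) - Real.log (expDen n m t) -
      ((t : ℝ) ^ 2 / (2 * n) - Real.log (1024 * m / n)) = ∑ i ∈ Finset.range t,
        (Real.log (1 + (2 * i + 1) / (4 * n)) - Real.log (1 - (2 * i + 1) / (4 * n)) -
          2 * ((2 * i + 1) / (4 * n))) := by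
    rw [Finset.sum_sub_distrib, hsq, hlog]
    ring
  rw [e]
  calc _ ≤ ∑ i ∈ Finset.range t, |Real.log (1 + (2 * i + 1) / (4 * n)) -
        Real.log (1 - (2 * i + 1) / (4 * n)) - 2 * ((2 * i + 1) / (4 * n))| :=
        Finset.abs_sum_le_sum_abs _ _
    _ ≤ ∑ _i ∈ Finset.range t, 4 * ((t : ℝ) / (2 * n)) ^ 3 := Finset.sum_le_sum fun i hi => by
        obtain ⟨h1, h2, h3⟩ := hz i hi
        refine (abs_log_sub_log_sub_le h1 (h2.trans h3)).trans ?_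
        gcongr
    _ = (t : ℝ) ^ 4 / (2 * n ^ 3) := by
        rw [Finset.sum_const, Finset.card_range, nsmul_eq_mul]
        field_simp
        ring
    _ ≤ 1 / 2 := by
        rw [div_le_div_iff₀ (by positivity) (by norm_num)]
        linarith

/-- The number of points is at least linear and not too large in the dimension. -/
structure Moderate (n m : ℕ) : Prop where
  large : 10 ^ 6 ≤ n
  le : 16 * n ≤ m
  log_le : Real.log (m / n) ≤ Real.sqrt n / 1000

/-- The number `lam` is a suitable numerator of the threshold `lam / n`. -/
structure IsThreshold (n m lam : ℕ) : Prop where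
  pos : 0 < lam
  le : lam ≤ n
  lt : ∀ t < lam, expNum n t < expDen n m t
  ge : expDen n m lam ≤ expNum n lam
  sq_ge : Real.log (1024 * m / n) - 1 / 2 ≤ (lam : ℝ) ^ 2 / (2 * n)
  sq_le : ((lam : ℝ) - 1) ^ 2 / (2 * n) ≤ Real.log (1024 * m / n) + 1 / 2

namespace Moderate

variable {n m : ℕ}

theorem cast_large (h : Moderate n m) : (10 : ℝ) ^ 6 ≤ n := by exact_mod_cast h.large

theorem cast_le (h : Moderate n m) : 16 * (n : ℝ) ≤ m := by exact_mod_cast h.le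

theorem sqrt_ge (h : Moderate n m) : 1000 ≤ Real.sqrt n :=
  Real.le_sqrt_of_sq_le (by norm_num; have := h.large; exact_mod_cast this)

theorem log_two_bounds : 0.69 ≤ Real.log 2 ∧ Real.log 2 ≤ 0.7 := by
  constructor <;> linarith [Real.log_two_gt_d9, Real.log_two_lt_d9]

theorem log_ge (h : Moderate n m) : 2.7 ≤ Real.log (m / n) := by
  have hn : (0 : ℝ) < n := by have := h.cast_large; linarith
  have h1 : (2 : ℝ) ^ 4 ≤ m / n := by
    rw [le_div_iff₀ hn]; have := h.cast_le; linarith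
  have h2 := Real.log_le_log (by positivity) h1
  rw [Real.log_pow] at h2
  have := log_two_bounds.1
  push_cast at h2
  linarith

theorem log_mul_eq (h : Moderate n m) :
    Real.log (m / n) + 6.9 ≤ Real.log (1024 * m / n) ∧
    Real.log (1024 * m / n) ≤ Real.log (m / n) + 7 := by
  have hn : (0 : ℝ) < n := by have := h.cast_large; linarith
  have hm : (0 : ℝ) < m := by have := h.cast_le; linarith
  have e : Real.log (1024 * m / n) = 10 * Real.log 2 + Real.log (m / n) := by
    rw [mul_div_assoc, Real.log_mul (by norm_num) (by positivity),
      show (1024 : ℝ) = 2 ^ 10 by norm_num, Real.log_pow]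
    norm_num
  have := log_two_bounds
  rw [e]
  constructor <;> linarith

theorem exists_isThreshold (h : Moderate n m) : ∃ lam, IsThreshold n m lam := by
  have hn0 := h.cast_large
  have hn : (0 : ℝ) < n := by linarith
  have hn1 : 0 < n := by have := h.large; omega
  have hm1 : 0 < m := by have := h.le; omega
  set μ := Real.log (1024 * m / n) with hμ
  set q := Real.sqrt n with hq
  have hqq : q ^ 2 = n := Real.sq_sqrt hn.le
  have hq1 := h.sqrt_ge
  have hL := h.log_ge
  have hμL := h.log_mul_eq
  have hLq := h.log_le
  have hμ0 : 0 ≤ μ := by linarith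
  set x := Real.sqrt (2 * n * (μ + 1)) with hx
  have hxx : x ^ 2 = 2 * n * (μ + 1) := Real.sq_sqrt (by positivity)
  have hx0 : 0 ≤ x := Real.sqrt_nonneg _
  set t₀ := ⌈x⌉₊ with ht₀
  have ht1 : x ≤ t₀ := Nat.le_ceil x
  have ht2 : (t₀ : ℝ) < x + 1 := Nat.ceil_lt_add_one hx0
  have ht0 : (0 : ℝ) ≤ t₀ := by positivity
  -- Since ln(m/n) ≤ √n/1000, the square of t₀ is at most n √n, which is the condition t⁴ ≤ n³ of
  -- the approximation.
  have hsq : (t₀ : ℝ) ^ 2 ≤ n * q := by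
    have : (t₀ : ℝ) ^ 2 ≤ 2 * x ^ 2 + 2 := by nlinarith [sq_nonneg (x - 1)]
    have h2 : μ + 1 ≤ q / 50 := by linarith
    have h3 : 2 * (2 * n * (μ + 1)) ≤ 2 * (2 * n * (q / 50)) := by gcongr
    rw [hxx] at this
    nlinarith
  have h4 : ∀ t ≤ t₀, (t : ℝ) ^ 4 ≤ n ^ 3 ∧ t ≤ n := by
    intro t ht
    have htr : (t : ℝ) ≤ t₀ := by exact_mod_cast ht
    have h1 : (t : ℝ) ^ 2 ≤ n * q := (by gcongr : (t : ℝ) ^ 2 ≤ (t₀ : ℝ) ^ 2).trans hsq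
    constructor
    · calc (t : ℝ) ^ 4 = (t ^ 2) ^ 2 := by ring
        _ ≤ (n * q) ^ 2 := by gcongr
        _ = n ^ 3 := by rw [mul_pow, hqq]; ring
    · have h2 : (t : ℝ) ^ 2 ≤ (n : ℝ) ^ 2 := h1.trans (by rw [sq]; gcongr; nlinarith)
      have := abs_le_of_sq_le_sq' h2 hn.le
      exact_mod_cast this.2
  have key : ∀ t ≤ t₀, _ := fun t ht =>
    abs_log_expNum_div_expDen_sub_le (m := m) hn1 hm1 (h4 t ht).2 (h4 t ht).1
  have hgood : expDen n m t₀ ≤ expNum n t₀ := by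
    obtain ⟨hP, hQ, hlog⟩ := key t₀ le_rfl
    have h5 : μ + 1 ≤ (t₀ : ℝ) ^ 2 / (2 * n) := by
      rw [le_div_iff₀ (by positivity)]
      have : x ^ 2 ≤ (t₀ : ℝ) ^ 2 := by gcongr
      linarith
    have h6 := (abs_le.1 hlog).1
    have h7 : Real.log (expDen n m t₀) ≤ Real.log (expNum n t₀) := by linarith
    have hQ' : (0 : ℝ) < expDen n m t₀ := by exact_mod_cast hQ
    have hP' : (0 : ℝ) < expNum n t₀ := by exact_mod_cast hP
    exact_mod_cast (Real.log_le_log_iff hQ' hP').1 h7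
  classical
  have hex : ∃ t, expDen n m t ≤ expNum n t := ⟨t₀, hgood⟩
  set lam := Nat.find hex with hlam
  have hle : lam ≤ t₀ := Nat.find_min' hex hgood
  have hge := Nat.find_spec hex
  rw [← hlam] at hge
  have hpos : 0 < lam := by
    rw [Nat.pos_iff_ne_zero]
    intro h0
    rw [h0] at hge
    simp only [expDen, expNum, Finset.range_zero, Finset.prod_empty, mul_one] at hge
    have := h.le
    omega
  have hlt : ∀ t < lam, expNum n t < expDen n m t := fun t ht => not_le.1 (Nat.find_min hex ht)
  refine ⟨lam, hpos, (h4 lam hle).2, hlt, hge, ?_, ?_⟩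
  · obtain ⟨hP, hQ, hlog⟩ := key lam hle
    have hQ' : (0 : ℝ) < expDen n m lam := by exact_mod_cast hQ
    have h7 : Real.log (expDen n m lam) ≤ Real.log (expNum n lam) :=
      Real.log_le_log hQ' (by exact_mod_cast hge)
    have := (abs_le.1 hlog).2
    linarith
  · obtain ⟨hP, hQ, hlog⟩ := key (lam - 1) (by omega)
    have hP' : (0 : ℝ) < expNum n (lam - 1) := by exact_mod_cast hP
    have h7 : Real.log (expNum n (lam - 1)) ≤ Real.log (expDen n m (lam - 1)) :=
      Real.log_le_log hP' (by exact_mod_cast (hlt (lam - 1) (by omega)).le)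
    have := (abs_le.1 hlog).1
    rw [Nat.cast_sub hpos, Nat.cast_one] at this
    linarith

end Moderate

namespace IsThreshold

variable {n m lam : ℕ}

/-- The factor 1024 in the search leaves room for the error exp(1/2) ≤ 3, as 1024/3 > 300. -/
theorem exp_ge (h : Moderate n m) (hl : IsThreshold n m lam) :
    300 * (m : ℝ) ≤ n * Real.exp ((lam : ℝ) ^ 2 / (2 * n)) := by
  have hn : (0 : ℝ) < n := by have := h.cast_large; linarith
  have hm : (0 : ℝ) < m := by have := h.cast_le; linarith
  have h1 := Real.exp_le_exp.2 hl.sq_ge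
  rw [Real.exp_sub, Real.exp_log (by positivity)] at h1
  have h2 : Real.exp (1 / 2) ≤ 3 := by
    have : Real.exp (1 / 2) ≤ Real.exp 1 := Real.exp_le_exp.2 (by norm_num)
    linarith [Real.exp_one_lt_d9]
  have h3 : 0 < Real.exp (1 / 2) := Real.exp_pos _
  calc 300 * (m : ℝ) ≤ n * (1024 * m / n / 3) := by
        field_simp
        norm_num
    _ ≤ n * (1024 * m / n / Real.exp (1 / 2)) := by gcongr
    _ ≤ _ := by gcongr

theorem le_add_sqrt (h : Moderate n m) (hl : IsThreshold n m lam) :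
    (lam : ℝ) ≤ 1 + Real.sqrt (2 * n * (Real.log (m / n) + 7.5)) := by
  have hn : (0 : ℝ) < n := by have := h.cast_large; linarith
  have h1 := hl.sq_le
  rw [div_le_iff₀ (by positivity)] at h1
  have h2 := h.log_mul_eq.2
  have : (lam : ℝ) - 1 ≤ Real.sqrt (2 * n * (Real.log (m / n) + 7.5)) := by
    refine Real.le_sqrt_of_sq_le (h1.trans ?_)
    nlinarith
  linarith

/-- This is where m must not exceed 2^{o(√n)}: λ²/(2n), of the order of ln(m/n), has to stay below
√n/20. -/
theorem small (h : Moderate n m) (hl : IsThreshold n m lam) :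
    (lam : ℝ) ^ 2 / (2 * n) * (20 / Real.sqrt n) ≤ 1 := by
  have hn0 := h.cast_large
  have hn : (0 : ℝ) < n := by linarith
  have hq := h.sqrt_ge
  have h1 := hl.le_add_sqrt h
  have hL := h.log_ge
  have hLq := h.log_le
  set y := Real.sqrt (2 * n * (Real.log (m / n) + 7.5)) with hy
  have hyy : y ^ 2 = 2 * n * (Real.log (m / n) + 7.5) := Real.sq_sqrt (by
    have : 0 ≤ Real.log (m / n) := by linarith
    positivity)
  have h2 : (lam : ℝ) ^ 2 ≤ 2 * y ^ 2 + 2 := by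
    have : (lam : ℝ) ^ 2 ≤ (1 + y) ^ 2 := by gcongr
    nlinarith [sq_nonneg (y - 1)]
  have h3 : (lam : ℝ) ^ 2 / (2 * n) ≤ Real.sqrt n / 20 := by
    rw [div_le_iff₀ (by positivity)]
    rw [hyy] at h2
    have : 2 * (2 * n * (Real.log (m / n) + 7.5)) ≤ 2 * (2 * n * (Real.sqrt n / 1000 + 7.5)) := by
      gcongr
    nlinarith
  calc (lam : ℝ) ^ 2 / (2 * n) * (20 / Real.sqrt n) ≤ Real.sqrt n / 20 * (20 / Real.sqrt n) := by
        gcongr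
    _ = 1 := by field_simp

theorem log_le (h : Moderate n m) (hl : IsThreshold n m lam) :
    Real.log (m / n) ≤ (lam : ℝ) ^ 2 / (2 * n) := by
  have := hl.sq_ge
  have := h.log_mul_eq.1
  linarith

/-- The bound on the norms that the walk provides. -/
theorem norm_bound_ge (h : Moderate n m) (hl : IsThreshold n m lam) :
    1 - 2 / (5 * Real.log (m / n)) ≤
      1 - 1 / (5 * ((lam : ℝ) ^ 2 / (2 * n))) - 6 / Real.sqrt n := by
  have hL := h.log_ge
  have hLq := h.log_le
  have hq := h.sqrt_ge
  have h1 : 1 / (5 * ((lam : ℝ) ^ 2 / (2 * n))) ≤ 1 / (5 * Real.log (m / n)) := by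
    have := hl.log_le h
    gcongr
  have h2 : 6 / Real.sqrt n ≤ 1 / (5 * Real.log (m / n)) := by
    rw [div_le_div_iff₀ (by positivity) (by positivity)]
    linarith
  have h3 : 2 / (5 * Real.log (m / n)) = 1 / (5 * Real.log (m / n)) + 1 / (5 * Real.log (m / n)) := by
    ring
  linarith

/-- All losses are relative errors O(1/L) for L = ln(m/n), measured against z = √(2nL). The shift
7.5 under the root costs 4/L; the remaining additive 6 costs 6/L as z ≥ L; dividing by 1 - 2/(5L)
raises 10/L to at most 20/L. Passing to base 2 turns 20 into 30, since 30 ln 2 > 20. -/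
theorem bound_le (h : Moderate n m) (hl : IsThreshold n m lam) :
    ((lam : ℝ) + 5) / n / (1 - 2 / (5 * Real.log (m / n))) ≤
      Real.sqrt (2 * Real.log (m / n) / n) * (1 + 30 / Real.logb 2 (m / n)) := by
  have hn0 := h.cast_large
  have hn : (0 : ℝ) < n := by linarith
  have hL := h.log_ge
  have hLq := h.log_le
  have hq := h.sqrt_ge
  have h1 := hl.le_add_sqrt h
  set L := Real.log (m / n) with hLdef
  have hL0 : 0 < L := by linarith
  set z := Real.sqrt (2 * n * L) with hz
  have hzz : z ^ 2 = 2 * n * L := Real.sq_sqrt (by positivity)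
  have hz0 : 0 < z := Real.sqrt_pos.2 (by positivity)
  have h2 : Real.sqrt (2 * n * (L + 7.5)) ≤ z * (1 + 4 / L) := by
    rw [Real.sqrt_le_left (by positivity), mul_pow, hzz]
    have : L + 7.5 ≤ L * (1 + 4 / L) ^ 2 := by
      have : L * (1 + 4 / L) ^ 2 = L + 8 + 16 / L := by field_simp; ring
      have : 0 < 16 / L := by positivity
      linarith
    calc 2 * n * (L + 7.5) ≤ 2 * n * (L * (1 + 4 / L) ^ 2) := by gcongr
      _ = _ := by ring
  have h3 : L ≤ z := by
    refine Real.le_sqrt_of_sq_le ?_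
    have hqq : Real.sqrt n ^ 2 = n := Real.sq_sqrt hn.le
    have : L ≤ 2 * n := by nlinarith
    nlinarith
  have h4 : (lam : ℝ) + 5 ≤ z * (1 + 10 / L) := by
    have : 6 ≤ z * (6 / L) := by
      rw [← mul_div_assoc, le_div_iff₀ hL0]; linarith
    have e : z * (1 + 10 / L) = z * (1 + 4 / L) + z * (6 / L) := by ring
    linarith
  have hlogb : Real.logb 2 (m / n) = L / Real.log 2 := rfl
  have h5 : 1 + 20 / L ≤ 1 + 30 / Real.logb 2 (m / n) := by
    rw [hlogb, div_div_eq_mul_div]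
    have := Moderate.log_two_bounds.1
    gcongr
    linarith
  have h6 : z / n = Real.sqrt (2 * L / n) := by
    rw [eq_comm, Real.sqrt_eq_iff_mul_self_eq_of_pos (by positivity)]
    field_simp
    linarith
  have hx : 2 / (5 * L) ≤ 0.15 := by
    rw [div_le_iff₀ (by positivity)]; linarith
  have h7 : 1 + 10 / L ≤ (1 + 20 / L) * (1 - 2 / (5 * L)) := by
    have e : (1 + 20 / L) * (1 - 2 / (5 * L)) = 1 + 10 / L + (9.6 * L - 8) / L ^ 2 := by
      field_simp; ring
    rw [e]
    have : 0 ≤ (9.6 * L - 8) / L ^ 2 := div_nonneg (by linarith) (by positivity)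
    linarith
  calc ((lam : ℝ) + 5) / n / (1 - 2 / (5 * L))
      ≤ z * ((1 + 20 / L) * (1 - 2 / (5 * L))) / n / (1 - 2 / (5 * L)) := by
        gcongr
        · linarith
        · exact h4.trans (by gcongr)
    _ = z / n * (1 + 20 / L) := by
        have : 1 - 2 / (5 * L) ≠ 0 := by linarith
        generalize 1 - 2 / (5 * L) = d at this
        field_simp
    _ ≤ _ := by
        rw [h6]
        gcongr

end IsThreshold

/-- The value 1/8 is 2(3/4)² - 1, the condition for disjoint caps with cosine 3/4. The assumption m
≥ 16 n keeps the correction factor below 11. -/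
theorem Moderate.bound_lt {n m : ℕ} (h : Moderate n m) :
    Real.sqrt (2 * Real.log (m / n) / n) * (1 + 30 / Real.logb 2 (m / n)) < 1 / 8 := by
  have hn0 := h.cast_large
  have hn : (0 : ℝ) < n := by linarith
  have hL := h.log_ge
  have hLq := h.log_le
  have hq := h.sqrt_ge
  have h1 : Real.sqrt (2 * Real.log (m / n) / n) ≤ 1 / 600 := by
    rw [Real.sqrt_le_left (by norm_num), div_le_iff₀ hn]
    have hqq : Real.sqrt n ^ 2 = n := Real.sq_sqrt hn.le
    nlinarith
  have h2 : 1 + 30 / Real.logb 2 (m / n) ≤ 11 := by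
    have : 30 / Real.logb 2 (m / n) = 30 * Real.log 2 / Real.log (m / n) := by
      rw [Real.logb, div_div_eq_mul_div]
    rw [this]
    have := log_two_bounds.2
    have : 30 * Real.log 2 / Real.log (m / n) ≤ 10 := by
      rw [div_le_iff₀ (by linarith)]; linarith
    linarith
  have h3 : 0 ≤ 30 / Real.logb 2 (m / n) := by
    have : 0 ≤ Real.logb 2 (m / n) := div_nonneg (by linarith) (Real.log_nonneg (by norm_num))
    positivity
  calc _ ≤ (1 / 600 : ℝ) * 11 := by gcongr
    _ < 1 / 8 := by norm_num

theorem eventually_moderate {m : ℕ → ℕ} {f : ℕ → ℝ}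
    (hf : f =o[atTop] (fun n : ℕ => Real.sqrt (n : ℝ)))
    (hm : ∀ᶠ n : ℕ in atTop, 16 * n ≤ m n ∧ (m n : ℝ) ≤ (2 : ℝ) ^ (f n)) :
    ∀ᶠ n : ℕ in atTop, Moderate n (m n) := by
  filter_upwards [hf.bound (show (0 : ℝ) < 1 / 1000 by norm_num), hm, eventually_ge_atTop (10 ^ 6)]
    with n h1 h2 h3
  have hn : (1 : ℝ) ≤ n := by exact_mod_cast (by omega : 1 ≤ n)
  have hm16 : 16 * (n : ℝ) ≤ m n := by exact_mod_cast h2.1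
  refine ⟨h3, h2.1, ?_⟩
  rw [Real.norm_of_nonneg (Real.sqrt_nonneg _)] at h1
  have h4 : f n ≤ Real.sqrt n / 1000 := (le_abs_self _).trans (h1.trans (by linarith))
  have h5 : Real.log (m n / n) ≤ Real.log (2 ^ f n) := by
    refine Real.log_le_log (div_pos (by linarith) (by linarith)) ?_
    exact (div_le_self (by positivity) hn).trans h2.2
  rw [Real.log_rpow (by norm_num)] at h5
  have := Moderate.log_two_bounds
  rcases le_or_gt 0 (f n) with h6 | h6
  · nlinarith
  · have : 0 ≤ Real.sqrt n := Real.sqrt_nonneg _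
    nlinarith

end Threshold


/-! ### The construction in integer arithmetic -/

section Integer

/-- The inner product of the first `n` entries. -/
def dot (n : ℕ) (a b : ℕ → ℤ) : ℤ := ∑ l ∈ Finset.range n, a l * b l

/-- The scale of the output: the integer vector `u` represents `u / scaleD m`. -/
def scaleD (m : ℕ) : ℤ := (m : ℤ) ^ 4

/-- The multiple of the identity in the damping map, in integer scale. -/
def scaleK (m : ℕ) : ℤ := 2 * m * scaleD m ^ 2

/-- The power of the damping map. -/
def reps (m : ℕ) : ℕ := m ^ 8

/-- The scale of the directions. -/
def scaleE (m : ℕ) : ℤ := scaleK m ^ reps m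

/-- The scale of the weights. -/
def scaleF (n m : ℕ) : ℤ := n ^ 2 * scaleE m * scaleD m

/-- The vectors `a` damped along the rows `V j` with `h j = 1`, in integer scale. -/
def shrink (n m p : ℕ) (h : ℕ → ℤ) (V : ℕ → ℕ → ℤ) (r : ℕ → ℤ) : ℕ → ℤ := fun l =>
  scaleK m * r l - ∑ j ∈ Finset.range p, h j * dot n (V j) r * V j l

/-- A standard basis vector. -/
def unitRow (i : ℕ) : ℕ → ℤ := fun l => if l = i then 1 else 0

/-- A standard basis vector, repeatedly damped. -/
def column (n m p : ℕ) (h : ℕ → ℤ) (V : ℕ → ℕ → ℤ) (i : ℕ) : ℕ → ℤ :=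
  (shrink n m p h V)^[reps m] (unitRow i)

/-- A state of the walk: position, weights, correction, and the common scale of the weights. -/
structure Walk where
  Y : ℕ → ℤ
  W : ℕ → ℤ
  X : ℤ
  Z : ℤ

namespace Walk

/-- The initial state of the walk. -/
def init : Walk := ⟨fun _ => 0, fun _ => 1, 0, 1⟩

/-- The first order change of the potential in the direction `r`. -/
def gain (n m lam p : ℕ) (V : ℕ → ℕ → ℤ) (S : Walk) (r : ℕ → ℤ) : ℤ :=
  lam * n ^ 5 * scaleE m ^ 3 * ∑ j ∈ Finset.range p, S.W j * dot n (V j) r +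
    4 * m * scaleD m * S.Z * S.X * dot n S.Y r

/-- The sign with which the walk moves in the direction `r`. -/
def sgn (n m lam p : ℕ) (V : ℕ → ℕ → ℤ) (S : Walk) (r : ℕ → ℤ) : ℤ :=
  if 0 < gain n m lam p V S r then -1 else 1

/-- One step of the walk, in the direction `r`. -/
def step (n m lam p : ℕ) (V : ℕ → ℕ → ℤ) (S : Walk) (r : ℕ → ℤ) : Walk where
  Y := fun l => S.Y l + sgn n m lam p V S r * r l
  W := fun j => S.W j * (scaleF n m + sgn n m lam p V S r * lam * dot n (V j) r)
  X := S.X + 2 * sgn n m lam p V S r * dot n S.Y r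
  Z := S.Z * scaleF n m

/-- The indicator of the rows that have a large inner product with the position. -/
def heavy (n m lam : ℕ) (V : ℕ → ℕ → ℤ) (S : Walk) : ℕ → ℤ := fun j =>
  if lam * n * scaleE m * scaleD m ≤ dot n (V j) S.Y then 1 else 0

/-- The state after `i` steps of a round. -/
def inRound (n m lam p : ℕ) (V : ℕ → ℕ → ℤ) (S : Walk) : ℕ → Walk
  | 0 => S
  | i + 1 => (inRound n m lam p V S i).step n m lam p V (column n m p (S.heavy n m lam V) V i)

/-- The state after `b` rounds. -/
def rounds (n m lam p : ℕ) (V : ℕ → ℕ → ℤ) : ℕ → Walk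
  | 0 => init
  | b + 1 => (rounds n m lam p V b).inRound n m lam p V n

end Walk

/-- The row that is appended to the rows `V 0, …, V (p - 1)`. -/
def nextRow (n m lam p : ℕ) (V : ℕ → ℕ → ℤ) : ℕ → ℤ := fun l =>
  Int.fdiv (scaleD m * (Walk.rounds n m lam p V (n ^ 3)).Y l) (n ^ 2 * scaleE m)

/-- The table of the first `p` rows. -/
def table (n m lam : ℕ) : ℕ → ℕ → ℕ → ℤ
  | 0 => fun _ _ => 0
  | p + 1 => Function.update (table n m lam p) p (nextRow n m lam p (table n m lam p))

theorem table_eq {n m lam p q j : ℕ} (hj : j < p) (hpq : p ≤ q) :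
    table n m lam q j = table n m lam p j := by
  induction q, hpq using Nat.le_induction with
  | base => rfl
  | succ q hq ih => rw [table, Function.update_of_ne (by omega), ih]

theorem table_succ_self (n m lam p : ℕ) :
    table n m lam (p + 1) p = nextRow n m lam p (table n m lam p) := by simp [table]

open scoped RealInnerProductSpace

/-- The Euclidean vector with the given integer coordinates. -/
noncomputable def vec (n : ℕ) (a : ℕ → ℤ) : EuclideanSpace ℝ (Fin n) :=
  WithLp.toLp 2 fun i => (a i : ℝ)

@[simp] theorem vec_apply (n : ℕ) (a : ℕ → ℤ) (i : Fin n) : vec n a i = a i := rfl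

theorem inner_vec (n : ℕ) (a b : ℕ → ℤ) : ⟪vec n a, vec n b⟫ = (dot n a b : ℝ) := by
  simp only [dot, PiLp.inner_apply, vec_apply, Finset.sum_range, Int.cast_sum, Int.cast_mul]
  exact Finset.sum_congr rfl fun i _ => by simp [mul_comm]

theorem scaleD_pos {m : ℕ} (hm : 0 < m) : 0 < scaleD m := by unfold scaleD; positivity

theorem scaleK_pos {m : ℕ} (hm : 0 < m) : 0 < scaleK m := by
  have := scaleD_pos hm
  unfold scaleK; positivity

theorem scaleE_pos {m : ℕ} (hm : 0 < m) : 0 < scaleE m := pow_pos (scaleK_pos hm) _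

theorem scaleF_pos {n m : ℕ} (hn : 0 < n) (hm : 0 < m) : 0 < scaleF n m := by
  have := scaleD_pos hm
  have := scaleE_pos hm
  unfold scaleF; positivity

/-- The vector represented by a row. -/
noncomputable def pt (n m : ℕ) (V : ℕ → ℕ → ℤ) (j : ℕ) : EuclideanSpace ℝ (Fin n) :=
  (scaleD m : ℝ)⁻¹ • vec n (V j)

/-- The scale K = 2 m D² clears both κ = 2m and the two factors 1/D of each rank one term, so the
damping is exact in integers. -/
theorem vec_shrink {n m p : ℕ} (hm : 0 < m) {h : ℕ → ℤ} (h01 : ∀ j, h j = 0 ∨ h j = 1)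
    (V : ℕ → ℕ → ℤ) (r : ℕ → ℤ) :
    vec n (shrink n m p h V r) = (scaleK m : ℝ) •
      damp ((Finset.range p).filter fun j => h j = 1) (pt n m V) (2 * m) (vec n r) := by
  have hD : (scaleD m : ℝ) ≠ 0 := by exact_mod_cast (scaleD_pos hm).ne'
  have hm' : (m : ℝ) ≠ 0 := by exact_mod_cast hm.ne'
  rw [damp_apply, smul_sub, smul_smul, Finset.smul_sum]
  ext l
  simp only [vec_apply, PiLp.sub_apply, PiLp.smul_apply, smul_eq_mul, shrink, Int.cast_sub,
    Int.cast_mul, Int.cast_sum]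
  congr 1
  rw [Finset.sum_filter, WithLp.ofLp_sum, Finset.sum_apply]
  refine Finset.sum_congr rfl fun j _ => ?_
  have hK : (scaleK m : ℝ) = 2 * m * scaleD m ^ 2 := by simp [scaleK]
  rcases h01 j with e | e
  · simp [e]
  · simp only [e, if_true, Int.cast_one, one_mul, PiLp.smul_apply, smul_eq_mul, pt,
      inner_smul_left, inner_vec, vec_apply, conj_trivial, hK]
    field_simp

theorem vec_unitRow {n : ℕ} (i : Fin n) :
    vec n (unitRow i) = EuclideanSpace.basisFun (Fin n) ℝ i := by
  ext l
  simp [unitRow, Fin.ext_iff]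

theorem vec_shrink_iterate {n m p : ℕ} (hm : 0 < m) {h : ℕ → ℤ} (h01 : ∀ j, h j = 0 ∨ h j = 1)
    (V : ℕ → ℕ → ℤ) (r : ℕ → ℤ) (k : ℕ) :
    vec n ((shrink n m p h V)^[k] r) = (scaleK m : ℝ) ^ k •
      (damp ((Finset.range p).filter fun j => h j = 1) (pt n m V) (2 * m) ^ k) (vec n r) := by
  induction k with
  | zero => simp
  | succ k ih =>
    rw [Function.iterate_succ_apply', vec_shrink hm h01, ih, map_smul, smul_smul, pow_succ',
      pow_succ' (damp _ _ _), Module.End.mul_apply]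

theorem heavy_eq_zero_or_one (n m lam : ℕ) (V : ℕ → ℕ → ℤ) (S : Walk) (j : ℕ) :
    S.heavy n m lam V j = 0 ∨ S.heavy n m lam V j = 1 := by
  unfold Walk.heavy; split <;> simp

namespace Walk

theorem sgn_eq (n m lam p : ℕ) (V : ℕ → ℕ → ℤ) (S : Walk) (r : ℕ → ℤ) :
    sgn n m lam p V S r = 1 ∨ sgn n m lam p V S r = -1 := by
  unfold sgn; split <;> simp

theorem sgn_mul_gain_le (n m lam p : ℕ) (V : ℕ → ℕ → ℤ) (S : Walk) (r : ℕ → ℤ) :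
    sgn n m lam p V S r * gain n m lam p V S r ≤ 0 := by
  unfold sgn; split <;> linarith

/-- The position in real scale. -/
noncomputable def pos (n m : ℕ) (S : Walk) : EuclideanSpace ℝ (Fin n) :=
  ((n : ℝ) ^ 2 * scaleE m)⁻¹ • vec n S.Y

/-- The weights in real scale. -/
noncomputable def weight (S : Walk) (j : ℕ) : ℝ := S.W j / S.Z

/-- The correction in real scale. -/
noncomputable def corr (n m : ℕ) (S : Walk) : ℝ := S.X / (n ^ 4 * (scaleE m : ℝ) ^ 2)

theorem inRound_Z_pos {n m lam p : ℕ} {V : ℕ → ℕ → ℤ} (hn : 0 < n) (hm : 0 < m) {S : Walk}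
    (hS : 0 < S.Z) (i : ℕ) : 0 < (inRound n m lam p V S i).Z := by
  induction i with
  | zero => exact hS
  | succ i ih => exact mul_pos ih (scaleF_pos hn hm)

theorem rounds_Z_pos {n m lam p : ℕ} {V : ℕ → ℕ → ℤ} (hn : 0 < n) (hm : 0 < m) (b : ℕ) :
    0 < (rounds n m lam p V b).Z := by
  induction b with
  | zero => exact one_pos
  | succ b ih => exact inRound_Z_pos hn hm ih n

/-- No rounding occurs inside the walk: the integer step is the real step multiplied by the scales.
In particular `gain` is the first order change of the potential times the positive number n⁷ E⁴ D Z,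
so its sign is the right one. -/
theorem signedWalk {n m lam p : ℕ} {V : ℕ → ℕ → ℤ} (hn : 0 < n) (hm : 0 < m) {S : Walk}
    (hS : 0 < S.Z) (K : ℕ) :
    SignedWalk (Finset.range p) (pt n m V) lam (1 / n ^ 2) (m * n) K
      (fun i => (scaleE m : ℝ)⁻¹ • vec n (column n m p (S.heavy n m lam V) V i))
      (fun i => pos n m (inRound n m lam p V S i)) (fun i => weight (inRound n m lam p V S i))
      (fun i => corr n m (inRound n m lam p V S i))
      (fun i => sgn n m lam p V (inRound n m lam p V S i)
        (column n m p (S.heavy n m lam V) V i)) := by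
  have hn' : (n : ℝ) ≠ 0 := by exact_mod_cast hn.ne'
  have hD : (0 : ℝ) < scaleD m := by exact_mod_cast scaleD_pos hm
  have hE : (0 : ℝ) < scaleE m := by exact_mod_cast scaleE_pos hm
  have hD' := hD.ne'
  have hE' := hE.ne'
  have hF : (scaleF n m : ℝ) = n ^ 2 * scaleE m * scaleD m := by simp [scaleF]
  constructor
  · intro i _
    rcases sgn_eq n m lam p V (inRound n m lam p V S i) (column n m p (S.heavy n m lam V) V i)
      with e | e <;> simp [e]
  · intro i _
    ext l
    simp only [pos, inRound, step, PiLp.smul_apply, PiLp.add_apply, vec_apply, smul_eq_mul,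
      Int.cast_add, Int.cast_mul]
    field_simp
  · intro i _ j _
    have hZ : ((inRound n m lam p V S i).Z : ℝ) ≠ 0 := by
      exact_mod_cast (inRound_Z_pos hn hm hS i).ne'
    simp only [weight, inRound, step, Int.cast_add, Int.cast_mul, pt, inner_smul_left,
      inner_smul_right, inner_vec, conj_trivial, hF, Int.cast_natCast]
    field_simp
  · intro i _
    simp only [corr, inRound, step, Int.cast_add, Int.cast_mul, pos, inner_smul_left,
      inner_smul_right, inner_vec, conj_trivial, Int.cast_ofNat]
    field_simp
  · intro i _
    have hZ : (0 : ℝ) < (inRound n m lam p V S i).Z := by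
      exact_mod_cast inRound_Z_pos hn hm hS i
    have h := sgn_mul_gain_le n m lam p V (inRound n m lam p V S i)
      (column n m p (S.heavy n m lam V) V i)
    set r := column n m p (S.heavy n m lam V) V i
    set U := inRound n m lam p V S i
    have h' : ((sgn n m lam p V U r : ℝ)) * (gain n m lam p V U r : ℝ) ≤ 0 := by exact_mod_cast h
    have e : (lam : ℝ) * (1 / n ^ 2) * ∑ j ∈ Finset.range p, weight U j *
        ⟪pt n m V j, (scaleE m : ℝ)⁻¹ • vec n r⟫ + 4 * (m * n) * (1 / n ^ 2) * corr n m U *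
        ⟪pos n m U, (scaleE m : ℝ)⁻¹ • vec n r⟫ =
        gain n m lam p V U r / (n ^ 7 * scaleE m ^ 4 * scaleD m * U.Z) := by
      have hZ' := hZ.ne'
      have e1 : ∑ j ∈ Finset.range p, weight U j * ⟪pt n m V j, (scaleE m : ℝ)⁻¹ • vec n r⟫ =
          (∑ j ∈ Finset.range p, (U.W j : ℝ) * dot n (V j) r) / (scaleE m * scaleD m * U.Z) := by
        rw [Finset.sum_div]
        refine Finset.sum_congr rfl fun j _ => ?_
        simp only [weight, pt, inner_smul_left, inner_smul_right, inner_vec, conj_trivial]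
        field_simp
      rw [e1]
      simp only [gain, corr, pos, inner_smul_left, inner_smul_right, inner_vec, conj_trivial,
        Int.cast_add, Int.cast_mul, Int.cast_sum, Int.cast_pow, Int.cast_natCast, Int.cast_ofNat]
      field_simp
    rw [e, ← mul_div_assoc]
    exact div_nonpos_of_nonpos_of_nonneg h' (by positivity)

end Walk

/-- The rows represent vectors of almost unit length at most. -/
def RowsLe (n m p : ℕ) (V : ℕ → ℕ → ℤ) : Prop :=
  ∀ j < p, ‖pt n m V j‖ ^ 2 ≤ 1 + 6 / Real.sqrt n

/-! ### The integer walk satisfies the estimates of the real walk -/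

section Analysis

variable {n m lam p : ℕ} {V : ℕ → ℕ → ℤ}

theorem RowsLe.norm_le (h : Moderate n m) (hV : RowsLe n m p V) {j : ℕ} (hj : j < p) :
    ‖pt n m V j‖ ≤ 3 / 2 := by
  have h1 := hV j hj
  have hq := h.sqrt_ge
  have h2 : 6 / Real.sqrt n ≤ 1 := by rw [div_le_one (by linarith)]; linarith
  nlinarith [norm_nonneg (pt n m V j)]

theorem Moderate.pos_left (h : Moderate n m) : 0 < n := by have := h.large; omega

theorem Moderate.pos_right (h : Moderate n m) : 0 < m := by have := h.large; have := h.le; omega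

theorem RowsLe.sum_le (h : Moderate n m) (hV : RowsLe n m p V) (hp : p ≤ m) {H : Finset ℕ}
    (hH : H ⊆ Finset.range p) : ∑ j ∈ H, ‖pt n m V j‖ ^ 2 ≤ 2 * m := by
  have hq := h.sqrt_ge
  have h2 : 6 / Real.sqrt n ≤ 1 := by rw [div_le_one (by linarith)]; linarith
  calc ∑ j ∈ H, ‖pt n m V j‖ ^ 2 ≤ ∑ j ∈ H, (2 : ℝ) := Finset.sum_le_sum fun j hj => by
        have := hV j (Finset.mem_range.1 (hH hj))
        linarith
    _ = H.card * 2 := by simp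
    _ ≤ m * 2 := by
        have : H.card ≤ m := (Finset.card_le_card hH).trans (by simpa using hp)
        gcongr
    _ = _ := mul_comm _ _

/-- The parameters are matched here: κ = 2m bounds the trace of the rows, ξ = 6/n follows from λ ≤ n
and norms at most 3/2, and N = m⁸ makes a heavy row move by at most n⁻⁴ per round. -/
theorem roundStep_rounds (h : Moderate n m) (hl : IsThreshold n m lam) (hp : p ≤ m)
    (hV : RowsLe n m p V) (b : ℕ) :
    RoundStep (Finset.range p) (pt n m V) lam (1 / n ^ 2) (m * n) (6 / n) (lam / n)
      (1 / n ^ 4) n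
      ((Walk.rounds n m lam p V b).pos n m) ((Walk.rounds n m lam p V (b + 1)).pos n m)
      (Walk.rounds n m lam p V b).weight (Walk.rounds n m lam p V (b + 1)).weight
      ((Walk.rounds n m lam p V b).corr n m) ((Walk.rounds n m lam p V (b + 1)).corr n m) := by
  have hn := h.pos_left
  have hm := h.pos_right
  have hn' : (0 : ℝ) < n := by exact_mod_cast hn
  have hm' : (0 : ℝ) < m := by exact_mod_cast hm
  have hnl := h.cast_large
  have hnm := h.cast_le
  have hD : (0 : ℝ) < scaleD m := by exact_mod_cast scaleD_pos hm
  have hE : (0 : ℝ) < scaleE m := by exact_mod_cast scaleE_pos hm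
  set S := Walk.rounds n m lam p V b with hS
  have hw := Walk.signedWalk (lam := lam) (p := p) (V := V) hn hm
    (Walk.rounds_Z_pos (lam := lam) (p := p) (V := V) hn hm b) n
  rw [← hS] at hw
  have hlamn : (lam : ℝ) ≤ n := by exact_mod_cast hl.le
  refine hw.roundStep (H := (Finset.range p).filter fun j => S.heavy n m lam V j = 1)
    (κ := 2 * m) (N := reps m) (EuclideanSpace.basisFun (Fin n) ℝ)
    (by positivity) (by positivity) (by positivity) ?_ (by positivity)
    (hV.sum_le h hp (Finset.filter_subset _ _)) ?_ ?_ ?_ ?_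
  · intro i
    simp only [column]
    rw [vec_shrink_iterate hm (heavy_eq_zero_or_one n m lam V S), smul_smul, vec_unitRow]
    have : (scaleE m : ℝ)⁻¹ * scaleK m ^ reps m = 1 := by
      rw [scaleE, Int.cast_pow, inv_mul_cancel₀]
      have := scaleK_pos hm
      positivity
    rw [this, one_smul]
  · intro j
    rw [Finset.mem_filter]
    refine and_congr_right fun _ => ?_
    have e : ⟪pt n m V j, (Walk.inRound n m lam p V S 0).pos n m⟫ =
        dot n (V j) S.Y / (scaleD m * n ^ 2 * scaleE m) := by
      simp only [pt, Walk.pos, Walk.inRound, inner_smul_left, inner_smul_right, inner_vec,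
        conj_trivial]
      field_simp
    rw [e, div_le_div_iff₀ hn' (by positivity)]
    have e2 : S.heavy n m lam V j = 1 ↔ lam * n * scaleE m * scaleD m ≤ dot n (V j) S.Y := by
      unfold Walk.heavy; split <;> simp_all
    rw [e2]
    have e3 : (lam : ℝ) * (scaleD m * n ^ 2 * scaleE m) =
      ((lam * n * scaleE m * scaleD m : ℤ) : ℝ) * n := by push_cast; ring
    rw [e3, mul_le_mul_iff_left₀ hn', Int.cast_le]
  · rw [div_le_one hn']; linarith
  · intro j hj
    have h1 := hV.norm_le h (Finset.mem_range.1 hj)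
    calc (lam : ℝ) * (1 / n ^ 2) * ‖pt n m V j‖ ≤ n * (1 / (n : ℝ) ^ 2) * (3 / 2) := by gcongr
      _ = 6 / (n : ℝ) / 4 := by field_simp; norm_num
  · have h1 : Real.sqrt n ≤ n := by
      rw [Real.sqrt_le_left hn'.le]; nlinarith
    -- Since m ≥ n, N = m⁸ ≥ m n⁶, so the residual squared norm 2m/(2N+1) of a damped heavy row is
    -- at most n⁻⁶.
    have h2 : Real.sqrt (2 * m / (2 * (reps m : ℕ) + 1)) ≤ 1 / n ^ 3 := by
      rw [Real.sqrt_le_left (by positivity), div_le_iff₀ (by positivity)]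
      have h3 : (n : ℝ) ^ 6 ≤ m ^ 6 := by gcongr; have := h.le; omega
      have h4 : (1 : ℝ) ≤ m := by linarith
      have h5 : (reps m : ℝ) = m * (m * m ^ 6) := by simp [reps]; ring
      have h6 : 2 * (m : ℝ) * n ^ 6 ≤ 2 * reps m + 1 := by
        rw [h5]
        have : (m : ℝ) * n ^ 6 ≤ m * (m * m ^ 6) := by
          gcongr
          exact h3.trans (le_mul_of_one_le_left (by positivity) h4)
        linarith
      calc 2 * (m : ℝ) = (1 / n ^ 3) ^ 2 * (2 * (m : ℝ) * n ^ 6) := by field_simp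
        _ ≤ _ := by gcongr
    calc 1 / (n : ℝ) ^ 2 * Real.sqrt n * Real.sqrt (2 * m / (2 * (reps m : ℕ) + 1))
        ≤ 1 / (n : ℝ) ^ 2 * n * (1 / (n : ℝ) ^ 3) := by gcongr
      _ = 1 / (n : ℝ) ^ 4 := by field_simp

/-- The appended row represents an almost unit vector which has small inner product with the
vectors represented by the previous rows. -/
theorem nextRow_spec (h : Moderate n m) (hl : IsThreshold n m lam) (hp : p ≤ m)
    (hV : RowsLe n m p V) :
    let v := (scaleD m : ℝ)⁻¹ • vec n (nextRow n m lam p V)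
    (∀ j < p, ⟪pt n m V j, v⟫ ≤ ((lam : ℝ) + 5) / n) ∧ ‖v‖ ^ 2 ≤ 1 + 6 / Real.sqrt n ∧
      1 - 2 / (5 * Real.log (m / n)) ≤ ‖v‖ ^ 2 := by
  intro v
  have hn := h.pos_left
  have hm := h.pos_right
  have hn' : (0 : ℝ) < n := by exact_mod_cast hn
  have hm' : (0 : ℝ) < m := by exact_mod_cast hm
  have hnl := h.cast_large
  have hnm := h.cast_le
  have hq := h.sqrt_ge
  have hqq : Real.sqrt n ^ 2 = n := Real.sq_sqrt hn'.le
  have hD : (0 : ℝ) < scaleD m := by exact_mod_cast scaleD_pos hm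
  have hE : (0 : ℝ) < scaleE m := by exact_mod_cast scaleE_pos hm
  obtain ⟨f1, f2, f3⟩ := RoundStep.final (n := n) (m := m) (J := Finset.range p) (v := pt n m V)
    (lam := lam) (L := (lam : ℝ) ^ 2 / (2 * n)) (τ := 1 / n ^ 4)
    (y := fun b => (Walk.rounds n m lam p V b).pos n m)
    (w := fun b => (Walk.rounds n m lam p V b).weight)
    (X := fun b => (Walk.rounds n m lam p V b).corr n m)
    (by have := h.large; omega) hm (by simpa using hp) (by exact_mod_cast hl.pos) rfl
    (hl.exp_ge h) (by positivity) (fun j hj => hV j (Finset.mem_range.1 hj)) (hl.small h)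
    (fun b _ => roundStep_rounds h hl hp hV b)
    (by ext l; simp [Walk.pos, Walk.rounds, Walk.init])
    (fun j _ => by simp [Walk.weight, Walk.rounds, Walk.init])
    (by simp [Walk.corr, Walk.rounds, Walk.init])
  set S := Walk.rounds n m lam p V (n ^ 3) with hS
  set y := S.pos n m with hy
  -- The only rounding of the construction: the floor moves each coordinate by at most 1/D = m⁻⁴,
  -- hence the vector by at most √n m⁻⁴ ≤ n⁻².
  have hdist : ‖v - y‖ ≤ 1 / n ^ 2 := by
    have hcoord : ∀ l : Fin n, |(v - y) l| ≤ 1 / scaleD m := by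
      intro l
      have hpos : (0 : ℤ) < n ^ 2 * scaleE m := by
        have := scaleE_pos hm; positivity
      have hq : (nextRow n m lam p V l : ℝ) =
          ((⌊(scaleD m * S.Y l : ℝ) / (n ^ 2 * scaleE m : ℝ)⌋ : ℤ) : ℝ) := by
        rw [nextRow, Int.fdiv_eq_ediv_of_nonneg _ hpos.le, ← hS]
        congr 1
        rw [eq_comm, Int.floor_eq_iff]
        have h1 := Int.ediv_mul_le (scaleD m * S.Y l) hpos.ne'
        have h2 := Int.lt_ediv_add_one_mul_self (scaleD m * S.Y l) hpos
        have h1' : (((scaleD m * S.Y l / (n ^ 2 * scaleE m) : ℤ) : ℝ)) * (n ^ 2 * scaleE m) ≤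
            scaleD m * S.Y l := by exact_mod_cast h1
        have h2' : (scaleD m * S.Y l : ℝ) <
            (((scaleD m * S.Y l / (n ^ 2 * scaleE m) : ℤ) : ℝ) + 1) * (n ^ 2 * scaleE m) := by
          exact_mod_cast h2
        exact ⟨(le_div_iff₀ (by positivity)).2 h1', (div_lt_iff₀ (by positivity)).2 h2'⟩
      have e : (v - y) l = (scaleD m : ℝ)⁻¹ *
          ((⌊(scaleD m * S.Y l : ℝ) / (n ^ 2 * scaleE m : ℝ)⌋ : ℤ) -
            (scaleD m * S.Y l : ℝ) / (n ^ 2 * scaleE m : ℝ)) := by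
        simp only [v, hy, Walk.pos, PiLp.sub_apply, PiLp.smul_apply, vec_apply, smul_eq_mul, hq]
        field_simp
      rw [e, abs_mul, abs_of_pos (inv_pos.2 hD), one_div]
      refine mul_le_of_le_one_right (inv_pos.2 hD).le (abs_le.2 ⟨?_, ?_⟩)
      · linarith [Int.sub_one_lt_floor ((scaleD m * S.Y l : ℝ) / (n ^ 2 * scaleE m : ℝ))]
      · linarith [Int.floor_le ((scaleD m * S.Y l : ℝ) / (n ^ 2 * scaleE m : ℝ))]
    have hsq : ‖v - y‖ ^ 2 ≤ (1 / n ^ 2 : ℝ) ^ 2 := by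
      rw [EuclideanSpace.norm_sq_eq]
      calc ∑ l, ‖(v - y) l‖ ^ 2 ≤ ∑ _l : Fin n, (1 / scaleD m : ℝ) ^ 2 :=
            Finset.sum_le_sum fun l _ => by
              rw [Real.norm_eq_abs]
              have := hcoord l
              gcongr
        _ = n * (1 / (m : ℝ) ^ 4) ^ 2 := by simp [scaleD]
        _ ≤ n * (1 / (n : ℝ) ^ 4) ^ 2 := by gcongr; have := h.le; omega
        _ = (1 / n ^ 2 : ℝ) ^ 2 * (1 / n ^ 3) := by field_simp
        _ ≤ (1 / n ^ 2 : ℝ) ^ 2 * 1 := by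
            gcongr
            rw [div_le_one (by positivity)]
            exact one_le_pow₀ (by linarith)
        _ = _ := mul_one _
    exact abs_le_of_sq_le_sq' hsq (by positivity) |>.2
  have hyn : ‖y‖ ≤ 3 / 2 := by
    have h2 : 5 / Real.sqrt n ≤ 1 := by rw [div_le_one (by linarith)]; linarith
    nlinarith [norm_nonneg y]
  have hn2 : 1 / (n : ℝ) ^ 2 ≤ 1 / 10 := by
    refine one_div_le_one_div_of_le (by norm_num) ?_
    nlinarith
  have hnq : 4 * (1 / (n : ℝ) ^ 2) ≤ 1 / Real.sqrt n := by
    rw [mul_one_div, div_le_div_iff₀ (by positivity) (by linarith)]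
    nlinarith
  have hn20 : 0 < 1 / (n : ℝ) ^ 2 := by positivity
  have q56 : 6 / Real.sqrt n = 5 / Real.sqrt n + 1 / Real.sqrt n := by ring
  have hvn : ‖v‖ ≤ ‖y‖ + 1 / n ^ 2 := by
    have : ‖v‖ ≤ ‖y‖ + ‖v - y‖ := by
      calc ‖v‖ = ‖y + (v - y)‖ := by congr 1; abel
        _ ≤ _ := norm_add_le _ _
    linarith
  have hyv : ‖y‖ ≤ ‖v‖ + 1 / n ^ 2 := by
    have : ‖y‖ ≤ ‖v‖ + ‖v - y‖ := by
      calc ‖y‖ = ‖v - (v - y)‖ := by congr 1; abel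
        _ ≤ _ := norm_sub_le _ _
    linarith
  refine ⟨fun j hj => ?_, ?_, ?_⟩
  · have h1 := f1 j (Finset.mem_range.2 hj)
    have h2 : ⟪pt n m V j, v⟫ = ⟪pt n m V j, y⟫ + ⟪pt n m V j, v - y⟫ := by
      rw [← inner_add_right]; congr 1; abel
    have h3 : ⟪pt n m V j, v - y⟫ ≤ 3 / 2 * (1 / n ^ 2) :=
      (real_inner_le_norm _ _).trans (by gcongr; exact hV.norm_le h hj)
    have h4 : 3 / 2 * (1 / (n : ℝ) ^ 2) ≤ 2 / n := by
      rw [mul_one_div, div_le_div_iff₀ (by positivity) hn']; nlinarith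
    have h5 : (n : ℝ) ^ 3 * (1 / n ^ 4) = 1 / n := by field_simp
    -- The budget of 5/n: 2/n for the overshoot of a row on becoming heavy, n³ · n⁻⁴ for its creep
    -- afterwards, and 2/n for the rounding.
    have h6 : ((lam : ℝ) + 5) / n = lam / n + 2 / n + 1 / n + 2 / n := by ring
    rw [h5] at h1
    rw [h2, h6]
    linarith
  · have : ‖v‖ ^ 2 ≤ (‖y‖ + 1 / n ^ 2) ^ 2 := by gcongr
    nlinarith [norm_nonneg y]
  · refine (hl.norm_bound_ge h).trans ?_
    have h1 : ‖y‖ ^ 2 ≤ (‖v‖ + 1 / n ^ 2) ^ 2 := by gcongr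
    have h2 : ‖v‖ ≤ 8 / 5 := by linarith
    nlinarith [norm_nonneg v]

theorem table_spec (h : Moderate n m) (hl : IsThreshold n m lam) :
    ∀ p ≤ m, RowsLe n m p (table n m lam p) := by
  intro p
  induction p with
  | zero => intro _ j hj; omega
  | succ p ih =>
    intro hp j hj
    have hV := ih (by omega)
    rcases Nat.lt_succ_iff_lt_or_eq.1 hj with hj | rfl
    · have := hV j hj
      simpa only [pt, table_eq hj (Nat.le_succ p)] using this
    · simp only [pt, table_succ_self]
      exact (nextRow_spec h hl (by omega) hV).2.1

theorem norm_table_ge (h : Moderate n m) (hl : IsThreshold n m lam) {i : ℕ} (hi : i < m) :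
    1 - 2 / (5 * Real.log (m / n)) ≤ ‖pt n m (table n m lam m) i‖ ^ 2 := by
  simp only [pt, table_eq (Nat.lt_succ_self i) hi, table_succ_self]
  exact (nextRow_spec h hl hi.le (table_spec h hl i hi.le)).2.2

theorem inner_table_le (h : Moderate n m) (hl : IsThreshold n m lam) {i j : ℕ} (hi : i < m)
    (hj : j < m) (hij : i ≠ j) :
    ⟪pt n m (table n m lam m) i, pt n m (table n m lam m) j⟫ ≤ ((lam : ℝ) + 5) / n := by
  have main : ∀ i j, i < j → j < m →
      ⟪pt n m (table n m lam m) i, pt n m (table n m lam m) j⟫ ≤ ((lam : ℝ) + 5) / n := by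
    intro i j hij hj
    have := (nextRow_spec h hl hj.le (table_spec h hl j hj.le)).1 i hij
    simpa only [pt, table_eq (Nat.lt_succ_self j) hj, table_succ_self, table_eq hij hj.le]
      using this
  rcases lt_or_gt_of_ne hij with h' | h'
  · exact main i j h' hj
  · rw [real_inner_comm]
    exact main j i h' hi

end Analysis

end Integer


/-! ### The size of the integers -/

section Size

/-- A common upper bound for the parameters of the construction. -/
def scaleA (n m : ℕ) : ℤ := 4 * m * scaleF n m

/-- The binary length of all the integers that occur. -/
def bits (n m : ℕ) : ℕ := 20 * m ^ 9 * (n ^ 4 + 12)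

theorem abs_sum_range_le {f : ℕ → ℤ} {c : ℤ} {k N : ℕ} (hc : 0 ≤ c) (hk : k ≤ N)
    (h : ∀ i < k, |f i| ≤ c) : |∑ i ∈ Finset.range k, f i| ≤ N * c := by
  calc |∑ i ∈ Finset.range k, f i| ≤ ∑ i ∈ Finset.range k, |f i| := Finset.abs_sum_le_sum_abs _ _
    _ ≤ ∑ _i ∈ Finset.range k, c := Finset.sum_le_sum fun i hi => h i (Finset.mem_range.1 hi)
    _ = k * c := by simp
    _ ≤ N * c := by gcongr

variable {n m lam p : ℕ} {V : ℕ → ℕ → ℤ}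

/-- E = K^(m⁸) dominates the length, with at most (9m+1)m⁸ bits. The exponent n⁴ counts the steps of
a walk, each of which may multiply the weights by one power; 12 more powers pay for the polynomial
factors. -/
theorem scaleA_pow_le (hm : 0 < m) (hnm : n ≤ m) :
    scaleA n m ^ (n ^ 4 + 12) ≤ 2 ^ bits n m := by
  have h2 : ∀ x : ℕ, (x : ℤ) ≤ 2 ^ x := fun x => by exact_mod_cast Nat.lt_two_pow_self.le
  have hD0 := scaleD_pos hm
  have hE0 := scaleE_pos hm
  have hK0 := scaleK_pos hm
  have hD : scaleD m ≤ 2 ^ (4 * m) := by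
    rw [scaleD, mul_comm, pow_mul]
    gcongr
    exact h2 m
  have hK : scaleK m ≤ 2 ^ (9 * m + 1) := by
    calc scaleK m = 2 * m * scaleD m ^ 2 := rfl
      _ ≤ 2 * 2 ^ m * (2 ^ (4 * m)) ^ 2 := by gcongr; exact h2 m
      _ = 2 ^ (9 * m + 1) := by rw [← pow_mul]; ring
  have hE : scaleE m ≤ 2 ^ ((9 * m + 1) * m ^ 8) := by
    rw [pow_mul, scaleE, reps]
    gcongr
  have hA : scaleA n m ≤ 2 ^ (20 * m ^ 9) := by
    calc scaleA n m = 4 * m * (n ^ 2 * scaleE m * scaleD m) := rfl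
      _ ≤ 4 * 2 ^ m * ((2 ^ m) ^ 2 * 2 ^ ((9 * m + 1) * m ^ 8) * 2 ^ (4 * m)) := by
          gcongr
          · exact h2 m
          · exact (h2 n).trans (pow_le_pow_right₀ (by norm_num) hnm)
      _ = 2 ^ (2 + m + 2 * m + (9 * m + 1) * m ^ 8 + 4 * m) := by
          rw [show (4 : ℤ) = 2 ^ 2 by norm_num]
          ring
      _ ≤ 2 ^ (20 * m ^ 9) := by
          refine pow_le_pow_right₀ (by norm_num) ?_
          have h8 : 1 ≤ m ^ 8 := Nat.one_le_pow _ _ hm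
          have h9 : m ≤ m ^ 9 := Nat.le_self_pow (by norm_num) m
          have h10 : m ^ 8 ≤ m ^ 9 := Nat.pow_le_pow_right hm (by norm_num)
          have h11 : (9 * m + 1) * m ^ 8 = 9 * m ^ 9 + m ^ 8 := by ring
          omega
  have hA0 : 0 ≤ scaleA n m := by
    unfold scaleA scaleF; positivity
  rw [bits, pow_mul]
  gcongr

/-- The sizes of the parameters. -/
structure ParamsLe (n m : ℕ) : Prop where
  one_le : 1 ≤ scaleA n m
  two_le : 2 ≤ scaleA n m
  n_le : (n : ℤ) ≤ scaleA n m
  m_le : (m : ℤ) ≤ scaleA n m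
  D_le : scaleD m ≤ scaleA n m
  E_le : scaleE m ≤ scaleA n m
  F_le : 3 * scaleF n m ≤ scaleA n m
  seven_le : 7 * (n : ℤ) ≤ scaleA n m
  large_le : 1024 ≤ scaleA n m

theorem Moderate.paramsLe (h : Moderate n m) : ParamsLe n m := by
  have hD := scaleD_pos h.pos_right
  have hE := scaleE_pos h.pos_right
  have hn : (1000000 : ℤ) ≤ n := by exact_mod_cast h.large
  have hm : 16 * (n : ℤ) ≤ m := by exact_mod_cast h.le
  have hF : scaleF n m = n ^ 2 * scaleE m * scaleD m := rfl
  have hED : 1 ≤ scaleE m * scaleD m := Int.add_one_le_iff.2 (mul_pos hE hD)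
  have hn2 : (1 : ℤ) ≤ n ^ 2 := by nlinarith
  have hF1 : scaleE m * scaleD m ≤ scaleF n m := by
    rw [hF, mul_assoc]; exact le_mul_of_one_le_left (by positivity) hn2
  have hFD : scaleD m ≤ scaleF n m := by nlinarith
  have hFE : scaleE m ≤ scaleF n m := by nlinarith
  have hFpos : 1 ≤ scaleF n m := by linarith
  have hA : scaleA n m = 4 * (m * scaleF n m) := by rw [scaleA]; ring
  have h1 : scaleF n m ≤ m * scaleF n m := le_mul_of_one_le_left (by linarith) (by linarith)
  have h2 : (m : ℤ) ≤ m * scaleF n m := le_mul_of_one_le_right (by linarith) hFpos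
  constructor <;> rw [hA] <;> linarith

theorem le_pow_of_le {A x : ℤ} {j k : ℕ} (hA : 1 ≤ A) (hx : x ≤ A ^ j) (hjk : j ≤ k) : x ≤ A ^ k :=
  hx.trans (pow_le_pow_right₀ hA hjk)

theorem Moderate.le_two_pow_bits (h : Moderate n m) {x : ℤ} {j : ℕ} (hx : x ≤ scaleA n m ^ j)
    (hj : j ≤ n ^ 4 + 12) : x ≤ 2 ^ bits n m := by
  refine (le_pow_of_le h.paramsLe.one_le hx hj).trans (scaleA_pow_le h.pos_right ?_)
  have := h.le
  omega

theorem RowsLe.abs_le (h : Moderate n m) (hV : RowsLe n m p V) {j l : ℕ} (hj : j < p)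
    (hl : l < n) : |V j l| ≤ 2 * scaleD m := by
  have hD : (0 : ℝ) < scaleD m := by exact_mod_cast scaleD_pos h.pos_right
  have h1 := (PiLp.norm_apply_le (pt n m V j) ⟨l, hl⟩).trans (hV.norm_le h hj)
  simp only [pt, PiLp.smul_apply, vec_apply, smul_eq_mul, Real.norm_eq_abs, abs_mul,
    abs_of_pos (inv_pos.2 hD)] at h1
  rw [inv_mul_le_iff₀ hD] at h1
  have h2 : |(V j l : ℝ)| ≤ 2 * scaleD m := by linarith
  exact_mod_cast h2

/-- The bound comes from contraction: an iterate is K^k times the image of a unit vector under a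
contraction. Entrywise estimates would pick up an additional factor at every iteration. -/
theorem abs_shrink_iterate_le (h : Moderate n m) (hp : p ≤ m) (hV : RowsLe n m p V) {hv : ℕ → ℤ}
    (h01 : ∀ j, hv j = 0 ∨ hv j = 1) {i k l : ℕ} (hi : i < n) (hk : k ≤ reps m) (hl : l < n) :
    |(shrink n m p hv V)^[k] (unitRow i) l| ≤ scaleE m := by
  have hm := h.pos_right
  have hm' : (0 : ℝ) < m := by exact_mod_cast hm
  have hK := scaleK_pos hm
  have hK' : (0 : ℝ) < scaleK m := by exact_mod_cast hK
  have h2 := norm_pow_apply_le (norm_damp_apply_le (v := pt n m V) (κ := 2 * m) (by positivity)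
    (hV.sum_le h hp (Finset.filter_subset (fun j => hv j = 1) _))) k (vec n (unitRow i))
  have h3 : ‖vec n (unitRow i)‖ = 1 := by
    rw [vec_unitRow ⟨i, hi⟩]; exact (EuclideanSpace.basisFun (Fin n) ℝ).orthonormal.1 _
  rw [h3] at h2
  have h1 : ‖vec n ((shrink n m p hv V)^[k] (unitRow i))‖ ≤ (scaleK m : ℝ) ^ k := by
    rw [vec_shrink_iterate hm h01, norm_smul, norm_pow, Real.norm_of_nonneg hK'.le]
    exact mul_le_of_le_one_right (by positivity) h2
  have h4 : |((shrink n m p hv V)^[k] (unitRow i) l : ℝ)| ≤ (scaleK m : ℝ) ^ k :=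
    (PiLp.norm_apply_le (vec n ((shrink n m p hv V)^[k] (unitRow i))) ⟨l, hl⟩).trans h1
  have h5 : |(shrink n m p hv V)^[k] (unitRow i) l| ≤ scaleK m ^ k := by exact_mod_cast h4
  exact h5.trans (pow_le_pow_right₀ hK hk)

/-- The sizes of the entries of a state of the walk after `t` steps. -/
structure Walk.Le (n m p t : ℕ) (S : Walk) : Prop where
  Y : ∀ l < n, |S.Y l| ≤ t * scaleE m
  W : ∀ j < p, |S.W j| ≤ (3 * scaleF n m) ^ t
  X : |S.X| ≤ 2 * t * (n ^ 5 * scaleE m ^ 2)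
  Z : |S.Z| ≤ scaleF n m ^ t

theorem abs_dot_le {a b : ℕ → ℤ} {α β : ℤ} (hα : 0 ≤ α) (hβ : 0 ≤ β) {k : ℕ} (hk : k ≤ n)
    (ha : ∀ l < n, |a l| ≤ α) (hb : ∀ l < n, |b l| ≤ β) :
    |∑ l ∈ Finset.range k, a l * b l| ≤ n * (α * β) :=
  abs_sum_range_le (mul_nonneg hα hβ) hk fun l hl => by
    rw [abs_mul]
    exact mul_le_mul (ha l (by omega)) (hb l (by omega)) (abs_nonneg _) hα

theorem Walk.Le.init : Walk.Le n m p 0 Walk.init := by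
  constructor <;> simp [Walk.init]

/-- The position grows additively, by at most E per entry. A weight is multiplied by at most F + n ·
n · 2 D E = 3F, as F = n² E D and λ ≤ n. -/
theorem Walk.Le.step (h : Moderate n m) (hlam : lam ≤ n) (hV : RowsLe n m p V)
    {S : Walk} {t : ℕ} (hS : S.Le n m p t) (ht : t ≤ n ^ 4) {r : ℕ → ℤ}
    (hr : ∀ l < n, |r l| ≤ scaleE m) : (S.step n m lam p V r).Le n m p (t + 1) := by
  have hD := scaleD_pos h.pos_right
  have hE := scaleE_pos h.pos_right
  have hF := scaleF_pos h.pos_left h.pos_right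
  have hsgn : |Walk.sgn n m lam p V S r| = 1 := by
    rcases Walk.sgn_eq n m lam p V S r with e | e <;> simp [e]
  have htn : (t : ℤ) ≤ n ^ 4 := by exact_mod_cast ht
  have he : |dot n S.Y r| ≤ n ^ 5 * scaleE m ^ 2 := by
    calc |dot n S.Y r| ≤ n * (t * scaleE m * scaleE m) :=
          abs_dot_le (by positivity) hE.le le_rfl hS.Y hr
      _ ≤ n * (n ^ 4 * scaleE m * scaleE m) := by gcongr
      _ = _ := by ring
  constructor
  · intro l hl
    calc |S.Y l + Walk.sgn n m lam p V S r * r l| ≤ |S.Y l| + |r l| := by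
          refine (abs_add_le _ _).trans ?_
          rw [abs_mul, hsgn, one_mul]
      _ ≤ t * scaleE m + scaleE m := add_le_add (hS.Y l hl) (hr l hl)
      _ = _ := by push_cast; ring
  · intro j hj
    have hd : |dot n (V j) r| ≤ n * (2 * scaleD m * scaleE m) :=
      abs_dot_le (by positivity) hE.le le_rfl (fun l hl => hV.abs_le h hj hl) hr
    have hlam' : (lam : ℤ) ≤ n := by exact_mod_cast hlam
    have h1 : |scaleF n m + Walk.sgn n m lam p V S r * lam * dot n (V j) r| ≤ 3 * scaleF n m := by
      calc _ ≤ scaleF n m + lam * |dot n (V j) r| := by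
            refine (abs_add_le _ _).trans ?_
            rw [abs_mul, abs_mul, hsgn, one_mul, abs_of_pos hF, Nat.abs_cast]
        _ ≤ scaleF n m + n * (n * (2 * scaleD m * scaleE m)) := by gcongr
        _ = _ := by unfold scaleF; ring
    calc |S.W j * (scaleF n m + Walk.sgn n m lam p V S r * lam * dot n (V j) r)|
        ≤ (3 * scaleF n m) ^ t * (3 * scaleF n m) := by
          rw [abs_mul]
          exact mul_le_mul (hS.W j hj) h1 (abs_nonneg _) (by positivity)
      _ = _ := (pow_succ _ _).symm
  · calc |S.X + 2 * Walk.sgn n m lam p V S r * dot n S.Y r|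
        ≤ |S.X| + 2 * |dot n S.Y r| := by
          refine (abs_add_le _ _).trans ?_
          rw [abs_mul, abs_mul, hsgn]
          simp
      _ ≤ 2 * t * (n ^ 5 * scaleE m ^ 2) + 2 * (n ^ 5 * scaleE m ^ 2) := by
          have := hS.X
          linarith
      _ = _ := by push_cast; ring
  · calc |S.Z * scaleF n m| ≤ scaleF n m ^ t * scaleF n m := by
          rw [abs_mul, abs_of_pos hF]
          have := hS.Z
          gcongr
      _ = _ := (pow_succ _ _).symm

theorem Walk.Le.inRound (h : Moderate n m) (hlam : lam ≤ n) (hp : p ≤ m) (hV : RowsLe n m p V)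
    {S : Walk} {t : ℕ} (hS : S.Le n m p t) : ∀ i ≤ n, t + i ≤ n ^ 4 →
      (Walk.inRound n m lam p V S i).Le n m p (t + i)
  | 0, _, _ => hS
  | i + 1, hi, ht => (Walk.Le.inRound h hlam hp hV hS i (by omega) (by omega)).step h hlam hV
      (by omega) fun _ hl => abs_shrink_iterate_le h hp hV (heavy_eq_zero_or_one n m lam V S)
        (by omega) le_rfl hl

theorem Walk.Le.rounds (h : Moderate n m) (hlam : lam ≤ n) (hp : p ≤ m) (hV : RowsLe n m p V) :
    ∀ b ≤ n ^ 3, (Walk.rounds n m lam p V b).Le n m p (b * n)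
  | 0, _ => by simpa [Walk.rounds] using Walk.Le.init
  | b + 1, hb => by
    have h1 := Walk.Le.inRound h hlam hp hV (Walk.Le.rounds h hlam hp hV b (by omega)) n le_rfl (by
      calc b * n + n = (b + 1) * n := by ring
        _ ≤ n ^ 3 * n := by gcongr
        _ = n ^ 4 := by ring)
    rw [add_one_mul]
    exact h1

/-! ### Binary length of the intermediate results -/

section Bits

theorem Walk.Le.Y_le (h : Moderate n m) {S : Walk} {t : ℕ} (hS : S.Le n m p t) (ht : t ≤ n ^ 4)
    {l : ℕ} (hl : l < n) : |S.Y l| ≤ n ^ 4 * scaleE m := by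
  have hE := scaleE_pos h.pos_right
  refine (hS.Y l hl).trans ?_
  gcongr
  exact_mod_cast ht

theorem le_two_pow_of_le_mul (h : Moderate n m) {x y : ℤ} {t j : ℕ} (ht : t ≤ n ^ 4) (hj : j ≤ 12)
    (hx : x ≤ (3 * scaleF n m) ^ t * y) (hy : y ≤ scaleA n m ^ j) : x ≤ 2 ^ bits n m := by
  have P := h.paramsLe
  have hF := scaleF_pos h.pos_left h.pos_right
  have hA : 0 ≤ scaleA n m := by linarith [P.one_le]
  refine h.le_two_pow_bits (j := t + j) (hx.trans ?_) (by omega)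
  rw [pow_add]
  have := P.F_le
  refine (mul_le_mul_of_nonneg_left hy (by positivity)).trans ?_
  gcongr

theorem bits_Y (h : Moderate n m) {S : Walk} {t : ℕ} (hS : S.Le n m p t) (ht : t ≤ n ^ 4)
    {l : ℕ} (hl : l < n) : |S.Y l| ≤ 2 ^ bits n m := by
  have P := h.paramsLe
  have hE := scaleE_pos h.pos_right
  refine h.le_two_pow_bits (j := 5) ((hS.Y_le h ht hl).trans ?_) (by omega)
  have := P.n_le
  have := P.E_le
  calc (n : ℤ) ^ 4 * scaleE m ≤ scaleA n m ^ 4 * scaleA n m := by gcongr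
    _ = _ := by ring

theorem bits_W (h : Moderate n m) {S : Walk} {t : ℕ} (hS : S.Le n m p t) (ht : t ≤ n ^ 4)
    {j : ℕ} (hj : j < p) : |S.W j| ≤ 2 ^ bits n m :=
  le_two_pow_of_le_mul h (y := 1) (j := 0) ht (by norm_num) (by simpa using hS.W j hj) (by simp)

theorem bits_Z (h : Moderate n m) {S : Walk} {t : ℕ} (hS : S.Le n m p t) (ht : t ≤ n ^ 4) :
    |S.Z| ≤ 2 ^ bits n m := by
  have hF := scaleF_pos h.pos_left h.pos_right
  refine le_two_pow_of_le_mul h (y := 1) (j := 0) ht (by norm_num) ?_ (by simp)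
  rw [mul_one]
  refine hS.Z.trans ?_
  gcongr
  linarith

theorem bits_X (h : Moderate n m) {S : Walk} {t : ℕ} (hS : S.Le n m p t) (ht : t ≤ n ^ 4) :
    |S.X| ≤ 2 ^ bits n m := by
  have P := h.paramsLe
  have hE := scaleE_pos h.pos_right
  have htn : (t : ℤ) ≤ n ^ 4 := by exact_mod_cast ht
  refine h.le_two_pow_bits (j := 12) (hS.X.trans ?_) (by omega)
  have := P.n_le
  have := P.E_le
  have := P.two_le
  calc 2 * (t : ℤ) * (n ^ 5 * scaleE m ^ 2) ≤ 2 * n ^ 4 * (n ^ 5 * scaleE m ^ 2) := by gcongr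
    _ ≤ scaleA n m * scaleA n m ^ 4 * (scaleA n m ^ 5 * scaleA n m ^ 2) := by gcongr
    _ = _ := by ring

theorem bits_dot (h : Moderate n m) (hV : RowsLe n m p V) {r : ℕ → ℤ}
    (hr : ∀ l < n, |r l| ≤ n ^ 4 * scaleE m) {j k : ℕ} (hj : j < p) (hk : k ≤ n) :
    |∑ l ∈ Finset.range k, V j l * r l| ≤ 2 ^ bits n m := by
  have P := h.paramsLe
  have hE := scaleE_pos h.pos_right
  have hD := scaleD_pos h.pos_right
  refine h.le_two_pow_bits (j := 8) ((abs_dot_le (by positivity) (by positivity) hk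
    (fun l hl => hV.abs_le h hj hl) hr).trans ?_) (by omega)
  have := P.n_le
  have := P.E_le
  have := P.D_le
  have := P.two_le
  calc (n : ℤ) * (2 * scaleD m * (n ^ 4 * scaleE m))
      ≤ scaleA n m * (scaleA n m * scaleA n m * (scaleA n m ^ 4 * scaleA n m)) := by
        gcongr
    _ = _ := by ring

theorem bits_damp (h : Moderate n m) (hp : p ≤ m) (hV : RowsLe n m p V) {hv r : ℕ → ℤ}
    (h01 : ∀ j, hv j = 0 ∨ hv j = 1) (hr : ∀ l < n, |r l| ≤ scaleE m) {k l : ℕ} (hk : k ≤ p)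
    (hl : l < n) :
    |∑ j ∈ Finset.range k, hv j * dot n (V j) r * V j l| ≤ 2 ^ bits n m := by
  have P := h.paramsLe
  have hE := scaleE_pos h.pos_right
  have hD := scaleD_pos h.pos_right
  refine h.le_two_pow_bits (j := 7) ((abs_sum_range_le (N := m)
    (c := n * (2 * scaleD m * scaleE m) * (2 * scaleD m)) (by positivity) (by omega)
    fun j hj => ?_).trans ?_) (by omega)
  · have h1 : |hv j| ≤ 1 := by rcases h01 j with e | e <;> simp [e]
    have h2 : |dot n (V j) r| ≤ n * (2 * scaleD m * scaleE m) :=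
      abs_dot_le (by positivity) hE.le le_rfl (fun l hl => hV.abs_le h (by omega) hl) hr
    rw [abs_mul, abs_mul]
    refine mul_le_mul ?_ (hV.abs_le h (by omega) hl) (abs_nonneg _) (by positivity)
    exact (mul_le_of_le_one_left (abs_nonneg _) h1).trans h2
  · have := P.n_le
    have := P.m_le
    have := P.E_le
    have := P.D_le
    have := P.two_le
    calc (m : ℤ) * (n * (2 * scaleD m * scaleE m) * (2 * scaleD m))
        ≤ scaleA n m * (scaleA n m * (scaleA n m * scaleA n m * scaleA n m) *
          (scaleA n m * scaleA n m)) := by gcongr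
      _ = _ := by ring

theorem bits_cross (h : Moderate n m) {S : Walk} {t : ℕ} (hS : S.Le n m p t) (ht : t ≤ n ^ 4)
    {r : ℕ → ℤ} (hr : ∀ l < n, |r l| ≤ scaleE m) {k : ℕ} (hk : k ≤ n) :
    |∑ l ∈ Finset.range k, S.Y l * r l| ≤ 2 ^ bits n m := by
  have P := h.paramsLe
  have hE := scaleE_pos h.pos_right
  refine h.le_two_pow_bits (j := 7) ((abs_dot_le (by positivity) hE.le hk
    (fun l hl => hS.Y_le h ht hl) hr).trans ?_) (by omega)
  have := P.n_le
  have := P.E_le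
  have hA : 0 ≤ scaleA n m := by linarith [P.one_le]
  calc (n : ℤ) * (n ^ 4 * scaleE m * scaleE m)
      ≤ scaleA n m * (scaleA n m ^ 4 * scaleA n m * scaleA n m) := by gcongr
    _ = _ := by ring

theorem bits_gain (h : Moderate n m) (hp : p ≤ m) (hV : RowsLe n m p V) {S : Walk} {t : ℕ}
    (hS : S.Le n m p t) (ht : t ≤ n ^ 4) {r : ℕ → ℤ} (hr : ∀ l < n, |r l| ≤ scaleE m) {k : ℕ}
    (hk : k ≤ p) : |∑ j ∈ Finset.range k, S.W j * dot n (V j) r| ≤ 2 ^ bits n m := by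
  have P := h.paramsLe
  have hE := scaleE_pos h.pos_right
  have hD := scaleD_pos h.pos_right
  have hF := scaleF_pos h.pos_left h.pos_right
  refine le_two_pow_of_le_mul h (t := t) (j := 5) (y := m * (n * (2 * scaleD m * scaleE m))) ht
    (by norm_num) ((abs_sum_range_le (N := m)
    (c := (3 * scaleF n m) ^ t * (n * (2 * scaleD m * scaleE m))) (by positivity) (by omega)
    fun j hj => ?_).trans (le_of_eq (by ring))) ?_
  · have h2 : |dot n (V j) r| ≤ n * (2 * scaleD m * scaleE m) :=
      abs_dot_le (by positivity) hE.le le_rfl (fun l hl => hV.abs_le h (by omega) hl) hr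
    rw [abs_mul]
    exact mul_le_mul (hS.W j (by omega)) h2 (abs_nonneg _) (by positivity)
  · have := P.n_le
    have := P.m_le
    have := P.E_le
    have := P.D_le
    have := P.two_le
    calc (m : ℤ) * (n * (2 * scaleD m * scaleE m))
        ≤ scaleA n m * (scaleA n m * (scaleA n m * scaleA n m * scaleA n m)) := by gcongr
      _ = _ := by ring

theorem bits_nextRow (h : Moderate n m) (hlam : lam ≤ n) (hp : p ≤ m) (hV : RowsLe n m p V) {l : ℕ}
    (hl : l < n) : |nextRow n m lam p V l| ≤ 2 ^ bits n m := by
  have P := h.paramsLe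
  have hE := scaleE_pos h.pos_right
  have hD := scaleD_pos h.pos_right
  refine h.le_two_pow_bits (j := 6) ((Int.abs_fdiv_le _ _).trans ?_) (by omega)
  have h1 := (Walk.Le.rounds h hlam hp hV (n ^ 3) le_rfl).Y_le h (by ring_nf; rfl) hl
  rw [abs_mul, abs_of_pos hD]
  have := P.n_le
  have := P.E_le
  have := P.D_le
  calc scaleD m * |(Walk.rounds n m lam p V (n ^ 3)).Y l| ≤ scaleD m * (n ^ 4 * scaleE m) := by
        gcongr
    _ ≤ scaleA n m * (scaleA n m ^ 4 * scaleA n m) := by gcongr; linarith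
    _ = _ := by ring

theorem bits_expNum (h : Moderate n m) {t : ℕ} (ht : t ≤ n) :
    |expNum n t| ≤ 2 ^ bits n m ∧ |expDen n m t| ≤ 2 ^ bits n m := by
  have P := h.paramsLe
  have hA : 0 ≤ scaleA n m := by linarith [P.one_le]
  have hn4 : n ≤ n ^ 4 := Nat.le_self_pow (by norm_num) n
  have hn1 := h.pos_left
  have h1 : ∀ i ∈ Finset.range t, |4 * (n : ℤ) + 2 * (i : ℤ) + 1| ≤ scaleA n m := fun i hi => by
    have := Finset.mem_range.1 hi
    have := P.seven_le
    rw [abs_le]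
    constructor <;> omega
  have h2 : ∀ i ∈ Finset.range t, |4 * (n : ℤ) - 2 * (i : ℤ) - 1| ≤ scaleA n m := fun i hi => by
    have := Finset.mem_range.1 hi
    have := P.seven_le
    rw [abs_le]
    constructor <;> omega
  have hprod : ∀ f : ℕ → ℤ, (∀ i ∈ Finset.range t, |f i| ≤ scaleA n m) →
      |∏ i ∈ Finset.range t, f i| ≤ scaleA n m ^ t := fun f hf => by
    rw [Finset.abs_prod]
    refine (Finset.prod_le_prod (fun i _ => abs_nonneg _) hf).trans ?_
    simp
  constructor
  · refine h.le_two_pow_bits (j := t + 1) ?_ (by omega)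
    rw [expNum, abs_mul, Nat.abs_cast, pow_succ']
    exact mul_le_mul P.n_le (hprod _ h1) (abs_nonneg _) hA
  · refine h.le_two_pow_bits (j := t + 2) ?_ (by omega)
    rw [expDen, abs_mul, abs_mul, Nat.abs_cast, show t + 2 = (1 + 1) + t by ring, pow_add, pow_add,
      pow_one]
    refine mul_le_mul (mul_le_mul ?_ P.m_le (by positivity) hA) (hprod _ h2) (abs_nonneg _)
      (by positivity)
    simpa using P.large_le

end Bits

end Size


/-! ### The program -/

section Program

/-- The cell of the table in row `x` and column `y`. -/
def cell (x y : ℕ) : Expr := .plus (.times (.var x) (.var 0)) (.var y)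

/-- Stores the inner products of the rows of the table with array `a` in array `2`. -/
def dotRows (a : ℕ) : Prog :=
  forLoop 15 11 (.seq (sumLoop 16 0 17 (.times (.get 0 (cell 15 16)) (.get a (.var 16))))
    (.put 2 (.var 15) (.var 17)))

/-- Applies the damping map to array `1`. -/
def shrinkProg : Prog :=
  .seq (dotRows 1) (forLoop 16 0 (.seq
    (sumLoop 15 11 17 (.times (.times (.get 3 (.var 15)) (.get 2 (.var 15))) (.get 0 (cell 15 16))))
    (.put 1 (.var 16) (.minus (.times (.var 6) (.get 1 (.var 16))) (.var 17)))))

/-- Computes a damped basis vector in array `1`, and its inner products in array `2`. -/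
def columnProg : Prog :=
  .seq (forLoop 16 0 (.put 1 (.var 16) (.lit 0))) (.seq (.put 1 (.var 13) (.lit 1))
    (.seq (forLoop 14 7 shrinkProg) (dotRows 1)))

/-- The first order change of the potential. -/
def gainExpr : Expr :=
  .plus
    (.times (.times (.times (.var 2)
      (.times (.var 0) (.times (.var 0) (.times (.var 0) (.times (.var 0) (.var 0))))))
      (.times (.var 8) (.times (.var 8) (.var 8)))) (.var 19))
    (.times (.times (.times (.times (.times (.lit 4) (.var 1)) (.var 5)) (.var 22)) (.var 21))
      (.var 18))

/-- One step of the walk. -/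
def stepProg : Prog :=
  .seq (sumLoop 16 0 18 (.times (.get 4 (.var 16)) (.get 1 (.var 16))))
  (.seq (sumLoop 15 11 19 (.times (.get 5 (.var 15)) (.get 2 (.var 15))))
  (.seq (.ite gainExpr (.assign 20 (.lit (-1))) (.assign 20 (.lit 1)))
  (.seq (forLoop 16 0 (.put 4 (.var 16)
    (.plus (.get 4 (.var 16)) (.times (.var 20) (.get 1 (.var 16))))))
  (.seq (forLoop 15 11 (.put 5 (.var 15) (.times (.get 5 (.var 15))
    (.plus (.var 9) (.times (.times (.var 20) (.var 2)) (.get 2 (.var 15)))))))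
  (.seq (.assign 21 (.plus (.var 21) (.times (.times (.lit 2) (.var 20)) (.var 18))))
    (.assign 22 (.times (.var 22) (.var 9))))))))

/-- One round of the walk. -/
def roundProg : Prog :=
  .seq (dotRows 4) (.seq
    (forLoop 15 11 (.ite (.plus (.minus (.get 2 (.var 15))
      (.times (.times (.times (.var 2) (.var 0)) (.var 8)) (.var 5))) (.lit 1))
      (.put 3 (.var 15) (.lit 1)) (.put 3 (.var 15) (.lit 0))))
    (forLoop 13 0 (.seq columnProg stepProg)))

/-- The whole walk. -/
def walkProg : Prog :=
  .seq (forLoop 16 0 (.put 4 (.var 16) (.lit 0))) (.seq (forLoop 15 11 (.put 5 (.var 15) (.lit 1)))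
    (.seq (.assign 21 (.lit 0)) (.seq (.assign 22 (.lit 1)) (forLoop 12 10 roundProg))))

/-- Computes the next row of the table. -/
def rowProg : Prog :=
  .seq walkProg (forLoop 16 0 (.put 0 (cell 11 16)
    (.quot (.times (.var 5) (.get 4 (.var 16))) (.times (.times (.var 0) (.var 0)) (.var 8)))))

/-- Computes the threshold in variable `2`. -/
def thresholdProg : Prog :=
  .seq (.assign 3 (.var 0)) (.seq (.assign 4 (.times (.lit 1024) (.var 1)))
    (.loop (.minus (.var 4) (.var 3))
      (.seq (.assign 3 (.times (.var 3)
        (.plus (.plus (.times (.lit 4) (.var 0)) (.times (.lit 2) (.var 2))) (.lit 1))))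
      (.seq (.assign 4 (.times (.var 4)
        (.minus (.minus (.times (.lit 4) (.var 0)) (.times (.lit 2) (.var 2))) (.lit 1))))
        (.assign 2 (.plus (.var 2) (.lit 1)))))))

/-- The square of an expression. -/
def Expr.sq (e : Expr) : Expr := .times e e

/-- Computes the parameters in variables `5` to `10`. -/
def paramProg : Prog :=
  .seq (.assign 5 (Expr.var 1).sq.sq)
  (.seq (.assign 6 (.times (.times (.lit 2) (.var 1)) (Expr.var 5).sq))
  (.seq (.assign 7 (Expr.var 1).sq.sq.sq)
  (.seq (.assign 8 (.lit 1))
  (.seq (forLoop 14 7 (.assign 8 (.times (.var 8) (.var 6))))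
  (.seq (.assign 9 (.times (.times (Expr.var 0).sq (.var 8)) (.var 5)))
    (.assign 10 (.times (Expr.var 0).sq (.var 0))))))))

/-- The algorithm. -/
def mainProg : Prog := .seq thresholdProg (.seq paramProg (forLoop 11 1 rowProg))

end Program

/-! ### The run of the program -/

section Run

variable {n m lam p : ℕ} {V : ℕ → ℕ → ℤ}

/-- The variables that hold the parameters. -/
structure Params (n m lam : ℕ) (s : State) : Prop where
  var_n : s.var 0 = n
  var_m : s.var 1 = m
  var_lam : s.var 2 = lam
  var_D : s.var 5 = scaleD m
  var_K : s.var 6 = scaleK m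
  var_N : s.var 7 = reps m
  var_E : s.var 8 = scaleE m
  var_F : s.var 9 = scaleF n m
  var_T : s.var 10 = (n ^ 3 : ℕ)

/-- The memory holds the parameters and the first `p` rows of the table. -/
structure Holds (n m lam p : ℕ) (V : ℕ → ℕ → ℤ) (s : State) : Prop extends Params n m lam s where
  var_p : s.var 11 = p
  row : ∀ j < p, ∀ l < n, s.arr 0 (j * n + l) = V j l

/-- Variables 0 to 10 are never written once initialized. Of the others, 11 to 14 count rows,
rounds, steps and damping iterations, 15 and 16 run over rows and coordinates, 17 to 20 hold partial
sums and the sign, and 21, 22 hold X and Z. Arrays 0 to 5 hold the table, the direction, inner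
products with the rows, the heavy indicator, Y and W. -/
theorem Params.frame {s s' : State} {S A : List ℕ} (hc : Params n m lam s) (hF : Frame S A s s')
    (hS : ∀ x ∈ S, 11 ≤ x := by decide) : Params n m lam s' := by
  have h : ∀ x < 11, s'.var x = s.var x := fun x hx => hF.1 x fun hxS => by
    have := hS x hxS
    omega
  constructor
  · rw [h _ (by norm_num), hc.var_n]
  · rw [h _ (by norm_num), hc.var_m]
  · rw [h _ (by norm_num), hc.var_lam]
  · rw [h _ (by norm_num), hc.var_D]
  · rw [h _ (by norm_num), hc.var_K]
  · rw [h _ (by norm_num), hc.var_N]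
  · rw [h _ (by norm_num), hc.var_E]
  · rw [h _ (by norm_num), hc.var_F]
  · rw [h _ (by norm_num), hc.var_T]

theorem Holds.frame {s s' : State} {S A : List ℕ} (hc : Holds n m lam p V s)
    (hF : Frame S A s s') (hS : ∀ x ∈ S, 12 ≤ x := by decide) (hA : 0 ∉ A := by decide) :
    Holds n m lam p V s' where
  toParams := hc.toParams.frame hF fun x hx => le_trans (by norm_num) (hS x hx)
  var_p := by
    rw [hF.1 11 fun h => by have := hS 11 h; omega, hc.var_p]
  row := by rw [hF.2 0 hA]; exact hc.row

/-- The hypotheses on the sizes. -/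
structure Setting (n m lam p : ℕ) (V : ℕ → ℕ → ℤ) : Prop where
  mod : Moderate n m
  lam_le : lam ≤ n
  p_le : p ≤ m
  rows : RowsLe n m p V

theorem Moderate.ten_le_bits (h : Moderate n m) : 10 ≤ bits n m := by
  have := Nat.one_le_pow 9 m h.pos_right
  have : m ^ 9 * 12 ≤ m ^ 9 * (n ^ 4 + 12) := by gcongr; omega
  rw [bits, mul_assoc]
  omega

theorem Moderate.pow_le_pow_succ (h : Moderate n m) (k : ℕ) :
    1 ≤ m ^ k ∧ 1000 * m ^ k ≤ m ^ (k + 1) := by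
  have := h.large
  have := h.le
  refine ⟨Nat.one_le_pow _ _ h.pos_right, ?_⟩
  rw [pow_succ']
  gcongr
  omega

/-- Since m is large, one extra power of m absorbs the overhead of a loop, so that run times are
tracked by exponents only. -/
theorem Moderate.loop_le (h : Moderate n m) {K T a b : ℕ} (hK : K ≤ m ^ a) (hT : T ≤ m ^ b) :
    K * (T + 2) + 2 ≤ m ^ (a + b + 1) := by
  have h1 := h.pow_le_pow_succ a
  have h2 := h.pow_le_pow_succ b
  have h3 := h.pow_le_pow_succ (a + b)
  calc K * (T + 2) + 2 ≤ m ^ a * (m ^ b + 2 * m ^ b) + 2 * (m ^ a * m ^ b) := by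
        have : 1 ≤ m ^ a * m ^ b := Nat.mul_pos h1.1 h2.1
        gcongr <;> omega
    _ = 5 * m ^ (a + b) := by rw [pow_add]; ring
    _ ≤ _ := by omega

/-- The bound n⁴ E on the entries covers both uses: with a direction, bounded by E, and with the
position, bounded by n⁴ E. -/
theorem Setting.runs_dotRows (g : Setting n m lam p V) {s : State} (hs : Small (bits n m) s)
    (hc : Holds n m lam p V s) {a : ℕ} (ha : a ≠ 2) {r : ℕ → ℤ} (hr : ∀ l < n, s.arr a l = r l)
    (hb : ∀ l < n, |r l| ≤ n ^ 4 * scaleE m) :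
    ∃ s', Runs (bits n m) (dotRows a) s (m ^ 3) s' ∧ Frame [15, 16, 17] [2] s s' ∧
      ∀ j < p, s'.arr 2 j = dot n (V j) r := by
  have hB := g.mod.ten_le_bits
  have hnm := g.mod.le
  have hn := g.mod.large
  obtain ⟨s', hrun, hF, hd, -⟩ := Runs.tabulate hB (x := 15) (y := 11) (a := 2)
    (p := .seq (sumLoop 16 0 17 (.times (.get 0 (cell 15 16)) (.get a (.var 16))))
      (.put 2 (.var 15) (.var 17))) (Tb := m) [16, 17] (fun k => k)
    (fun j => dot n (V j) r) hs (by decide) (by decide) (by decide) hc.var_p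
    (fun k _ k' _ e => by exact_mod_cast e)
    (fun j hj s₁ hs₁ hF₁ hx _ _ => by
      have hc₁ := hc.frame hF₁
      obtain ⟨s₂, hr₂, hF₂, hz₂⟩ := Runs.sumLoop hB (x := 16) (y := 0) (z := 17)
        (e := .times (.get 0 (cell 15 16)) (.get a (.var 16)))
        (by simp [Expr.nodes, Expr.maxLit, cell]) (by decide) (by decide) (by decide)
        (fun l => V j l * r l) hs₁ hc₁.var_n
        (fun l hl s₃ hF₃ hx₃ => by
          have hc₃ := hc₁.frame hF₃
          have e1 : s₃.arr a = s.arr a := (hF₃.2 a (by simp)).trans (hF₁.2 a (by simp [ha]))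
          have e2 : s₃.var 15 = j := (hF₃.1 15 (by decide)).trans hx
          simp [Expr.eval, cell, e2, hx₃, hc₃.var_n, hc₃.row j hj l hl, e1, hr l hl])
        (fun k hk => bits_dot g.mod g.rows hb hj hk)
      refine ⟨_, (hr₂.seq (Runs.put hB hr₂.1 2 (i := .var 15) (e := .var 17)
        (by decide) (by decide) (k := j) (z := dot n (V j) r) ?_ hz₂ (bits_dot g.mod g.rows hb hj le_rfl))).mono (by omega),
        hF₂.trans (Frame.setArr _ _ _ _), ?_⟩
      · exact (hF₂.1 15 (by decide)).trans hx
      · simp [State.setArr, hF₂.2 2 (by decide)])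
  exact ⟨s', hrun.mono (g.mod.loop_le (a := 1) (b := 1) (by simpa using g.p_le) (by simp)), hF, hd⟩

/-- All inner products are stored in array 2 before array 1 is overwritten; afterwards each
coordinate depends only on its own old value, so the update in place is correct. -/
theorem Setting.runs_shrinkProg (g : Setting n m lam p V) {s : State} (hs : Small (bits n m) s)
    (hc : Holds n m lam p V s) {r hv : ℕ → ℤ} (hr : ∀ l < n, s.arr 1 l = r l)
    (hh : ∀ j < p, s.arr 3 j = hv j) (h01 : ∀ j, hv j = 0 ∨ hv j = 1)
    (hb : ∀ l < n, |r l| ≤ scaleE m) (hb' : ∀ l < n, |shrink n m p hv V r l| ≤ scaleE m) :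
    ∃ s', Runs (bits n m) shrinkProg s (m ^ 5) s' ∧ Frame [15, 16, 17] [1, 2] s s' ∧
      ∀ l < n, s'.arr 1 l = shrink n m p hv V r l := by
  have hB := g.mod.ten_le_bits
  have hnm := g.mod.le
  have hn := g.mod.large
  have hE := scaleE_pos g.mod.pos_right
  have hn4 : (1 : ℤ) ≤ n ^ 4 := one_le_pow₀ (by exact_mod_cast g.mod.pos_left)
  have hEB : scaleE m ≤ 2 ^ bits n m :=
    g.mod.le_two_pow_bits (j := 1) (by simpa using g.mod.paramsLe.E_le) (by omega)
  obtain ⟨s₀, hr₀, hF₀, hd₀⟩ := g.runs_dotRows hs hc (a := 1) (by decide) hr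
    fun l hl => (hb l hl).trans (le_mul_of_one_le_left hE.le hn4)
  have hc₀ := hc.frame hF₀
  obtain ⟨s', hrun, hF, hd, -⟩ := Runs.tabulate hB (x := 16) (y := 0) (a := 1)
    (p := .seq (sumLoop 15 11 17 (.times (.times (.get 3 (.var 15)) (.get 2 (.var 15)))
        (.get 0 (cell 15 16))))
      (.put 1 (.var 16) (.minus (.times (.var 6) (.get 1 (.var 16))) (.var 17))))
    (Tb := 4 * m + 4) [15, 17] (fun k => k)
    (fun l => shrink n m p hv V r l) hr₀.1 (by decide) (by decide) (by decide) hc₀.var_n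
    (fun k _ k' _ e => by exact_mod_cast e)
    (fun l hl s₁ hs₁ hF₁ hx hold _ => by
      have hc₁ := hc₀.frame hF₁
      have e0 : s₁.arr 1 l = r l := by
        rw [hold l le_rfl hl, hF₀.2 1 (by decide), hr l hl]
      obtain ⟨s₂, hr₂, hF₂, hz₂⟩ := Runs.sumLoop hB (x := 15) (y := 11) (z := 17)
        (e := .times (.times (.get 3 (.var 15)) (.get 2 (.var 15))) (.get 0 (cell 15 16)))
        (by decide) (by decide) (by decide) (by decide)
        (fun j => hv j * dot n (V j) r * V j l) hs₁ hc₁.var_p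
        (fun j hj s₃ hF₃ hx₃ => by
          have hc₃ := hc₁.frame hF₃
          have e1 : s₃.arr 3 j = hv j := by
            rw [hF₃.2 3 (by decide), hF₁.2 3 (by decide), hF₀.2 3 (by decide), hh j hj]
          have e2 : s₃.arr 2 j = dot n (V j) r := by
            rw [hF₃.2 2 (by decide), hF₁.2 2 (by decide), hd₀ j hj]
          have e3 : s₃.var 16 = l := (hF₃.1 16 (by decide)).trans hx
          simp [Expr.eval, cell, e1, e2, e3, hx₃, hc₃.var_n, hc₃.row j hj l hl])
        (fun k hk => bits_damp g.mod g.p_le g.rows h01 hb hk hl)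
      have hc₂ := hc₁.frame hF₂
      have e4 : s₂.var 16 = l := (hF₂.1 16 (by decide)).trans hx
      refine ⟨_, (hr₂.seq (Runs.put hB hr₂.1 1 (i := .var 16)
        (e := .minus (.times (.var 6) (.get 1 (.var 16))) (.var 17)) (by decide) (by decide)
        (k := l) (z := shrink n m p hv V r l) e4 ?_ ((hb' l hl).trans hEB))).mono
        (by have := g.p_le; omega), hF₂.trans (Frame.setArr _ _ _ _), ?_⟩
      · simp [Expr.eval, e4, hz₂, hc₂.var_K, hF₂.2 1 (by decide), e0, shrink]
      · simp [State.setArr, hF₂.2 1 (by decide)])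
  have t1 : n * (4 * m + 4 + 2) + 2 ≤ m ^ 4 :=
    g.mod.loop_le (a := 1) (b := 2) (by rw [pow_one]; omega) (by rw [pow_two]; nlinarith)
  have t2 : 1 ≤ m ^ 3 ∧ 1000 * m ^ 3 ≤ m ^ 4 := g.mod.pow_le_pow_succ 3
  have t3 : 1 ≤ m ^ 4 ∧ 1000 * m ^ 4 ≤ m ^ 5 := g.mod.pow_le_pow_succ 4
  exact ⟨s', (hr₀.seq hrun).mono (by omega), hF₀.trans hF, hd⟩

theorem Setting.runs_columnProg (g : Setting n m lam p V) {s : State} (hs : Small (bits n m) s)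
    (hc : Holds n m lam p V s) {i : ℕ} (hi : i < n) (hsi : s.var 13 = i) {hv : ℕ → ℤ}
    (hh : ∀ j < p, s.arr 3 j = hv j) (h01 : ∀ j, hv j = 0 ∨ hv j = 1) :
    ∃ s', Runs (bits n m) columnProg s (m ^ 15) s' ∧ Frame [14, 15, 16, 17] [1, 2] s s' ∧
      (∀ l < n, s'.arr 1 l = column n m p hv V i l) ∧
      ∀ j < p, s'.arr 2 j = dot n (V j) (column n m p hv V i) := by
  have hB := g.mod.ten_le_bits
  have hnm := g.mod.le
  have hn := g.mod.large
  have hE := scaleE_pos g.mod.pos_right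
  have hn4 : (1 : ℤ) ≤ n ^ 4 := one_le_pow₀ (by exact_mod_cast g.mod.pos_left)
  obtain ⟨s₀, hr₀, hF₀, hd₀, -⟩ := Runs.tabulate_put hB (x := 16) (y := 0) (a := 1)
    (i := .var 16) (e := .lit 0) (by decide) (by decide) (fun k => k) (fun _ => 0) hs (by decide)
    hc.var_n (fun k _ k' _ e => by exact_mod_cast e) (by simp)
    (fun k _ s' _ hx _ _ => ⟨hx, rfl⟩)
  have r₁ := Runs.put hB hr₀.1 1 (i := .var 13) (e := .lit 1) (k := i) (z := 1) (by decide)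
    (by decide) ((hF₀.1 13 (by decide)).trans hsi) rfl (by simpa using one_le_pow₀ (by norm_num))
  have hF₁ : Frame [14, 15, 16, 17] [1, 2] s (s₀.setArr 1 i 1) := hF₀.trans (Frame.setArr _ _ _ _)
  have hN : ((reps m : ℕ) : ℤ) ≤ 2 ^ bits n m := by
    have := r₁.1.1 7
    rw [(hc.frame hF₁).var_N] at this
    exact (le_abs_self _).trans this
  have hb : ∀ k ≤ reps m, ∀ l < n, |(shrink n m p hv V)^[k] (unitRow i) l| ≤ scaleE m :=
    fun k hk l hl => abs_shrink_iterate_le g.mod g.p_le g.rows h01 hi hk hl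
  obtain ⟨s₂, hr₂, hF₂, hd₂⟩ := Runs.forLoop hB (x := 14) (y := 7) (p := shrinkProg) (Tb := m ^ 5)
    (fun k s' => Frame [14, 15, 16, 17] [1, 2] s s' ∧
      ∀ l < n, s'.arr 1 l = (shrink n m p hv V)^[k] (unitRow i) l) hN r₁.1
    (fun k _ s' h => (hc.frame h.1).var_N)
    ⟨hF₁.trans (Frame.setVar _ 14 0), fun l hl => by
      by_cases e : l = i
      · simp [e, unitRow]
      · simp [e, unitRow, hd₀ l hl]⟩
    (fun k hk s' hs' hx h => by
      obtain ⟨s'', hr, hF, hd⟩ := g.runs_shrinkProg hs' (hc.frame h.1) h.2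
        (fun j hj => by rw [h.1.2 3 (by decide), hh j hj]) h01 (hb k hk.le)
        (by
          have := hb (k + 1) hk
          rwa [Function.iterate_succ_apply'] at this)
      refine ⟨s'', hr, (hF.1 14 (by decide)).trans hx,
        (h.1.trans (S := [14, 15, 16, 17]) (A := [1, 2]) hF).trans (Frame.setVar _ 14 _),
        fun l hl => ?_⟩
      rw [Function.iterate_succ_apply']
      exact hd l hl)
  obtain ⟨s₃, hr₃, hF₃, hd₃⟩ := g.runs_dotRows hr₂.1 (hc.frame hF₂) (a := 1) (by decide)
    (r := column n m p hv V i) hd₂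
    fun l hl => (hb _ le_rfl l hl).trans (le_mul_of_one_le_left hE.le hn4)
  have t1 : reps m * (m ^ 5 + 2) + 2 ≤ m ^ 14 := g.mod.loop_le (a := 8) (b := 5) le_rfl le_rfl
  have t2 : 1 ≤ m ^ 14 ∧ 1000 * m ^ 14 ≤ m ^ 15 := g.mod.pow_le_pow_succ 14
  have t3 : m ^ 3 ≤ m ^ 14 := Nat.pow_le_pow_right g.mod.pos_right (by norm_num)
  have t4 : m ≤ m ^ 14 := Nat.le_self_pow (by norm_num) m
  refine ⟨s₃, (hr₀.seq (r₁.seq (hr₂.seq hr₃))).mono ?_, hF₂.trans hF₃, fun l hl => ?_, hd₃⟩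
  · omega
  · rw [hF₃.2 1 (by decide)]
    exact hd₂ l hl

end Run


/-! ### Runs of a step, a round, a walk and a row -/

section Run

variable {n m lam p : ℕ} {V : ℕ → ℕ → ℤ}

/-- The memory holds the state `S` of the walk. -/
structure Tracks (n p : ℕ) (S : Walk) (s : State) : Prop where
  pos : ∀ l < n, s.arr 4 l = S.Y l
  wt : ∀ j < p, s.arr 5 j = S.W j
  corr : s.var 21 = S.X
  scale : s.var 22 = S.Z

theorem Tracks.frame {W : Walk} {s s' : State} {S A : List ℕ} (hT : Tracks n p W s)
    (hF : Frame S A s s') (h1 : 21 ∉ S ∧ 22 ∉ S := by decide) (h2 : 4 ∉ A ∧ 5 ∉ A := by decide) :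
    Tracks n p W s' := by
  constructor
  · rw [hF.2 4 h2.1]; exact hT.pos
  · rw [hF.2 5 h2.2]; exact hT.wt
  · rw [hF.1 21 h1.1]; exact hT.corr
  · rw [hF.1 22 h1.2]; exact hT.scale

/-- The two sums in variables 18 and 19 are taken before Y and W change, because the sign and the
update of X refer to the old state. -/
theorem Setting.runs_stepProg (g : Setting n m lam p V) {s : State} (hs : Small (bits n m) s)
    (hc : Holds n m lam p V s) {S : Walk} (hT : Tracks n p S s) {t : ℕ} (hS : S.Le n m p t)
    (ht : t < n ^ 4) {r : ℕ → ℤ} (hr : ∀ l < n, s.arr 1 l = r l)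
    (hd : ∀ j < p, s.arr 2 j = dot n (V j) r) (hb : ∀ l < n, |r l| ≤ scaleE m) :
    ∃ s', Runs (bits n m) stepProg s (m ^ 2) s' ∧ Frame [15, 16, 18, 19, 20, 21, 22] [4, 5] s s' ∧
      Tracks n p (S.step n m lam p V r) s' := by
  have hB := g.mod.ten_le_bits
  have hnm := g.mod.le
  have hn := g.mod.large
  have hp := g.p_le
  have hS' := hS.step g.mod g.lam_le g.rows ht.le hb
  obtain ⟨s₁, hr₁, hF₁, hz₁⟩ := Runs.sumLoop hB (x := 16) (y := 0) (z := 18)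
    (e := .times (.get 4 (.var 16)) (.get 1 (.var 16)))
    (by decide) (by decide) (by decide) (by decide) (fun l => S.Y l * r l) hs hc.var_n
    (fun l hl s' hF hx => by
      simp [Expr.eval, hx, hF.2 1 (by decide), hF.2 4 (by decide), hr l hl, hT.pos l hl])
    (fun k hk => bits_cross g.mod hS ht.le hb hk)
  have hc₁ := hc.frame hF₁
  have hT₁ := hT.frame hF₁
  obtain ⟨s₂, hr₂, hF₂, hz₂⟩ := Runs.sumLoop hB (x := 15) (y := 11) (z := 19)
    (e := .times (.get 5 (.var 15)) (.get 2 (.var 15)))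
    (by decide) (by decide) (by decide) (by decide) (fun j => S.W j * dot n (V j) r) hr₁.1
    hc₁.var_p
    (fun j hj s' hF hx => by
      simp [Expr.eval, hx, hF.2 2 (by decide), hF.2 5 (by decide), hT₁.wt j hj,
        hF₁.2 2 (by decide), hd j hj])
    (fun k hk => bits_gain g.mod g.p_le g.rows hS ht.le hb hk)
  have hc₂ := hc₁.frame hF₂
  have hT₂ := hT₁.frame hF₂
  have h18 : s₂.var 18 = dot n S.Y r := (hF₂.1 18 (by decide)).trans hz₁
  have hgain : gainExpr.eval s₂ = Walk.gain n m lam p V S r := by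
    simp only [gainExpr, Expr.eval, hc₂.var_n, hc₂.var_m, hc₂.var_lam, hc₂.var_D, hc₂.var_E,
      hT₂.corr, hT₂.scale, h18, hz₂, Walk.gain]
    ring
  have hone : |(1 : ℤ)| ≤ 2 ^ bits n m := by simpa using one_le_pow₀ (by norm_num)
  set ε := Walk.sgn n m lam p V S r with hε
  have hr₃ : Runs (bits n m) (.ite gainExpr (.assign 20 (.lit (-1))) (.assign 20 (.lit 1))) s₂ 2
      (s₂.setVar 20 ε) := by
    refine Runs.ite hB hr₂.1 (by decide) (fun h => ?_) (fun h => ?_)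
    · rw [hgain] at h
      have e : ε = -1 := by rw [hε, Walk.sgn, if_pos h]
      rw [e]
      exact Runs.assign hB hr₂.1 20 (by decide) rfl (by simpa using hone)
    · rw [hgain] at h
      have e : ε = 1 := by rw [hε, Walk.sgn, if_neg (by omega)]
      rw [e]
      exact Runs.assign hB hr₂.1 20 (by decide) rfl hone
  have hF₃ := Frame.setVar s₂ 20 ε
  have hc₃ := hc₂.frame hF₃
  have hT₃ := hT₂.frame hF₃
  have h20 : (s₂.setVar 20 ε).var 20 = ε := by simp
  have hr1 : ∀ l < n, (s₂.setVar 20 ε).arr 1 l = r l := fun l hl => by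
    rw [hF₃.2 1 (by decide), hF₂.2 1 (by decide), hF₁.2 1 (by decide), hr l hl]
  have hd2 : ∀ j < p, (s₂.setVar 20 ε).arr 2 j = dot n (V j) r := fun j hj => by
    rw [hF₃.2 2 (by decide), hF₂.2 2 (by decide), hF₁.2 2 (by decide), hd j hj]
  have h18' : (s₂.setVar 20 ε).var 18 = dot n S.Y r := (hF₃.1 18 (by decide)).trans h18
  generalize s₂.setVar 20 ε = s₃ at *
  obtain ⟨s₄, hr₄, hF₄, hd₄, -⟩ := Runs.tabulate_put hB (x := 16) (y := 0) (a := 4)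
    (i := .var 16) (e := .plus (.get 4 (.var 16)) (.times (.var 20) (.get 1 (.var 16))))
    (by decide) (by decide) (fun k => k) (S.step n m lam p V r).Y hr₃.1 (by decide)
    hc₃.var_n (fun k _ k' _ e => by exact_mod_cast e) (fun l hl => bits_Y g.mod hS' ht hl)
    (fun l hl s' hF hx hold _ => ⟨hx, by
      simp [Expr.eval, hx, hold l le_rfl hl, hT₃.pos l hl, hF.1 20 (by decide), h20,
        hF.2 1 (by decide), hr1 l hl, Walk.step, ← hε]⟩)
  have hc₄ := hc₃.frame hF₄
  obtain ⟨s₅, hr₅, hF₅, hd₅, -⟩ := Runs.tabulate_put hB (x := 15) (y := 11) (a := 5)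
    (i := .var 15) (e := .times (.get 5 (.var 15))
      (.plus (.var 9) (.times (.times (.var 20) (.var 2)) (.get 2 (.var 15)))))
    (by decide) (by decide) (fun k => k) (S.step n m lam p V r).W hr₄.1 (by decide)
    hc₄.var_p (fun k _ k' _ e => by exact_mod_cast e) (fun j hj => bits_W g.mod hS' ht hj)
    (fun j hj s' hF hx hold _ => ⟨hx, by
      have hc' := hc₄.frame hF
      simp [Expr.eval, hx, hold j le_rfl hj, hF₄.2 5 (by decide), hT₃.wt j hj,
        hF.1 20 (by decide), hF₄.1 20 (by decide), h20, hF.2 2 (by decide), hF₄.2 2 (by decide),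
        hd2 j hj, Walk.step, ← hε, hc'.var_F, hc'.var_lam]⟩)
  have hc₅ := hc₄.frame hF₅
  have hr₆ := Runs.assign hB hr₅.1 21
    (e := .plus (.var 21) (.times (.times (.lit 2) (.var 20)) (.var 18))) (by decide)
    (z := (S.step n m lam p V r).X) (by
      simp [Expr.eval, hF₅.1 21 (by decide), hF₄.1 21 (by decide), hT₃.corr, hF₅.1 20 (by decide),
        hF₄.1 20 (by decide), h20, hF₅.1 18 (by decide), hF₄.1 18 (by decide), h18', Walk.step,
        ← hε]) (bits_X g.mod hS' ht)
  have hr₇ := Runs.assign hB hr₆.1 22 (e := .times (.var 22) (.var 9)) (by decide)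
    (z := (S.step n m lam p V r).Z) (by
      simp [Expr.eval, hF₅.1 22 (by decide), hF₄.1 22 (by decide), hT₃.scale, hc₅.var_F,
        Walk.step]) (bits_Z g.mod hS' ht)
  refine ⟨_, (hr₁.seq (hr₂.seq (hr₃.seq (hr₄.seq (hr₅.seq (hr₆.seq hr₇)))))).mono ?_, ?_, ?_⟩
  · have : 16 * m ≤ m ^ 2 := by rw [pow_two]; exact Nat.mul_le_mul_right _ (by omega)
    omega
  · have f₁ : Frame [15, 16, 18, 19, 20, 21, 22] [4, 5] s s₂ := hF₁.trans hF₂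
    have f₂ : Frame [15, 16, 18, 19, 20, 21, 22] [4, 5] s s₃ := f₁.trans hF₃
    have f₃ : Frame [15, 16, 18, 19, 20, 21, 22] [4, 5] s s₄ := f₂.trans hF₄
    have f₄ : Frame [15, 16, 18, 19, 20, 21, 22] [4, 5] s s₅ := f₃.trans hF₅
    have f₅ : Frame [21, 22] [] s₅ ((s₅.setVar 21 (S.step n m lam p V r).X).setVar 22
        (S.step n m lam p V r).Z) := (Frame.setVar _ _ _).trans (Frame.setVar _ _ _)
    exact f₄.trans f₅
  · constructor
    · intro l hl
      simp [hF₅.2 4 (by decide), hd₄ l hl]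
    · intro j hj
      simp [hd₅ j hj]
    · simp
    · simp

theorem Setting.runs_roundProg (g : Setting n m lam p V) {s : State} (hs : Small (bits n m) s)
    (hc : Holds n m lam p V s) {S : Walk} (hT : Tracks n p S s) {t : ℕ} (hS : S.Le n m p t)
    (ht : t + n ≤ n ^ 4) :
    ∃ s', Runs (bits n m) roundProg s (m ^ 19) s' ∧
      Frame [13, 14, 15, 16, 17, 18, 19, 20, 21, 22] [1, 2, 3, 4, 5] s s' ∧
      Tracks n p (S.inRound n m lam p V n) s' := by
  have hB := g.mod.ten_le_bits
  have hnm := g.mod.le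
  have hn := g.mod.large
  have hone : |(1 : ℤ)| ≤ 2 ^ bits n m := by simpa using one_le_pow₀ (by norm_num)
  have h01 := heavy_eq_zero_or_one n m lam V S
  obtain ⟨s₁, hr₁, hF₁, hd₁⟩ := g.runs_dotRows hs hc (a := 4) (by decide) hT.pos
    fun l hl => hS.Y_le g.mod (by omega) hl
  have hc₁ := hc.frame hF₁
  obtain ⟨s₂, hr₂, hF₂, hd₂, -⟩ := Runs.tabulate hB (x := 15) (y := 11) (a := 3)
    (p := .ite (.plus (.minus (.get 2 (.var 15))
      (.times (.times (.times (.var 2) (.var 0)) (.var 8)) (.var 5))) (.lit 1))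
      (.put 3 (.var 15) (.lit 1)) (.put 3 (.var 15) (.lit 0))) (Tb := 2) [] (fun k => k)
    (S.heavy n m lam V) hr₁.1 (by decide) (by decide) (by decide) hc₁.var_p
    (fun k _ k' _ e => by exact_mod_cast e)
    (fun j hj s' hs' hF hx _ _ => by
      have hc' := hc₁.frame hF
      have e : s'.arr 2 j = dot n (V j) S.Y := by rw [hF.2 2 (by decide), hd₁ j hj]
      refine ⟨s'.setArr 3 j (S.heavy n m lam V j), Runs.ite hB hs' (by decide) (fun h => ?_)
        (fun h => ?_), Frame.setArr _ _ _ _, by simp [State.setArr]⟩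
      -- Tests ask for positivity, so the integer inequality "threshold ≤ inner product" is tested
      -- as difference plus one.
      · simp only [Expr.eval, hx, hc'.var_n, hc'.var_lam, hc'.var_E, hc'.var_D, e] at h
        have e1 : S.heavy n m lam V j = 1 := if_pos (by linarith)
        rw [e1]
        exact Runs.put hB hs' 3 (by decide) (by decide) hx rfl hone
      · simp only [Expr.eval, hx, hc'.var_n, hc'.var_lam, hc'.var_E, hc'.var_D, e] at h
        have e1 : S.heavy n m lam V j = 0 := if_neg (by linarith)
        rw [e1]
        exact Runs.put hB hs' 3 (by decide) (by decide) hx rfl (by simp))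
  -- Array 3 is absent from this frame: the heavy rows are determined at the start of the round and
  -- stay fixed during its n steps.
  have f₂ : Frame [13, 14, 15, 16, 17, 18, 19, 20, 21, 22] [1, 2, 4, 5] s₂ s₂ := Frame.refl _ _ _
  have hc₂ := hc₁.frame hF₂
  have hT₂ := (hT.frame hF₁).frame hF₂
  have hn' : ((n : ℕ) : ℤ) ≤ 2 ^ bits n m := by
    have := hr₂.1.1 0
    rw [hc₂.var_n] at this
    exact (le_abs_self _).trans this
  obtain ⟨s₃, hr₃, hF₃, hT₃⟩ := Runs.forLoop hB (x := 13) (y := 0) (p := .seq columnProg stepProg)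
    (Tb := m ^ 16)
    (fun k s' => Frame [13, 14, 15, 16, 17, 18, 19, 20, 21, 22] [1, 2, 4, 5] s₂ s' ∧
      Tracks n p (S.inRound n m lam p V k) s') hn' hr₂.1
    (fun k _ s' h => (hc₂.frame h.1).var_n)
    ⟨f₂.trans (Frame.setVar _ 13 0), hT₂.frame (Frame.setVar _ 13 0)⟩
    (fun k hk s' hs' hx h => by
      have hc' := hc₂.frame h.1
      obtain ⟨s₄, hr₄, hF₄, hd₄, hd₄'⟩ := g.runs_columnProg hs' hc' hk hx
        (hv := S.heavy n m lam V) (fun j hj => by rw [h.1.2 3 (by decide), hd₂ j hj]) h01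
      obtain ⟨s₅, hr₅, hF₅, hT₅⟩ := g.runs_stepProg hr₄.1 (hc'.frame hF₄) (h.2.frame hF₄)
        (Walk.Le.inRound g.mod g.lam_le g.p_le g.rows hS k hk.le (by omega)) (by omega) hd₄ hd₄'
        (fun l hl => abs_shrink_iterate_le g.mod g.p_le g.rows h01 hk le_rfl hl)
      have f₄ : Frame [13, 14, 15, 16, 17, 18, 19, 20, 21, 22] [1, 2, 4, 5] s₂ s₄ := h.1.trans hF₄
      have f₅ : Frame [13, 14, 15, 16, 17, 18, 19, 20, 21, 22] [1, 2, 4, 5] s₂ s₅ := f₄.trans hF₅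
      refine ⟨s₅, (hr₄.seq hr₅).mono ?_, ?_, f₅.trans (Frame.setVar _ 13 _),
        hT₅.frame (Frame.setVar _ 13 _)⟩
      · have t1 : 1 ≤ m ^ 15 ∧ 1000 * m ^ 15 ≤ m ^ 16 := g.mod.pow_le_pow_succ 15
        have t2 : m ^ 2 ≤ m ^ 15 := Nat.pow_le_pow_right g.mod.pos_right (by norm_num)
        omega
      · rw [hF₅.1 13 (by decide), hF₄.1 13 (by decide), hx])
  have f₁ : Frame [13, 14, 15, 16, 17, 18, 19, 20, 21, 22] [1, 2, 3, 4, 5] s s₂ := hF₁.trans hF₂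
  refine ⟨s₃, (hr₁.seq (hr₂.seq hr₃)).mono ?_, f₁.trans hF₃, hT₃⟩
  have t1 : n * (m ^ 16 + 2) + 2 ≤ m ^ 18 :=
    g.mod.loop_le (a := 1) (b := 16) (by rw [pow_one]; omega) le_rfl
  have t2 : 1 ≤ m ^ 18 ∧ 1000 * m ^ 18 ≤ m ^ 19 := g.mod.pow_le_pow_succ 18
  have t3 : m ^ 3 ≤ m ^ 18 := Nat.pow_le_pow_right g.mod.pos_right (by norm_num)
  have t4 : m ≤ m ^ 18 := Nat.le_self_pow (by norm_num) m
  have := g.p_le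
  omega

theorem Setting.runs_walkProg (g : Setting n m lam p V) {s : State} (hs : Small (bits n m) s)
    (hc : Holds n m lam p V s) :
    ∃ s', Runs (bits n m) walkProg s (m ^ 24) s' ∧
      Frame [12, 13, 14, 15, 16, 17, 18, 19, 20, 21, 22] [1, 2, 3, 4, 5] s s' ∧
      Tracks n p (Walk.rounds n m lam p V (n ^ 3)) s' := by
  have hB := g.mod.ten_le_bits
  have hnm := g.mod.le
  have hn := g.mod.large
  have hone : |(1 : ℤ)| ≤ 2 ^ bits n m := by simpa using one_le_pow₀ (by norm_num)
  obtain ⟨s₁, hr₁, hF₁, hd₁, -⟩ := Runs.tabulate_put hB (x := 16) (y := 0) (a := 4)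
    (i := .var 16) (e := .lit 0) (by decide) (by decide) (fun k => k) (fun _ => 0) hs (by decide)
    hc.var_n (fun k _ k' _ e => by exact_mod_cast e) (by simp) (fun k _ s' _ hx _ _ => ⟨hx, rfl⟩)
  have hc₁ := hc.frame hF₁
  obtain ⟨s₂, hr₂, hF₂, hd₂, -⟩ := Runs.tabulate_put hB (x := 15) (y := 11) (a := 5)
    (i := .var 15) (e := .lit 1) (by decide) (by decide) (fun k => k) (fun _ => 1) hr₁.1
    (by decide) hc₁.var_p (fun k _ k' _ e => by exact_mod_cast e) (fun _ _ => hone)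
    (fun k _ s' _ hx _ _ => ⟨hx, rfl⟩)
  have r₃ := Runs.assign hB hr₂.1 21 (e := .lit 0) (z := 0) (by decide) rfl (by simp)
  have r₄ := Runs.assign hB r₃.1 22 (e := .lit 1) (z := 1) (by decide) rfl hone
  set s₄ := (s₂.setVar 21 0).setVar 22 1 with hs₄
  have f₃ : Frame [21, 22] [] s₂ s₄ := (Frame.setVar _ _ _).trans (Frame.setVar _ _ _)
  have f₂ : Frame [12, 13, 14, 15, 16, 17, 18, 19, 20, 21, 22] [1, 2, 3, 4, 5] s s₂ :=
    hF₁.trans hF₂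
  have f₄ : Frame [12, 13, 14, 15, 16, 17, 18, 19, 20, 21, 22] [1, 2, 3, 4, 5] s s₄ :=
    f₂.trans f₃
  have hT₄ : Tracks n p Walk.init s₄ := by
    constructor
    · intro l hl
      simp [hs₄, hF₂.2 4 (by decide), hd₁ l hl, Walk.init]
    · intro j hj
      simp [hs₄, hd₂ j hj, Walk.init]
    · simp [hs₄, Walk.init]
    · simp [hs₄, Walk.init]
  have hc₄ := hc.frame f₄
  have hN : ((n ^ 3 : ℕ) : ℤ) ≤ 2 ^ bits n m := by
    have := r₄.1.1 10
    rw [hc₄.var_T] at this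
    exact (le_abs_self _).trans this
  obtain ⟨s₅, hr₅, hF₅, hT₅⟩ := Runs.forLoop hB (x := 12) (y := 10) (p := roundProg)
    (Tb := m ^ 19)
    (fun k s' => Frame [12, 13, 14, 15, 16, 17, 18, 19, 20, 21, 22] [1, 2, 3, 4, 5] s s' ∧
      Tracks n p (Walk.rounds n m lam p V k) s') hN r₄.1
    (fun k _ s' h => (hc.frame h.1).var_T)
    ⟨f₄.trans (Frame.setVar _ 12 0), hT₄.frame (Frame.setVar _ 12 0)⟩
    (fun k hk s' hs' hx h => by
      obtain ⟨s₆, hr₆, hF₆, hT₆⟩ := g.runs_roundProg hs' (hc.frame h.1) h.2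
        (Walk.Le.rounds g.mod g.lam_le g.p_le g.rows k hk.le) (by
          calc k * n + n = (k + 1) * n := by ring
            _ ≤ n ^ 3 * n := by gcongr; omega
            _ = n ^ 4 := by ring)
      have f₆ : Frame [12, 13, 14, 15, 16, 17, 18, 19, 20, 21, 22] [1, 2, 3, 4, 5] s s₆ :=
        h.1.trans hF₆
      exact ⟨s₆, hr₆, (hF₆.1 12 (by decide)).trans hx, f₆.trans (Frame.setVar _ 12 _),
        hT₆.frame (Frame.setVar _ 12 _)⟩)
  refine ⟨s₅, (hr₁.seq (hr₂.seq (r₃.seq (r₄.seq hr₅)))).mono ?_, hF₅, hT₅⟩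
  have t1 : n ^ 3 * (m ^ 19 + 2) + 2 ≤ m ^ 23 :=
    g.mod.loop_le (a := 3) (b := 19) (Nat.pow_le_pow_left (by omega) 3) le_rfl
  have t2 : 1 ≤ m ^ 23 ∧ 1000 * m ^ 23 ≤ m ^ 24 := g.mod.pow_le_pow_succ 23
  have t4 : m ≤ m ^ 23 := Nat.le_self_pow (by norm_num) m
  have := g.p_le
  omega

theorem Setting.runs_rowProg (g : Setting n m lam p V) {s : State} (hs : Small (bits n m) s)
    (hc : Holds n m lam p V s) :
    ∃ s', Runs (bits n m) rowProg s (m ^ 25) s' ∧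
      Frame [12, 13, 14, 15, 16, 17, 18, 19, 20, 21, 22] [0, 1, 2, 3, 4, 5] s s' ∧
      (∀ j < p, ∀ l < n, s'.arr 0 (j * n + l) = V j l) ∧
      ∀ l < n, s'.arr 0 (p * n + l) = nextRow n m lam p V l := by
  have hB := g.mod.ten_le_bits
  have hnm := g.mod.le
  have hn := g.mod.large
  obtain ⟨s₁, hr₁, hF₁, hT₁⟩ := g.runs_walkProg hs hc
  have hc₁ := hc.frame hF₁
  obtain ⟨s₂, hr₂, hF₂, hd₂, hold⟩ := Runs.tabulate_put hB (x := 16) (y := 0) (a := 0)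
    (i := cell 11 16) (e := .quot (.times (.var 5) (.get 4 (.var 16)))
      (.times (.times (.var 0) (.var 0)) (.var 8))) (by decide) (by decide)
    (fun l => p * n + l) (nextRow n m lam p V) hr₁.1 (by decide) hc₁.var_n
    (fun k _ k' _ e => by have := add_left_cancel e; exact_mod_cast this)
    (fun l hl => bits_nextRow g.mod g.lam_le g.p_le g.rows hl)
    (fun l hl s' hF hx _ _ => by
      have e0 := (hF.1 0 (by decide)).trans hc₁.var_n
      have e5 := (hF.1 5 (by decide)).trans hc₁.var_D
      have e8 := (hF.1 8 (by decide)).trans hc₁.var_E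
      have e11 := (hF.1 11 (by decide)).trans hc₁.var_p
      have e4 : s'.arr 4 l = (Walk.rounds n m lam p V (n ^ 3)).Y l := by rw [hF.2 4 (by decide), hT₁.pos l hl]
      refine ⟨by simp [Expr.eval, cell, e0, e11, hx], ?_⟩
      simp only [Expr.eval, e0, e5, e8, hx, e4, nextRow, pow_two])
  refine ⟨s₂, (hr₁.seq hr₂).mono ?_, hF₁.trans hF₂, fun j hj l hl => ?_, hd₂⟩
  · have t2 : 1 ≤ m ^ 24 ∧ 1000 * m ^ 24 ≤ m ^ 25 := g.mod.pow_le_pow_succ 24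
    have t4 : m ≤ m ^ 24 := Nat.le_self_pow (by norm_num) m
    omega
  · rw [hold _ fun k hk e => ?_, hc₁.row j hj l hl]
    have h1 : p * n + k = j * n + l := by exact_mod_cast e
    -- Cells are laid out row by row, so the end of row j does not pass the start of row p and the
    -- earlier rows are not overwritten.
    have h2 : (j + 1) * n ≤ p * n := Nat.mul_le_mul_right _ hj
    rw [add_one_mul] at h2
    omega

end Run


/-! ### Initialization and total running time -/

section Run

variable {n m lam : ℕ}

theorem Moderate.cast_le_two_pow (h : Moderate n m) :
    (n : ℤ) ≤ 2 ^ bits n m ∧ (m : ℤ) ≤ 2 ^ bits n m := by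
  have P := h.paramsLe
  exact ⟨h.le_two_pow_bits (j := 1) (by simpa using P.n_le) (by omega),
    h.le_two_pow_bits (j := 1) (by simpa using P.m_le) (by omega)⟩

theorem Moderate.small_inputState (h : Moderate n m) : Small (bits n m) (inputState n m) := by
  obtain ⟨h1, h2⟩ := h.cast_le_two_pow
  refine ⟨fun x => ?_, fun a i => by simp [inputState]⟩
  simp only [inputState]
  split_ifs
  · rwa [Nat.abs_cast]
  · rwa [Nat.abs_cast]
  · simp

/-- Both products gain one factor per round, and the loop stops exactly when the numerator catches
up with the denominator, which `IsThreshold` places at round λ. Variable 2, zero in the input state,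
counts the rounds. -/
theorem Moderate.runs_thresholdProg (h : Moderate n m) (hl : IsThreshold n m lam) :
    ∃ s', Runs (bits n m) thresholdProg (inputState n m) (m ^ 2) s' ∧
      s'.var 0 = n ∧ s'.var 1 = m ∧ s'.var 2 = lam := by
  have hB := h.ten_le_bits
  have hnm := h.le
  have hn := h.large
  have hlam := hl.le
  have hs := h.small_inputState
  have r₁ := Runs.assign hB hs 3 (e := .var 0) (z := expNum n 0) (by decide)
    (by simp [Expr.eval, inputState, expNum]) (bits_expNum h (Nat.zero_le _)).1
  have r₂ := Runs.assign hB r₁.1 4 (e := .times (.lit 1024) (.var 1)) (z := expDen n m 0)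
    (by decide) (by simp [Expr.eval, inputState, expDen]) (bits_expNum h (Nat.zero_le _)).2
  obtain ⟨s', hr, hI⟩ := Runs.loop hB (e := .minus (.var 4) (.var 3))
    (p := .seq (.assign 3 (.times (.var 3)
        (.plus (.plus (.times (.lit 4) (.var 0)) (.times (.lit 2) (.var 2))) (.lit 1))))
      (.seq (.assign 4 (.times (.var 4)
        (.minus (.minus (.times (.lit 4) (.var 0)) (.times (.lit 2) (.var 2))) (.lit 1))))
        (.assign 2 (.plus (.var 2) (.lit 1))))) (Tb := 3) (by decide)
    (fun t s => s.var 0 = n ∧ s.var 1 = m ∧ s.var 2 = t ∧ s.var 3 = expNum n t ∧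
      s.var 4 = expDen n m t) (K := lam)
    (fun t ht s hI => by
      have := hl.lt t ht
      simp only [Expr.eval, hI.2.2.2.1, hI.2.2.2.2]
      linarith)
    (fun s hI => by
      have := hl.ge
      simp only [Expr.eval, hI.2.2.2.1, hI.2.2.2.2]
      linarith)
    (fun t ht s hs ⟨h0, h1, h2, h3, h4⟩ => by
      obtain ⟨b1, b2⟩ := bits_expNum h (t := t + 1) (by omega)
      have r₃ := Runs.assign hB hs 3 (e := .times (.var 3)
        (.plus (.plus (.times (.lit 4) (.var 0)) (.times (.lit 2) (.var 2))) (.lit 1)))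
        (z := expNum n (t + 1)) (by decide)
        (by simp only [Expr.eval, h0, h2, h3, expNum, Finset.prod_range_succ]; ring) b1
      have r₄ := Runs.assign hB r₃.1 4 (e := .times (.var 4)
        (.minus (.minus (.times (.lit 4) (.var 0)) (.times (.lit 2) (.var 2))) (.lit 1)))
        (z := expDen n m (t + 1)) (by decide)
        (by
          simp only [Expr.eval, State.setVar_var, h0, h2, h4, expDen,
            Finset.prod_range_succ, Nat.reduceEqDiff, if_false, OfNat.zero_ne_ofNat]
          ring) b2
      have r₅ := Runs.assign hB r₄.1 2 (e := .plus (.var 2) (.lit 1)) (z := (t + 1 : ℕ))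
        (by decide) (by simp [Expr.eval, h2]) (by
          rw [Nat.abs_cast]
          exact le_trans (by exact_mod_cast (show t + 1 ≤ n by omega)) h.cast_le_two_pow.1)
      exact ⟨_, (r₃.seq (r₄.seq r₅)).mono (by norm_num), by simp [h0, h1]⟩)
    r₂.1 (by simp [inputState])
  refine ⟨s', (r₁.seq (r₂.seq hr)).mono ?_, hI.1, hI.2.1, hI.2.2.1⟩
  have : 16 * m ≤ m ^ 2 := by rw [pow_two]; exact Nat.mul_le_mul_right _ (by omega)
  omega

theorem Moderate.runs_paramProg (h : Moderate n m) {s : State} (hs : Small (bits n m) s)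
    (h0 : s.var 0 = n) (h1 : s.var 1 = m) (h2 : s.var 2 = lam) :
    ∃ s', Runs (bits n m) paramProg s (m ^ 12) s' ∧ Params n m lam s' := by
  have hB := h.ten_le_bits
  have hnm := h.le
  have hn := h.large
  have hm := h.pos_right
  have P := h.paramsLe
  have hA : 0 ≤ scaleA n m := by linarith [P.one_le]
  have hD := scaleD_pos hm
  have hK := scaleK_pos hm
  have hE := scaleE_pos hm
  have hF := scaleF_pos h.pos_left hm
  have hn4 : 12 ≤ n ^ 4 + 12 := by omega
  have r₅ := Runs.assign hB hs 5 (e := (Expr.var 1).sq.sq) (z := scaleD m) (by decide)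
    (by simp only [Expr.eval, Expr.sq, h1, scaleD]; ring) (by
      rw [abs_of_pos hD]
      exact h.le_two_pow_bits (j := 1) (by simpa using P.D_le) (by omega))
  have r₆ := Runs.assign hB r₅.1 6 (e := .times (.times (.lit 2) (.var 1)) (Expr.var 5).sq)
    (z := scaleK m) (by decide)
    (by simp [Expr.eval, Expr.sq, h1, scaleK, pow_two]) (by
      rw [abs_of_pos hK]
      refine h.le_two_pow_bits (j := 4) ?_ (by omega)
      have := P.two_le
      have := P.m_le
      have := P.D_le
      calc scaleK m = 2 * m * scaleD m ^ 2 := rfl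
        _ ≤ scaleA n m * scaleA n m * scaleA n m ^ 2 := by gcongr
        _ = _ := by ring)
  have r₇ := Runs.assign hB r₆.1 7 (e := (Expr.var 1).sq.sq.sq)
    (z := reps m) (by decide)
    (by simp [Expr.eval, Expr.sq, h1, reps]; ring) (by
      rw [Nat.abs_cast]
      refine h.le_two_pow_bits (j := 8) ?_ (by omega)
      have := P.m_le
      rw [reps]
      push_cast
      gcongr)
  have hone : |(1 : ℤ)| ≤ 2 ^ bits n m := by simpa using one_le_pow₀ (by norm_num)
  have r₈ := Runs.assign hB r₇.1 8 (e := .lit 1) (z := 1) (by decide) rfl hone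
  have hN : ((reps m : ℕ) : ℤ) ≤ 2 ^ bits n m := by
    have := r₈.1.1 7
    simp only [State.setVar_var] at this
    exact (le_abs_self _).trans (by simpa using this)
  obtain ⟨s', hr, hI, hI8⟩ := Runs.forLoop hB (x := 14) (y := 7)
    (p := .assign 8 (.times (.var 8) (.var 6))) (Tb := 1)
    (fun k s' => (s'.var 0 = n ∧ s'.var 1 = m ∧ s'.var 2 = lam ∧ s'.var 5 = scaleD m ∧
      s'.var 6 = scaleK m ∧ s'.var 7 = reps m) ∧ s'.var 8 = scaleK m ^ k) hN r₈.1
    (fun k _ s' h => h.1.2.2.2.2.2)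
    (by simp [h0, h1, h2])
    (fun k hk s' hs' hx hI => by
      refine ⟨_, Runs.assign hB hs' 8 (z := scaleK m ^ (k + 1)) (by decide) ?_ ?_, by simp [hx], ?_⟩
      · simp [Expr.eval, hI, pow_succ]
      · rw [abs_of_pos (pow_pos hK _)]
        refine h.le_two_pow_bits (j := 1) ?_ (by omega)
        rw [pow_one]
        refine le_trans ?_ P.E_le
        exact pow_le_pow_right₀ (Int.add_one_le_iff.2 hK) hk
      · simp [hI])
  obtain ⟨i0, i1, i2, i5, i6, i7⟩ := hI
  have r₉ := Runs.assign hB hr.1 9 (e := .times (.times (Expr.var 0).sq (.var 8)) (.var 5))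
    (z := scaleF n m) (by decide) (by
      simp only [Expr.eval, Expr.sq, i0, i5, hI8, scaleF, scaleE]; ring) (by
      rw [abs_of_pos hF]
      refine h.le_two_pow_bits (j := 1) ?_ (by omega)
      rw [pow_one]
      linarith [P.F_le])
  have r₁₀ := Runs.assign hB r₉.1 10 (e := .times (Expr.var 0).sq (.var 0))
    (z := (n ^ 3 : ℕ)) (by decide) (by simp [Expr.eval, Expr.sq, i0]; ring) (by
      rw [Nat.abs_cast]
      refine h.le_two_pow_bits (j := 3) ?_ (by omega)
      have := P.n_le
      push_cast
      gcongr)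
  refine ⟨_, (r₅.seq (r₆.seq (r₇.seq (r₈.seq (hr.seq (r₉.seq r₁₀)))))).mono ?_, ?_⟩
  · have t1 : reps m * (1 + 2) + 2 ≤ m ^ 11 :=
      h.loop_le (a := 8) (b := 2) le_rfl (Nat.one_le_pow _ _ hm)
    have t2 : 1 ≤ m ^ 11 ∧ 1000 * m ^ 11 ≤ m ^ 12 := h.pow_le_pow_succ 11
    omega
  · constructor <;> simp [i0, i1, i2, i5, i6, i7, hI8, scaleE]

theorem Moderate.runs_mainProg (h : Moderate n m) (hl : IsThreshold n m lam) :
    ∃ s', Runs (bits n m) mainProg (inputState n m) (m ^ 28) s' ∧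
      ∀ j < m, ∀ l < n, s'.arr 0 (j * n + l) = table n m lam m j l := by
  have hB := h.ten_le_bits
  obtain ⟨s₁, hr₁, e0, e1, e2⟩ := h.runs_thresholdProg hl
  obtain ⟨s₂, hr₂, hP₂⟩ := h.runs_paramProg hr₁.1 e0 e1 e2
  obtain ⟨s₃, hr₃, hH₃⟩ := Runs.forLoop hB (x := 11) (y := 1) (p := rowProg) (Tb := m ^ 25)
    (fun k s' => Params n m lam s' ∧
      ∀ j < k, ∀ l < n, s'.arr 0 (j * n + l) = table n m lam k j l)
    h.cast_le_two_pow.2 hr₂.1 (fun k _ s' h => h.1.var_m)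
    ⟨hP₂.frame (Frame.setVar _ _ _), by simp⟩
    (fun k hk s' hs' hx hI => by
      have g : Setting n m lam k (table n m lam k) :=
        ⟨h, hl.le, hk.le, table_spec h hl k hk.le⟩
      obtain ⟨s'', hr, hF, hold, hnew⟩ := g.runs_rowProg hs' ⟨hI.1, hx, hI.2⟩
      refine ⟨s'', hr, (hF.1 11 (by decide)).trans hx,
        (hI.1.frame hF).frame (Frame.setVar _ _ _), fun j hj l hl' => ?_⟩
      rw [State.setVar_arr]
      rcases Nat.lt_succ_iff_lt_or_eq.1 hj with h' | rfl
      · rw [table_eq h' (Nat.le_succ k)]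
        exact hold j h' l hl'
      · rw [table_succ_self]
        exact hnew l hl')
  refine ⟨s₃, (hr₁.seq (hr₂.seq hr₃)).mono ?_, hH₃.2⟩
  have t1 : m * (m ^ 25 + 2) + 2 ≤ m ^ 27 := h.loop_le (a := 1) (b := 25) (by simp) le_rfl
  have t2 : 1 ≤ m ^ 27 ∧ 1000 * m ^ 27 ≤ m ^ 28 := h.pow_le_pow_succ 27
  have t3 : m ^ 2 ≤ m ^ 27 := Nat.pow_le_pow_right h.pos_right (by norm_num)
  have t4 : m ^ 12 ≤ m ^ 27 := Nat.pow_le_pow_right h.pos_right (by norm_num)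
  omega

/-- There are at most m²⁸ commands, each costing at most 4000(bits + 1) ≤ m · m¹⁶, so m⁴⁵ suffices
and 50 leaves slack. -/
theorem Moderate.exec_mainProg (h : Moderate n m) (hl : IsThreshold n m lam) :
    ∃ t s', Exec mainProg (inputState n m) t s' ∧ t ≤ m ^ 50 ∧
      ∀ j < m, ∀ l < n, s'.arr 0 (j * n + l) = table n m lam m j l := by
  obtain ⟨s', ⟨-, t, ht, htT⟩, hH⟩ := h.runs_mainProg hl
  refine ⟨t, s', ht, htT.trans ?_, hH⟩
  have hnm := h.le
  have hn := h.large
  have hm := h.pos_right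
  have hb : bits n m + 1 ≤ m ^ 16 := by
    have h4 : n ^ 4 + 12 ≤ m ^ 5 := by
      have : 1 ≤ m ^ 4 ∧ 1000 * m ^ 4 ≤ m ^ 5 := h.pow_le_pow_succ 4
      have : n ^ 4 ≤ m ^ 4 := Nat.pow_le_pow_left (by omega) 4
      omega
    have h5 : 1 ≤ m ^ 15 := Nat.one_le_pow _ _ hm
    calc bits n m + 1 ≤ 20 * m ^ 9 * m ^ 5 + m ^ 14 := by
          unfold bits
          gcongr
          exact Nat.one_le_pow _ _ hm
      _ = 21 * m ^ 14 := by ring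
      _ ≤ m ^ 2 * m ^ 14 := by gcongr; nlinarith
      _ = m ^ 16 := by ring
  calc m ^ 28 * (4000 * (bits n m + 1)) ≤ m ^ 28 * (m * m ^ 16) := by
        gcongr
        omega
    _ = m ^ 45 := by ring
    _ ≤ m ^ 50 := Nat.pow_le_pow_right hm (by norm_num)

end Run


/-! ### Normalized output vectors and the final estimates -/

section Output

open scoped RealInnerProductSpace

/-- Both squared norms are at least q, so the product of the norms is at least q. The loss is thus
one factor q; a ≥ 0 is needed because the inner product may be negative. -/
theorem inner_normalize_le {E : Type*} [NormedAddCommGroup E] [InnerProductSpace ℝ E] {x y : E}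
    {q a : ℝ} (hq : 0 < q) (hx : q ≤ ‖x‖ ^ 2) (hy : q ≤ ‖y‖ ^ 2) (ha : 0 ≤ a) (h : ⟪x, y⟫ ≤ a) :
    ⟪‖x‖⁻¹ • x, ‖y‖⁻¹ • y⟫ ≤ a / q := by
  have h1 : q ≤ ‖x‖ * ‖y‖ := by
    refine le_of_sq_le_sq ?_ (by positivity)
    rw [mul_pow, pow_two]
    exact mul_le_mul hx hy hq.le (by positivity)
  rw [real_inner_smul_left, real_inner_smul_right, ← mul_assoc, ← mul_inv, inv_mul_eq_div]
  exact div_le_div₀ ha h hq h1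

theorem normalize_smul {E : Type*} [NormedAddCommGroup E] [NormedSpace ℝ E] {c : ℝ} (hc : 0 < c)
    (x : E) : ‖c • x‖⁻¹ • c • x = ‖x‖⁻¹ • x := by
  rw [norm_smul, Real.norm_of_nonneg hc.le, smul_smul, mul_inv, mul_right_comm,
    inv_mul_cancel₀ hc.ne', one_mul]

variable {n m lam : ℕ}

/-- Since m ≥ 2n the square root is at least 1, and m ≥ n: the bound from m caps is stronger than
required. -/
theorem Moderate.le_capDensity (h : Moderate n m) :
    1 / 5 * ((n : ℝ) / (2 ^ n * Real.sqrt (Real.logb 2 ((m : ℝ) / n)))) ≤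
      m * (1 / 5 * (1 / 2) ^ n) := by
  have hn : (0 : ℝ) < n := by exact_mod_cast h.pos_left
  have hm : (0 : ℝ) < m := by exact_mod_cast h.pos_right
  have hnm := h.cast_le
  have h1 : 1 ≤ Real.sqrt (Real.logb 2 ((m : ℝ) / n)) := by
    rw [Real.one_le_sqrt, Real.le_logb_iff_rpow_le (by norm_num) (by positivity), Real.rpow_one,
      le_div_iff₀ hn]
    linarith
  calc 1 / 5 * ((n : ℝ) / (2 ^ n * Real.sqrt (Real.logb 2 ((m : ℝ) / n))))
      ≤ 1 / 5 * (m / (2 ^ n * 1)) := by gcongr; have := h.le; omega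
    _ = _ := by rw [one_div_pow]; field_simp

theorem Moderate.exists_output (h : Moderate n m) :
    ∃ (t : ℕ) (s : State) (v : Fin m → Sphere n),
      Exec mainProg (inputState n m) t s ∧ t ≤ m ^ 50 ∧ IsOutput s v ∧
      ∀ i j, i ≠ j → ⟪(v i : EuclideanSpace ℝ (Fin n)), (v j : EuclideanSpace ℝ (Fin n))⟫ ≤
        Real.sqrt (2 * Real.log (m / n) / n) * (1 + 30 / Real.logb 2 (m / n)) := by
  obtain ⟨lam, hl⟩ := h.exists_isThreshold
  obtain ⟨t, s, hexec, ht, hs⟩ := h.exec_mainProg hl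
  have hL := h.log_ge
  have hq : 0 < 1 - 2 / (5 * Real.log ((m : ℝ) / n)) := by
    rw [sub_pos, div_lt_one (by linarith)]
    linarith
  have hD : (0 : ℝ) < (scaleD m : ℝ)⁻¹ := inv_pos.2 (by exact_mod_cast scaleD_pos h.pos_right)
  have hout : ∀ i : Fin m, outputVec s n i = vec n (table n m lam m i) := fun i => by
    ext l
    simp [outputVec, hs i i.2 l l.2]
  have hne : ∀ i : Fin m, outputVec s n i ≠ 0 := fun i e => by
    have h1 := norm_table_ge h hl i.2
    rw [pt, ← hout, e] at h1
    simp only [smul_zero, norm_zero] at h1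
    linarith
  refine ⟨t, s, fun i => ⟨‖outputVec s n i‖⁻¹ • outputVec s n i, by
    rw [mem_sphere_zero_iff_norm, norm_smul, norm_inv, norm_norm,
      inv_mul_cancel₀ (norm_ne_zero_iff.2 (hne i))]⟩, hexec, ht, fun i => ⟨hne i, rfl⟩,
    fun i j hij => ?_⟩
  refine le_trans ?_ (hl.bound_le h)
  simp only [hout]
  rw [← normalize_smul hD (vec n (table n m lam m i)),
    ← normalize_smul hD (vec n (table n m lam m j))]
  exact inner_normalize_le hq (norm_table_ge h hl i.2) (norm_table_ge h hl j.2) (by positivity)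
    (inner_table_le h hl i.2 j.2 fun e => hij (Fin.ext e))

end Output

end SpherePacking

theorem mainTheorem7 :
    ∃ (A : SpherePacking.Prog) (k : ℕ) (C c : ℝ), 0 < c ∧
      ∀ (m : ℕ → ℕ) (f : ℕ → ℝ),
        f =o[atTop] (fun n : ℕ => Real.sqrt (n : ℝ)) →
        (∀ᶠ n : ℕ in atTop, 16 * n ≤ m n ∧ (m n : ℝ) ≤ (2 : ℝ) ^ (f n)) →
        ∀ᶠ n : ℕ in atTop,
          ∃ (t : ℕ) (s : SpherePacking.State) (v : Fin (m n) → SpherePacking.Sphere n),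
            SpherePacking.Exec A (SpherePacking.inputState n (m n)) t s ∧
            t ≤ k * (m n + n) ^ k ∧
            SpherePacking.IsOutput s v ∧
            (∀ i j : Fin (m n), i ≠ j →
              inner ℝ (v i : EuclideanSpace ℝ (Fin n)) (v j : EuclideanSpace ℝ (Fin n)) ≤
                Real.sqrt (2 * Real.log ((m n : ℝ) / (n : ℝ)) / (n : ℝ)) *
                  (1 + C / Real.logb 2 ((m n : ℝ) / (n : ℝ)))) ∧
            ∃ r : ℝ, SpherePacking.IsMaxPackingRadius v r ∧
              c * ((n : ℝ) / (2 ^ n * Real.sqrt (Real.logb 2 ((m n : ℝ) / (n : ℝ))))) ≤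
                SpherePacking.capDensity v r := by
  -- The exponent 50 is that of the time bound, 30 is the constant of `IsThreshold.bound_le`, and
  -- 1/5 is the determinant factor of the ellipsoid in `vol_cap_ge`.
  refine ⟨SpherePacking.mainProg, 50, 30, 1 / 5, by norm_num, fun m f hf hm => ?_⟩
  filter_upwards [SpherePacking.eventually_moderate hf hm] with n h
  obtain ⟨t, s, v, hexec, ht, hout, hin⟩ := h.exists_output
  have hn := h.large
  have hnm := h.le
  obtain ⟨r, hr, hd⟩ := SpherePacking.exists_isMaxPackingRadius_capDensity_ge h.pos_left
    (by omega) v fun i j hij => (hin i j hij).trans_lt h.bound_lt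
  refine ⟨t, s, v, hexec, ht.trans ?_, hout, hin, r, hr, h.le_capDensity.trans hd⟩
  calc m n ^ 50 ≤ (m n + n) ^ 50 := Nat.pow_le_pow_left (by omega) 50
    _ ≤ 50 * (m n + n) ^ 50 := Nat.le_mul_of_pos_left _ (by norm_num)
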